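/- Let $X$ be a compact Kähler manifold of complex dimension $n\ge 1$ with Kähler form $\omega=\sqrt{-1}\sum g_{\alpha\bar\beta}\,dz^\alpha\wedge d\bar z^\beta$ and $\mathrm{Vol}\,X=\int_X\omega^n/n!$. Let $\mathfrak E=(E,\phi)$ be a Higgs bundle over $X$: a holomorphic vector bundle $E$ of rank $r\ge 1$ together with a holomorphic $\mathrm{End}\,E$-valued $(1,0)$-form $\phi$ with $\phi\wedge\phi=0$. Put $\deg\mathfrak E=\int_X c_1(E)\wedge\omega^{n-1}$, where $c_1(E)$ stands for any closed $2$-form representing the first Chern class of $E$; the integral does not depend on its choice. For a smooth Hermitian metric $h$ on $E$ let $D_h$ be the Chern connection of $(E,h)$, $\phi^*_h$ the $h$-adjoint of $\phi$, $\mathcal R_h$ the curvature of the Hitchin--Simpson connection $D_h+\phi+\phi^*_h$, and $\mathcal K_h=\sqrt{-1}\,\Lambda\mathcal R_h\in\Gamma(\mathrm{End}\,E)$, where $\Lambda$ is the adjoint of $\omega\wedge\cdot$ (in a local frame, $(\mathcal K_h)^i_j=\sum g^{\alpha\bar\beta}(\mathcal R_h)^i_{j\alpha\bar\beta}$). Put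 $|\mathcal K_h|^2=\mathrm{tr}(\mathcal K_h\circ(\mathcal K_h)^*_h)$ and $$\mathcal J(h)=\frac12\int_X|\mathcal K_h|^2\,\omega^n .$$ Then for every Hermitian metric $h$ on $E$ $$\mathcal J(h)\ \ge\ \mathcal C:=\frac{2n\,(\pi\deg\mathfrak E)^2}{r\,(n-1)!\,\mathrm{Vol}\,X}.$$ The constant $\mathcal C$ depends only on the rank and the first Chern class (in real de Rham cohomology) of $E$ and on the cohomology class of $\omega$: if $E'$ is another holomorphic vector bundle of rank $r$ on $X$ with $c_1(E')=c_1(E)$ and $\omega'$ is another Kähler form on $X$ with $[\omega']=[\omega]$, then the constants defined by $(E',\omega')$ and by $(E,\omega)$ are equal. Moreover, for a Hermitian metric $h_0$ on $E$, $\mathcal J(h_0)=\mathcal C$ if and only if $h_0$ is a Hermite--Yang--Mills metric, i.e. $\mathcal K_{h_0}=c\,I$ with $$c=\frac{2\pi n\deg\mathfrak E}{r\,n!\,\mathrm{Vol}\,X}.$$ -/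

import Mathlib

open scoped Manifold ContDiff
open Bundle

noncomputable section

namespace HiggsKaehler

/-! ## Complex manifolds, real differential forms and integration

A complex manifold of dimension `n` is a space `X` charted on `ℂⁿ = Fin n → ℂ` with holomorphic
changes of charts, `[IsManifold 𝓘(ℂ, Fin n → ℂ) ω X]`. Real smooth objects on `X` use the same
charts with the real model `𝓘(ℝ, Fin n → ℂ)`. The tangent space at `x` is `ℂⁿ`, identified through
the preferred chart at `x`. -/

/-- A complex manifold is a smooth real manifold. -/
theorem isManifold_real (n : ℕ) (X : Type*) [TopologicalSpace X] [ChartedSpace (Fin n → ℂ) X]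
    [IsManifold 𝓘(ℂ, Fin n → ℂ) ω X] : IsManifold 𝓘(ℝ, Fin n → ℂ) ∞ X := by
  refine isManifold_of_contDiffOn _ _ _ fun e e' he he' => ?_
  have h := (contDiffGroupoid ω 𝓘(ℂ, Fin n → ℂ)).compatible he he'
  rw [contDiffGroupoid, mem_groupoid_of_pregroupoid] at h
  exact (ContDiffOn.restrict_scalars ℝ h.1).of_le le_top

section Forms

variable {n : ℕ} {X : Type*} [TopologicalSpace X] [ChartedSpace (Fin n → ℂ) X]

variable (n X) in
/-- Real differential `k`-forms on `X` (smoothness is the separate predicate `DForm.IsSmooth`). -/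
abbrev DForm (k : ℕ) : Type _ :=
  ∀ x : X, TangentSpace 𝓘(ℝ, Fin n → ℂ) x [⋀^Fin k]→L[ℝ] ℝ

/-- The expression of a form in a chart: its pullback by the inverse of the chart. -/
def DForm.inChart {k : ℕ} (α : DForm n X k) (c : OpenPartialHomeomorph X (Fin n → ℂ))
    (y : Fin n → ℂ) : (Fin n → ℂ) [⋀^Fin k]→L[ℝ] ℝ :=
  (α (c.symm y)).compContinuousLinearMap
    (mfderiv 𝓘(ℝ, Fin n → ℂ) 𝓘(ℝ, Fin n → ℂ) c.symm y)

/-- A form is smooth if its expression in every chart of the atlas is smooth. -/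
def DForm.IsSmooth {k : ℕ} (α : DForm n X k) : Prop :=
  ∀ c ∈ atlas (Fin n → ℂ) X, ContDiffOn ℝ ∞ (α.inChart c) c.target

/-- The exterior derivative of a form, computed at `x` in the preferred chart at `x`. -/
def DForm.d {k : ℕ} (α : DForm n X k) : DForm n X (k + 1) := fun x =>
  (extDeriv (α.inChart (chartAt (Fin n → ℂ) x)) (chartAt (Fin n → ℂ) x x)).compContinuousLinearMap
    (mfderiv 𝓘(ℝ, Fin n → ℂ) 𝓘(ℝ, Fin n → ℂ) (chartAt (Fin n → ℂ) x) x)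

/-- Two `2`-forms are cohomologous if they differ by the exterior derivative of a smooth
`1`-form. -/
def Cohomologous (α β : DForm n X 2) : Prop :=
  ∃ η : DForm n X 1, η.IsSmooth ∧ ∀ x, β x = α x + η.d x

variable (n X) in
/-- Forms of top degree `2n`; it is convenient to number their `2n` arguments by pairs in
`Fin n × Fin 2`, in lexicographic order. -/
abbrev TopForm : Type _ :=
  ∀ x : X, TangentSpace 𝓘(ℝ, Fin n → ℂ) x [⋀^(Fin n × Fin 2)]→ₗ[ℝ] ℝ

theorem update_pair_self {n : ℕ} {T : Type*} [DecidableEq (Fin n × Fin 2)]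
    (v : Fin n × Fin 2 → T) (k₀ : Fin n) (j₀ : Fin 2) (t : T) :
    (fun j => Function.update v (k₀, j₀) t (k₀, j)) =
      Function.update (fun j => v (k₀, j)) j₀ t := by
  funext j
  by_cases hj : j = j₀
  · subst hj; simp
  · simp [hj]

theorem update_pair_of_mem_erase {n : ℕ} {T : Type*} [AddCommGroup T] [Module ℝ T]
    [TopologicalSpace T] [DecidableEq (Fin n × Fin 2)] (β : Fin n → T [⋀^Fin 2]→L[ℝ] ℝ)
    (v : Fin n × Fin 2 → T) (k₀ : Fin n) (j₀ : Fin 2) (t : T) :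
    ∀ k ∈ Finset.univ.erase k₀,
      (β k fun j => Function.update v (k₀, j₀) t (k, j)) = β k fun j => v (k, j) := by
  intro k hk
  congr 1
  funext j
  exact Function.update_of_ne (fun h => Finset.ne_of_mem_erase hk (congrArg Prod.fst h)) _ _

/-- The tensor product `β₁ ⊗ ⋯ ⊗ βₙ` of `n` bilinear alternating maps. -/
def tensorTwoForms {n : ℕ} {T : Type*} [AddCommGroup T] [Module ℝ T] [TopologicalSpace T]
    (β : Fin n → T [⋀^Fin 2]→L[ℝ] ℝ) : MultilinearMap ℝ (fun _ : Fin n × Fin 2 => T) ℝ where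
  toFun v := ∏ k, β k fun j => v (k, j)
  map_update_add' v i a b := by
    obtain ⟨k₀, j₀⟩ := i
    simp only [← Finset.mul_prod_erase _ _ (Finset.mem_univ k₀), update_pair_self]
    rw [Finset.prod_congr rfl (update_pair_of_mem_erase β v k₀ j₀ a),
      Finset.prod_congr rfl (update_pair_of_mem_erase β v k₀ j₀ b),
      Finset.prod_congr rfl (update_pair_of_mem_erase β v k₀ j₀ (a + b))]
    simp [add_mul]
  map_update_smul' v i t a := by
    obtain ⟨k₀, j₀⟩ := i
    simp only [← Finset.mul_prod_erase _ _ (Finset.mem_univ k₀), update_pair_self]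
    rw [Finset.prod_congr rfl (update_pair_of_mem_erase β v k₀ j₀ a),
      Finset.prod_congr rfl (update_pair_of_mem_erase β v k₀ j₀ (t • a))]
    simp [mul_assoc]

/-- The wedge product `β₁ ∧ ⋯ ∧ βₙ` of `n` forms of degree `2` on an `n`-dimensional complex
manifold,
`(v_q) ↦ 2⁻ⁿ ∑_σ sign(σ) ∏_k β_k (v_{σ(k,0)}, v_{σ(k,1)})`, the sum being over the permutations
of the index set `Fin n × Fin 2`. -/
def wedge (β : Fin n → DForm n X 2) : TopForm n X := fun x =>
  (1 / 2 : ℝ) ^ n • (tensorTwoForms fun k => β k x).alternatization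

/-- The `n`-th exterior power `αⁿ` of a `2`-form `α`. -/
def topPower (α : DForm n X 2) : TopForm n X := wedge fun _ => α

/-- `β ∧ αⁿ⁻¹` for `2`-forms `β`, `α` (and `n ≥ 1`). -/
def wedgePower (β α : DForm n X 2) : TopForm n X :=
  wedge fun k => if (k : ℕ) = 0 then β else α

/-- The positively oriented real basis `e₁, √-1 e₁, …, eₙ, √-1 eₙ` of `ℂⁿ`. -/
def realBasis (n : ℕ) (q : Fin n × Fin 2) : Fin n → ℂ :=
  Pi.single q.1 (if q.2 = 0 then 1 else Complex.I)

/-- The coefficient `f` of a top form written as `f dx₁ ∧ dy₁ ∧ ⋯ ∧ dxₙ ∧ dyₙ` in a chart. -/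
def TopForm.coeff (τ : TopForm n X) (c : OpenPartialHomeomorph X (Fin n → ℂ))
    (y : Fin n → ℂ) : ℝ :=
  τ (c.symm y) fun q => mfderiv 𝓘(ℝ, Fin n → ℂ) 𝓘(ℝ, Fin n → ℂ) c.symm y (realBasis n q)

variable (n X) in
/-- A smooth partition of unity subordinate to the charts of `X`. -/
def chartPartition [IsManifold 𝓘(ℂ, Fin n → ℂ) ω X] [T2Space X] [SigmaCompactSpace X] :
    SmoothPartitionOfUnity X 𝓘(ℝ, Fin n → ℂ) X :=
  haveI := isManifold_real n X
  (SmoothPartitionOfUnity.exists_isSubordinate_chartAt_source 𝓘(ℝ, Fin n → ℂ) X).choose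

/-- The integral of a top form over a complex manifold with its complex orientation:
`∫_X τ = ∑_p ∫ ρ_p τ`, where `ρ` is a partition of unity subordinate to the charts. -/
def TopForm.integral [IsManifold 𝓘(ℂ, Fin n → ℂ) ω X] [T2Space X] [SigmaCompactSpace X]
    (τ : TopForm n X) : ℝ :=
  ∑ᶠ p : X, ∫ y in (chartAt (Fin n → ℂ) p).target,
    chartPartition n X p ((chartAt (Fin n → ℂ) p).symm y) * τ.coeff (chartAt (Fin n → ℂ) p) y

end Forms

/-! ## Hermitian holomorphic vector bundles -/

section Bundles

variable {n : ℕ} {X : Type*} [TopologicalSpace X] [ChartedSpace (Fin n → ℂ) X]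
  {r : ℕ} {E : X → Type*} [∀ x, AddCommGroup (E x)] [∀ x, Module ℂ (E x)]
  [∀ x, TopologicalSpace (E x)] [TopologicalSpace (TotalSpace (Fin r → ℂ) E)]
  [FiberBundle (Fin r → ℂ) E] [VectorBundle ℂ (Fin r → ℂ) E]

/-- The `j`-th vector of the frame of `E` given by a local trivialization. The trivializations in
the atlas of a holomorphic vector bundle give holomorphic frames. -/
def frame (e : Trivialization (Fin r → ℂ) (π (Fin r → ℂ) E)) [MemTrivializationAtlas e]
    (x : X) (j : Fin r) : E x :=
  e.symmL ℂ x (Pi.single j 1)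

/-- The matrix of an endomorphism of `E x` in the frame given by a local trivialization. -/
def endMatrix (e : Trivialization (Fin r → ℂ) (π (Fin r → ℂ) E)) [MemTrivializationAtlas e]
    (x : X) (f : Module.End ℂ (E x)) : Matrix (Fin r) (Fin r) ℂ :=
  Matrix.of fun i j => e.continuousLinearMapAt ℂ x (f (frame e x j)) i

/-- The endomorphism of `E x` with a given matrix in the frame given by a local trivialization. -/
def endOfMatrix (e : Trivialization (Fin r → ℂ) (π (Fin r → ℂ) E)) [MemTrivializationAtlas e]
    (x : X) (M : Matrix (Fin r) (Fin r) ℂ) : Module.End ℂ (E x) :=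
  (e.symmL ℂ x : (Fin r → ℂ) →ₗ[ℂ] E x) ∘ₗ Matrix.toLin' M ∘ₗ
    (e.continuousLinearMapAt ℂ x : E x →ₗ[ℂ] (Fin r → ℂ))

variable (n r E) in
/-- A smooth Hermitian metric on a complex vector bundle of rank `r`. It is conjugate linear in the
*first* variable and linear in the second one. -/
structure HermitianMetric where
  form : ∀ x, E x →ₗ⋆[ℂ] E x →ₗ[ℂ] ℂ
  conj_symm : ∀ x u v, starRingEnd ℂ (form x v u) = form x u v
  pos : ∀ x u, u ≠ 0 → 0 < (form x u u).re
  smooth : ∀ (e : Trivialization (Fin r → ℂ) (π (Fin r → ℂ) E)) [MemTrivializationAtlas e]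
    (i j : Fin r), ContMDiffOn 𝓘(ℝ, Fin n → ℂ) 𝓘(ℝ, ℂ) ∞
      (fun x => form x (frame e x i) (frame e x j)) e.baseSet

/-- Every endomorphism of a fibre has an adjoint with respect to a Hermitian metric. -/
theorem HermitianMetric.exists_adjoint (h : HermitianMetric n r E) (x : X)
    (f : Module.End ℂ (E x)) :
    ∃ f' : Module.End ℂ (E x), ∀ u v, h.form x (f' u) v = h.form x u (f v) := by
  let core : InnerProductSpace.Core ℂ (E x) :=
    { inner := fun u v => h.form x u v
      conj_inner_symm := h.conj_symm x
      re_inner_nonneg := fun u => by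
        by_cases hu : u = 0
        · simp [hu]
        · exact (h.pos x u hu).le
      add_left := fun u v w => by simp
      smul_left := fun u v a => by simp
      definite := fun u hu => by
        by_contra hne
        have := h.pos x u hne
        rw [show h.form x u u = 0 from hu] at this
        simp at this }
  have : FiniteDimensional ℂ (E x) :=
    ((trivializationAt (Fin r → ℂ) E x).continuousLinearEquivAt ℂ x
      (mem_baseSet_trivializationAt _ _ x)).symm.toLinearEquiv.finiteDimensional
  let _ : NormedAddCommGroup (E x) := core.toNormedAddCommGroup
  let _ : InnerProductSpace ℂ (E x) := InnerProductSpace.ofCore core.toCore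
  exact ⟨LinearMap.adjoint f, fun u v => LinearMap.adjoint_inner_left f v u⟩

/-- The adjoint of an endomorphism of a fibre: `h(f* u, v) = h(u, f v)`. -/
def HermitianMetric.adjoint (h : HermitianMetric n r E) (x : X) (f : Module.End ℂ (E x)) :
    Module.End ℂ (E x) :=
  (h.exists_adjoint x f).choose

/-- The pointwise square norm `|f|² = tr (f ∘ f*)`, which is a real number. -/
def HermitianMetric.normSq (h : HermitianMetric n r E) (x : X) (f : Module.End ℂ (E x)) : ℝ :=
  (LinearMap.trace ℂ (E x) (f * h.adjoint x f)).re

/-- The Gram matrix `G i j = h(eᵢ, eⱼ)` of a Hermitian metric in the frame given by a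
trivialization, as a function of the coordinates given by a chart. -/
def HermitianMetric.gram (h : HermitianMetric n r E) (c : OpenPartialHomeomorph X (Fin n → ℂ))
    (e : Trivialization (Fin r → ℂ) (π (Fin r → ℂ) E)) [MemTrivializationAtlas e]
    (y : Fin n → ℂ) : Matrix (Fin r) (Fin r) ℂ :=
  Matrix.of fun i j => h.form (c.symm y) (frame e (c.symm y) i) (frame e (c.symm y) j)

/-- The `(1,0)`-part `∂f` of the differential of a function: `∂f(v) = (df(v) - √-1 df(√-1 v)) / 2`. -/
def delHol (f : (Fin n → ℂ) → ℂ) (y v : Fin n → ℂ) : ℂ :=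
  (fderiv ℝ f y v - Complex.I * fderiv ℝ f y (Complex.I • v)) / 2

/-- The matrix of the Chern connection `D_h = D'_h + D''` in a holomorphic frame: it is the matrix
`A` of `1`-forms with `D_h eⱼ = ∑ᵢ Aᵢⱼ eᵢ`. Since `D'' = ∂̄` annihilates the frame, `A` has type
`(1,0)`, and compatibility with the metric, `dG = A^* G + G A`, gives `A = G⁻¹ ∂G`. -/
def HermitianMetric.chernConnection (h : HermitianMetric n r E)
    (c : OpenPartialHomeomorph X (Fin n → ℂ))
    (e : Trivialization (Fin r → ℂ) (π (Fin r → ℂ) E)) [MemTrivializationAtlas e]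
    (y v : Fin n → ℂ) : Matrix (Fin r) (Fin r) ℂ :=
  (h.gram c e y)⁻¹ * Matrix.of fun i j => delHol (fun z => h.gram c e z i j) y v

/-- The matrix `dB + B ∧ B` of the curvature of the connection `d + B`. -/
def curvatureMatrix (B : (Fin n → ℂ) → (Fin n → ℂ) → Matrix (Fin r) (Fin r) ℂ)
    (y u v : Fin n → ℂ) : Matrix (Fin r) (Fin r) ℂ :=
  (Matrix.of fun i j => fderiv ℝ (fun z => B z v i j) y u - fderiv ℝ (fun z => B z u i j) y v)
    + (B y u * B y v - B y v * B y u)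

/-- The `End E`-valued curvature `2`-form of a connection on `E` which has the matrix `B c e` with
respect to a chart `c` and a trivialization `e`. -/
def curvature (B : OpenPartialHomeomorph X (Fin n → ℂ) →
      ∀ e : Trivialization (Fin r → ℂ) (π (Fin r → ℂ) E), [MemTrivializationAtlas e] →
        (Fin n → ℂ) → (Fin n → ℂ) → Matrix (Fin r) (Fin r) ℂ)
    (x : X) (u v : TangentSpace 𝓘(ℝ, Fin n → ℂ) x) : Module.End ℂ (E x) :=
  endOfMatrix (trivializationAt (Fin r → ℂ) E x) x
    (curvatureMatrix (B (chartAt (Fin n → ℂ) x) (trivializationAt (Fin r → ℂ) E x))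
      (chartAt (Fin n → ℂ) x x)
      (mfderiv 𝓘(ℝ, Fin n → ℂ) 𝓘(ℝ, Fin n → ℂ) (chartAt (Fin n → ℂ) x) x u)
      (mfderiv 𝓘(ℝ, Fin n → ℂ) 𝓘(ℝ, Fin n → ℂ) (chartAt (Fin n → ℂ) x) x v))

/-- The curvature `R_h = D_h ∘ D_h` of the Chern connection. -/
def HermitianMetric.chernCurvature (h : HermitianMetric n r E) (x : X)
    (u v : TangentSpace 𝓘(ℝ, Fin n → ℂ) x) : Module.End ℂ (E x) :=
  curvature (fun c e => h.chernConnection c e) x u v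

variable (n r E) in
/-- A (real, closed) `2`-form `β` represents the first Chern class `c₁(E)` (in the sense of
Chern and Weil) if for some Hermitian metric `h` on `E` it differs from `(√-1 / 2π) tr R_h` by the
exterior derivative of a smooth `1`-form. -/
def RepresentsFirstChernClass (β : DForm n X 2) : Prop :=
  ∃ (h : HermitianMetric n r E) (η : DForm n X 1), η.IsSmooth ∧
    ∀ (x : X) (u v : TangentSpace 𝓘(ℝ, Fin n → ℂ) x),
      ((β x ![u, v] : ℝ) : ℂ) = Complex.I / (2 * Real.pi) *
        LinearMap.trace ℂ (E x) (h.chernCurvature x u v) + ((η.d x ![u, v] : ℝ) : ℂ)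

variable (n r E) in
/-- A Higgs field on a holomorphic vector bundle `E`: a holomorphic `End E`-valued `(1,0)`-form `φ`
with `φ ∧ φ = 0`. -/
structure HiggsField where
  toFun : ∀ x : X, TangentSpace 𝓘(ℂ, Fin n → ℂ) x →ₗ[ℂ] Module.End ℂ (E x)
  holomorphic : ∀ c ∈ atlas (Fin n → ℂ) X,
    ∀ (e : Trivialization (Fin r → ℂ) (π (Fin r → ℂ) E)) [MemTrivializationAtlas e]
      (v : Fin n → ℂ) (i j : Fin r), DifferentiableOn ℂ
        (fun y => endMatrix e (c.symm y)
          (toFun (c.symm y) (mfderiv 𝓘(ℂ, Fin n → ℂ) 𝓘(ℂ, Fin n → ℂ) c.symm y v)) i j)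
        (c.target ∩ c.symm ⁻¹' e.baseSet)
  wedge_self : ∀ (x : X) (u v : TangentSpace 𝓘(ℂ, Fin n → ℂ) x),
    toFun x u * toFun x v - toFun x v * toFun x u = 0

/-- The matrix of the Hitchin–Simpson connection `D_h + φ + φ*_h` in a holomorphic frame. -/
def HiggsField.hsConnection (φ : HiggsField n r E) (h : HermitianMetric n r E)
    (c : OpenPartialHomeomorph X (Fin n → ℂ))
    (e : Trivialization (Fin r → ℂ) (π (Fin r → ℂ) E)) [MemTrivializationAtlas e]
    (y v : Fin n → ℂ) : Matrix (Fin r) (Fin r) ℂ :=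
  let Φ := φ.toFun (c.symm y) (mfderiv 𝓘(ℂ, Fin n → ℂ) 𝓘(ℂ, Fin n → ℂ) c.symm y v)
  h.chernConnection c e y v + endMatrix e (c.symm y) Φ
    + endMatrix e (c.symm y) (h.adjoint (c.symm y) Φ)

/-- The Hitchin–Simpson curvature. -/
def HiggsField.hsCurvature (φ : HiggsField n r E) (h : HermitianMetric n r E) (x : X)
    (u v : TangentSpace 𝓘(ℝ, Fin n → ℂ) x) : Module.End ℂ (E x) :=
  curvature (fun c e => φ.hsConnection h c e) x u v

end Bundles

/-! ## Kähler metrics and the Kobayashi functional -/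

section Kaehler

variable {n : ℕ} {X : Type*} [TopologicalSpace X] [ChartedSpace (Fin n → ℂ) X]
  [IsManifold 𝓘(ℂ, Fin n → ℂ) ω X]

variable (n X) in
/-- A Hermitian metric on `X` is a Hermitian metric on its holomorphic tangent bundle. -/
abbrev HermitianStructure : Type _ :=
  HermitianMetric n n (fun x : X => TangentSpace 𝓘(ℂ, Fin n → ℂ) x)

/-- The alternating real bilinear map `(u, v) ↦ 2 Im B(u, v)` given by a Hermitian form on `ℂⁿ`. -/
def twoImForm (B : (Fin n → ℂ) →ₗ⋆[ℂ] (Fin n → ℂ) →ₗ[ℂ] ℂ)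
    (hB : ∀ u v, starRingEnd ℂ (B v u) = B u v) : (Fin n → ℂ) [⋀^Fin 2]→L[ℝ] ℝ where
  toFun v := 2 * (B (v 0) (v 1)).im
  map_update_add' v i a b := by
    fin_cases i <;> simp <;> ring
  map_update_smul' v i t a := by
    have hl : ∀ u w, B (t • u) w = t * B u w := fun u w => by
      rw [← Complex.coe_smul, LinearMap.map_smulₛₗ]; simp
    have hr : ∀ u w, B u (t • w) = t * B u w := fun u w => by
      rw [← Complex.coe_smul, LinearMap.map_smul]; simp
    fin_cases i <;> simp [hl, hr] <;> ring
  map_eq_zero_of_eq' v i j hv hij := by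
    have hsame : ∀ u, (B u u).im = 0 := fun u => Complex.conj_eq_iff_im.mp (hB u u)
    fin_cases i <;> fin_cases j <;> simp_all
  cont := by
    have hexp : ∀ v : Fin 2 → Fin n → ℂ, B (v 0) (v 1) =
        ∑ i, ∑ j, starRingEnd ℂ (v 0 i) * (v 1 j * B (Pi.single i 1) (Pi.single j 1)) := by
      intro v
      conv_lhs => rw [pi_eq_sum_univ' (v 0), pi_eq_sum_univ' (v 1)]
      simp only [map_sum, LinearMap.map_smulₛₗ, LinearMap.sum_apply, LinearMap.smul_apply,
        RingHom.id_apply, smul_eq_mul, Finset.mul_sum]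
      rw [Finset.sum_comm]
      exact Finset.sum_congr rfl fun i _ => Finset.sum_congr rfl fun j _ => mul_left_comm _ _ _
    simp only [hexp]
    fun_prop

/-- The Kähler form `√-1 ∑ g_{αβ̄} dz^α ∧ dz̄^β` of a Hermitian metric `g` on `X`, where
`g_{αβ̄} = g(∂_β, ∂_α)` (the metric being conjugate linear in the first variable); its value on
real tangent vectors is `2 Im g(u, v)`. -/
def kaehlerForm (g : HermitianStructure n X) : DForm n X 2 := fun x =>
  twoImForm (g.form x) (g.conj_symm x)

/-- A Hermitian metric on `X` is a Kähler metric if its Kähler form is closed. -/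
def IsKaehler (g : HermitianStructure n X) : Prop := (kaehlerForm g).d = 0

/-- The matrix `(g_{βᾱ})` at `x`, with rows `α` and columns `β`, with respect to the coordinate
basis of the tangent space given by the preferred chart at `x`. -/
def metricMatrix (g : HermitianStructure n X) (x : X) : Matrix (Fin n) (Fin n) ℂ :=
  Matrix.of fun α β => g.form x (Pi.single α 1 : Fin n → ℂ) (Pi.single β 1 : Fin n → ℂ)

/-- The coefficient `ψ_{αβ̄} = ψ(∂_α, ∂̄_β)` of `dz^α ∧ dz̄^β` in an alternating real bilinear map
`ψ`, extended complex bilinearly; here `∂_α = (e_α - √-1 Je_α) / 2` and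
`∂̄_β = (e_β + √-1 Je_β) / 2`, where `J` is the complex structure. -/
def coeffOneOne {W : Type*} [AddCommGroup W] [Module ℂ W]
    (ψ : (Fin n → ℂ) → (Fin n → ℂ) → W) (α β : Fin n) : W :=
  (1 / 4 : ℂ) • (ψ (Pi.single α 1) (Pi.single β 1)
    + ψ (Pi.single α Complex.I) (Pi.single β Complex.I)
    + Complex.I • (ψ (Pi.single α 1) (Pi.single β Complex.I)
      - ψ (Pi.single α Complex.I) (Pi.single β 1)))

/-- The adjoint `Λ` of `ψ ↦ ω ∧ ψ` on `2`-forms at `x`, with values in a complex vector space: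
`Λ ψ = -√-1 ∑ g^{αβ̄} ψ_{αβ̄}`. -/
def Lam (g : HermitianStructure n X) {W : Type*} [AddCommGroup W] [Module ℂ W] (x : X)
    (ψ : TangentSpace 𝓘(ℝ, Fin n → ℂ) x → TangentSpace 𝓘(ℝ, Fin n → ℂ) x → W) : W :=
  (-Complex.I) • ∑ α, ∑ β, (metricMatrix g x)⁻¹ α β • coeffOneOne ψ α β

variable {r : ℕ} {E : X → Type*} [∀ x, AddCommGroup (E x)] [∀ x, Module ℂ (E x)]
  [∀ x, TopologicalSpace (E x)] [TopologicalSpace (TotalSpace (Fin r → ℂ) E)]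
  [FiberBundle (Fin r → ℂ) E] [VectorBundle ℂ (Fin r → ℂ) E]

/-- The Hitchin–Simpson mean curvature `K_h = √-1 Λ R_h`. -/
def meanCurvature (g : HermitianStructure n X) (φ : HiggsField n r E) (h : HermitianMetric n r E)
    (x : X) : Module.End ℂ (E x) :=
  Complex.I • Lam g x (φ.hsCurvature h x)

variable [T2Space X] [SigmaCompactSpace X]

/-- `Vol X = ∫_X ωⁿ / n!`. -/
def vol (g : HermitianStructure n X) : ℝ :=
  TopForm.integral fun x => (1 / (n.factorial : ℝ)) • topPower (kaehlerForm g) x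

/-- The Kobayashi functional `J(h) = (1/2) ∫_X |K_h|² ωⁿ`. -/
def kobayashi (g : HermitianStructure n X) (φ : HiggsField n r E) (h : HermitianMetric n r E) : ℝ :=
  1 / 2 * TopForm.integral fun x =>
    h.normSq x (meanCurvature g φ h x) • topPower (kaehlerForm g) x

variable (r E) in
/-- The degree `∫_X c₁(E) ∧ ωⁿ⁻¹`, where `c₁(E)` stands for an arbitrarily chosen `2`-form
representing the first Chern class. -/
def degree (g : HermitianStructure n X) : ℝ :=
  (wedgePower (Classical.epsilon (RepresentsFirstChernClass n r E)) (kaehlerForm g)).integral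

variable (r E) in
/-- The constant `c = 2π n deg E / (r n! Vol X)`. -/
def hymConstant (g : HermitianStructure n X) : ℝ :=
  2 * Real.pi * n * degree r E g / (r * n.factorial * vol g)

/-- `h` is a Hermite–Yang–Mills metric: `K_h = c I`. -/
def IsHermiteYangMills (g : HermitianStructure n X) (φ : HiggsField n r E)
    (h : HermitianMetric n r E) : Prop :=
  ∀ x, meanCurvature g φ h x = (hymConstant r E g : ℂ) • (1 : Module.End ℂ (E x))

variable (r E) in
/-- The constant `2n (π deg E)² / (r (n-1)! Vol X)`. -/
def lowerBound (g : HermitianStructure n X) : ℝ :=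
  2 * n * (Real.pi * degree r E g) ^ 2 / (r * (n - 1).factorial * vol g)

end Kaehler

end HiggsKaehler

end

/-!
The theorem is a completion of the square. For a real number `a` and the mean curvature `K` of a
Hermitian metric `h`,
`|K - a I|² = |K|² - 2 a Re tr K + a² r`,
so that `∫ |K - a I|² ωⁿ = 2 J(h) - 2 a ∫ tr K ωⁿ + a² r n! Vol X`. Once it is known that
`∫ tr K ωⁿ = 2π n deg E`, the choice `a = c` gives `2 (J(h) - C) = ∫ |K - c I|² ωⁿ`
(`kobayashi_sub_lowerBound`). The right hand side is non-negative since `ωⁿ` is positive for the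
complex orientation (`coeff_topPower_pos`, `volIntegral_nonneg`), and it vanishes only if `K = c I`,
because `K` is continuous and the norm is definite (`eq_zero_of_volIntegral_eq_zero`,
`normSq_nonneg_and_definite`).

The integral of `tr K` is computed from three facts.

* Linear algebra: `n β ∧ ωⁿ⁻¹ = (Λβ) ωⁿ` for a real `2`-form `β` (`wedgeAt_eq_lam`). In a real basis
  `u₁, √-1 u₁, …, uₙ, √-1 uₙ` with `u` unitary, `ω` pairs every vector with its partner only, so
  that the permutations with a non-zero contribution to the wedge products preserve the pairs
  (`wedgeAt_slot`).
* The Higgs field does not contribute to `tr K` (`trace_meanCurvature`). The trace of the commutator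
  terms vanishes, `tr φ*` is the conjugate of `tr φ`, and `d tr φ` has type `(2,0)` as `φ` is
  holomorphic. Hence `tr K` is `Λ` of `√-1 tr R` with the curvature `R` of the Chern connection,
  that is, `2π` times `Λ` of the Chern form. The form `√-1 tr R` is real (`re_trace_chernCurvature`)
  since `2 Re tr (G⁻¹ ∂G) = tr (G⁻¹ dG)` is closed for the Gram matrix `G`.
* The integral `∫ β ∧ ωⁿ⁻¹` does not depend on the form `β` representing the first Chern class
  (`integral_wedgePower_eq`). The trace of the difference of two Chern connections is a global
  `1`-form, so that the Chern forms of two metrics are cohomologous (`cohomologous_chernForm`), and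
  Stokes' theorem applies.

The same form of Stokes' theorem, `∫ dη ∧ γ₂ ∧ ⋯ ∧ γₙ = 0` for closed `2`-forms `γ`
(`integral_wedge_d_eq_zero`), shows that the degree and the volume, and therefore `C`, depend only on
the classes of `c₁(E)` and `ω` (`integral_wedge_congr`). It is reduced to `ℂⁿ` by a partition of
unity. There the integrand is a sum of directional derivatives of compactly supported functions, as
the terms containing derivatives of a form `γ` cancel by `dγ = 0` (`setIntegral_wedgeAt_extDeriv`).

Curvature, `Λ` and the exterior derivative are defined at a point through the preferred chart and
frame there. Their independence of these choices, needed for continuity and for all local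
computations, is proved in `DForm.d_inChart`, `Lam_chart` and `IsConnection.endMatrix_curvature`; the
last rests on the transformation rule `curvatureMatrix_gauge` for the curvature of connection
matrices, with `isConnection_chern` and `isConnection_hs` for the two connections in question.
-/

set_option linter.unusedSectionVars false

noncomputable section

namespace HiggsKaehler

/-! ### Top exterior powers of alternating forms on `ℂⁿ` -/

section Wedge

variable {n : ℕ}

/-- The wedge product of `n` alternating `2`-forms on `ℂⁿ`, normalized as in `wedge`. -/
def wedgeAt (β : Fin n → (Fin n → ℂ) [⋀^Fin 2]→L[ℝ] ℝ) :
    (Fin n → ℂ) [⋀^(Fin n × Fin 2)]→ₗ[ℝ] ℝ :=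
  (1 / 2 : ℝ) ^ n • (tensorTwoForms β).alternatization

theorem wedgeAt_apply (β : Fin n → (Fin n → ℂ) [⋀^Fin 2]→L[ℝ] ℝ) (v : Fin n × Fin 2 → Fin n → ℂ) :
    wedgeAt β v = (1 / 2 : ℝ) ^ n * ∑ σ : Equiv.Perm (Fin n × Fin 2),
      ((Equiv.Perm.sign σ : ℤ) : ℝ) * ∏ k, β k ![v (σ (k, 0)), v (σ (k, 1))] := by
  rw [wedgeAt, AlternatingMap.smul_apply, MultilinearMap.alternatization_apply, smul_eq_mul]
  congr 1
  refine Finset.sum_congr rfl fun σ _ => ?_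
  rw [Units.smul_def, zsmul_eq_mul]
  refine congrArg _ ?_
  change ∏ k, β k (fun j => v (σ (k, j))) = _
  refine Finset.prod_congr rfl fun k _ => congrArg (β k) ?_
  funext j
  fin_cases j <;> rfl

/-- In a permutation of `Fin n × Fin 2`, if the second blocks of `σ (k, 0)` and `σ (k, 1)` agree,
then no other index is sent to this block. -/
theorem eq_of_perm_fst_eq (σ : Equiv.Perm (Fin n × Fin 2)) {k l : Fin n} {j : Fin 2}
    (h : (σ (k, 0)).1 = (σ (k, 1)).1) (hl : (σ (l, j)).1 = (σ (k, 0)).1) : l = k := by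
  by_contra hne
  have h01 : σ (k, 0) ≠ σ (k, 1) := fun h => by simpa using σ.injective h
  have hl0 : σ (l, j) ≠ σ (k, 0) := fun h => hne (congrArg Prod.fst (σ.injective h))
  have hl1 : σ (l, j) ≠ σ (k, 1) := fun h => hne (congrArg Prod.fst (σ.injective h))
  have a : (σ (k, 0)).2 ≠ (σ (k, 1)).2 := fun h' => h01 (Prod.ext h h')
  have b : (σ (l, j)).2 ≠ (σ (k, 0)).2 := fun h' => hl0 (Prod.ext hl h')
  have c : (σ (l, j)).2 ≠ (σ (k, 1)).2 := fun h' => hl1 (Prod.ext (hl.trans h) h')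
  lia

/-- A permutation of `Fin n × Fin 2` which respects all blocks but one respects the last one. -/
theorem perm_fst_eq_of_forall_ne (σ : Equiv.Perm (Fin n × Fin 2)) (k : Fin n)
    (h : ∀ l, l ≠ k → (σ (l, 0)).1 = (σ (l, 1)).1) : (σ (k, 0)).1 = (σ (k, 1)).1 := by
  obtain ⟨⟨l, j⟩, hlj⟩ := σ.surjective ((σ (k, 0)).1, (σ (k, 0)).2 + 1)
  have hl1 : (σ (l, j)).1 = (σ (k, 0)).1 := by rw [hlj]
  have hl2 : (σ (l, j)).2 = (σ (k, 0)).2 + 1 := by rw [hlj]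
  have hlk : l = k := by
    by_contra hne
    have h0 : (σ (l, 0)).1 = (σ (l, j)).1 := by
      obtain rfl | rfl : j = 0 ∨ j = 1 := by lia
      · rfl
      · exact h l hne
    exact hne (eq_of_perm_fst_eq σ (h l hne) (hl1.symm.trans h0.symm)).symm
  subst hlk
  obtain rfl | rfl : j = 0 ∨ j = 1 := by lia
  · lia
  · exact hl1.symm

/-- A real basis adapted to a `2`-form: the form is twice the standard symplectic form. -/
structure IsAdapted (o : (Fin n → ℂ) [⋀^Fin 2]→L[ℝ] ℝ) (b : Fin n × Fin 2 → Fin n → ℂ) : Prop where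
  pair : ∀ a, o ![b (a, 0), b (a, 1)] = 2
  ne : ∀ p q, p.1 ≠ q.1 → o ![b p, b q] = 0

theorem alt_swap (o : (Fin n → ℂ) [⋀^Fin 2]→L[ℝ] ℝ) (u v : Fin n → ℂ) :
    o ![u, v] = - o ![v, u] := by
  have := o.toAlternatingMap.map_swap ![v, u] (i := 0) (j := 1) (by decide)
  refine Eq.trans (congrArg o ?_) this
  funext j
  fin_cases j <;> simp

theorem alt_pair_eq_smul {o : (Fin n → ℂ) [⋀^Fin 2]→L[ℝ] ℝ} {b : Fin n × Fin 2 → Fin n → ℂ}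
    (hb : IsAdapted o b) (β : (Fin n → ℂ) [⋀^Fin 2]→L[ℝ] ℝ) {p q : Fin n × Fin 2}
    (hpq : p.1 = q.1) (hne : p ≠ q) :
    β ![b p, b q] = 1 / 2 * β ![b (p.1, 0), b (p.1, 1)] * o ![b p, b q] := by
  obtain ⟨a, i⟩ := p
  obtain ⟨a', j⟩ := q
  obtain rfl : a = a' := hpq
  fin_cases i <;> fin_cases j
  · exact absurd rfl hne
  · simp only [Fin.mk_one, Fin.zero_eta, hb.pair]; ring
  · simp only [Fin.mk_one, Fin.zero_eta]
    rw [alt_swap o, alt_swap β, hb.pair]; ring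
  · exact absurd rfl hne

/-- The product of the values of `o` on the blocks of the permuted family. -/
def blockProd (o : (Fin n → ℂ) [⋀^Fin 2]→L[ℝ] ℝ) (b : Fin n × Fin 2 → Fin n → ℂ)
    (σ : Equiv.Perm (Fin n × Fin 2)) : ℝ :=
  ∏ k, o ![b (σ (k, 0)), b (σ (k, 1))]

theorem fst_eq_of_blockProd_ne_zero {o : (Fin n → ℂ) [⋀^Fin 2]→L[ℝ] ℝ}
    {b : Fin n × Fin 2 → Fin n → ℂ} (hb : IsAdapted o b) {σ : Equiv.Perm (Fin n × Fin 2)}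
    (h : blockProd o b σ ≠ 0) (k : Fin n) : (σ (k, 0)).1 = (σ (k, 1)).1 := by
  by_contra hk
  exact h (Finset.prod_eq_zero (Finset.mem_univ k) (hb.ne _ _ hk))

theorem prod_single_slot {o : (Fin n → ℂ) [⋀^Fin 2]→L[ℝ] ℝ}
    {b : Fin n × Fin 2 → Fin n → ℂ} (hb : IsAdapted o b) (β : (Fin n → ℂ) [⋀^Fin 2]→L[ℝ] ℝ)
    (σ : Equiv.Perm (Fin n × Fin 2)) (k₀ : Fin n) :
    ∏ k, (if k = k₀ then β else o) ![b (σ (k, 0)), b (σ (k, 1))] =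
      1 / 2 * β ![b ((σ (k₀, 0)).1, 0), b ((σ (k₀, 0)).1, 1)] * blockProd o b σ := by
  rw [blockProd, ← Finset.mul_prod_erase _ _ (Finset.mem_univ k₀),
    ← Finset.mul_prod_erase _ (fun k => o ![b (σ (k, 0)), b (σ (k, 1))]) (Finset.mem_univ k₀),
    Finset.prod_congr rfl (g := fun k => o ![b (σ (k, 0)), b (σ (k, 1))])
      (fun k hk => by rw [if_neg (Finset.ne_of_mem_erase hk)]), if_pos rfl]
  by_cases h : ∀ l, l ≠ k₀ → (σ (l, 0)).1 = (σ (l, 1)).1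
  · have h0 := perm_fst_eq_of_forall_ne σ k₀ h
    rw [alt_pair_eq_smul hb β h0 (fun h => by simpa using σ.injective h)]
    ring
  · push Not at h
    obtain ⟨l, hl, hne⟩ := h
    rw [Finset.prod_eq_zero (i := l) (Finset.mem_erase.2 ⟨hl, Finset.mem_univ _⟩)
      (hb.ne _ _ hne)]
    ring

theorem sign_prodCongrLeft_const (ϖ : Equiv.Perm (Fin n)) :
    Equiv.Perm.sign (Equiv.prodCongrLeft (fun _ : Fin 2 => ϖ)) = 1 := by
  rw [Equiv.Perm.sign_prodCongrLeft]
  simp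

/-- The sum over the permutations of `Fin n × Fin 2` which computes a top wedge product does not
change under permutations of the blocks. -/
theorem sum_blockProd_slot (o : (Fin n → ℂ) [⋀^Fin 2]→L[ℝ] ℝ)
    (b : Fin n × Fin 2 → Fin n → ℂ) (s : Fin n → ℝ) (k k₀ : Fin n) :
    ∑ σ : Equiv.Perm (Fin n × Fin 2),
      ((Equiv.Perm.sign σ : ℤ) : ℝ) * (s (σ (k, 0)).1 * blockProd o b σ) =
    ∑ σ : Equiv.Perm (Fin n × Fin 2),
      ((Equiv.Perm.sign σ : ℤ) : ℝ) * (s (σ (k₀, 0)).1 * blockProd o b σ) := by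
  set ϖ := Equiv.swap k k₀
  set τ : Equiv.Perm (Fin n × Fin 2) := Equiv.prodCongrLeft (fun _ : Fin 2 => ϖ)
  rw [← Equiv.sum_comp (Equiv.mulRight τ)]
  refine Finset.sum_congr rfl fun σ _ => ?_
  have h1 : Equiv.Perm.sign (σ * τ) = Equiv.Perm.sign σ := by
    rw [Equiv.Perm.sign_mul, sign_prodCongrLeft_const, mul_one]
  have h2 : blockProd o b (σ * τ) = blockProd o b σ :=
    Equiv.prod_comp ϖ fun k => o ![b (σ (k, 0)), b (σ (k, 1))]
  have h3 : (σ * τ) (k, 0) = σ (k₀, 0) := by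
    simp [τ, ϖ]
  rw [Equiv.coe_mulRight, h1, h2, h3]

theorem bijective_of_blockProd_ne_zero {o : (Fin n → ℂ) [⋀^Fin 2]→L[ℝ] ℝ}
    {b : Fin n × Fin 2 → Fin n → ℂ} (hb : IsAdapted o b) {σ : Equiv.Perm (Fin n × Fin 2)}
    (h : blockProd o b σ ≠ 0) : Function.Bijective fun k => (σ (k, 0)).1 :=
  Finite.injective_iff_bijective.1 fun _ l hkl =>
    eq_of_perm_fst_eq σ (fst_eq_of_blockProd_ne_zero hb h l) hkl

/-- In an adapted basis, `n β ∧ oⁿ⁻¹ = (½ ∑ₐ β(bₐ₀, bₐ₁)) oⁿ`. -/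
theorem wedgeAt_slot {o : (Fin n → ℂ) [⋀^Fin 2]→L[ℝ] ℝ}
    {b : Fin n × Fin 2 → Fin n → ℂ} (hb : IsAdapted o b) (β : (Fin n → ℂ) [⋀^Fin 2]→L[ℝ] ℝ)
    (k₀ : Fin n) :
    n * wedgeAt (fun k => if k = k₀ then β else o) b =
      (1 / 2 * ∑ a, β ![b (a, 0), b (a, 1)]) * wedgeAt (fun _ => o) b := by
  rw [wedgeAt_apply, wedgeAt_apply]
  simp only [prod_single_slot hb]
  have key : (n : ℝ) * ∑ σ : Equiv.Perm (Fin n × Fin 2), ((Equiv.Perm.sign σ : ℤ) : ℝ) *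
      (β ![b ((σ (k₀, 0)).1, 0), b ((σ (k₀, 0)).1, 1)] * blockProd o b σ) =
      (∑ a, β ![b (a, 0), b (a, 1)]) * ∑ σ : Equiv.Perm (Fin n × Fin 2),
        ((Equiv.Perm.sign σ : ℤ) : ℝ) * blockProd o b σ := by
    calc _ = ∑ k : Fin n, ∑ σ : Equiv.Perm (Fin n × Fin 2), ((Equiv.Perm.sign σ : ℤ) : ℝ) *
          (β ![b ((σ (k, 0)).1, 0), b ((σ (k, 0)).1, 1)] * blockProd o b σ) := by
          rw [Finset.sum_congr rfl fun k _ =>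
            sum_blockProd_slot o b (fun a => β ![b (a, 0), b (a, 1)]) k k₀]
          simp
      _ = _ := by
          rw [Finset.sum_comm, Finset.mul_sum]
          refine Finset.sum_congr rfl fun σ _ => ?_
          rw [← Finset.mul_sum, ← Finset.sum_mul]
          by_cases h : blockProd o b σ = 0
          · simp [h]
          · rw [(bijective_of_blockProd_ne_zero hb h).sum_comp
              (fun a => β ![b (a, 0), b (a, 1)])]
            ring
  change _ = _ * (_ * ∑ σ : Equiv.Perm (Fin n × Fin 2),
        ((Equiv.Perm.sign σ : ℤ) : ℝ) * blockProd o b σ)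
  rw [show ∀ A B C : ℝ, (1 / 2 * A) * (B * C) = 1 / 2 * B * (A * C) by intros; ring, ← key]
  simp only [Finset.mul_sum]
  refine Finset.sum_congr rfl fun σ _ => ?_
  ring

/-- The non-zero terms of `oⁿ(b)` are positive: the sign of a permutation preserving the blocks is
the product of its signs on the blocks, since it permutes the blocks with sign `+1`. -/
theorem sign_mul_blockProd_nonneg {o : (Fin n → ℂ) [⋀^Fin 2]→L[ℝ] ℝ}
    {b : Fin n × Fin 2 → Fin n → ℂ} (hb : IsAdapted o b) (σ : Equiv.Perm (Fin n × Fin 2)) :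
    0 ≤ ((Equiv.Perm.sign σ : ℤ) : ℝ) * blockProd o b σ := by
  by_cases h : blockProd o b σ = 0
  · simp [h]
  have h1 := fst_eq_of_blockProd_ne_zero hb h
  set ϖ := Equiv.ofBijective _ (bijective_of_blockProd_ne_zero hb h) with hϖ
  have hfst : ∀ k j, (σ (k, j)).1 = ϖ k := by
    intro k j
    fin_cases j
    · rfl
    · exact (h1 k).symm
  have hinj : ∀ k, Function.Injective fun j => (σ (k, j)).2 := fun k i j hij => by
    have : σ (k, i) = σ (k, j) := Prod.ext ((hfst k i).trans (hfst k j).symm) hij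
    simpa using σ.injective this
  set f : Fin n → Equiv.Perm (Fin 2) := fun k =>
    Equiv.ofBijective _ (Finite.injective_iff_bijective.1 (hinj k)) with hf
  have hσ : σ = Equiv.prodCongrLeft (fun _ : Fin 2 => ϖ) * Equiv.prodCongrRight f := by
    ext1 ⟨k, j⟩
    exact Prod.ext (hfst k j) rfl
  have hs : Equiv.Perm.sign σ = ∏ k, Equiv.Perm.sign (f k) := by
    rw [hσ, Equiv.Perm.sign_mul, sign_prodCongrLeft_const, one_mul, Equiv.Perm.sign_prodCongrRight]
  rw [hs, blockProd]
  push_cast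
  rw [← Finset.prod_mul_distrib]
  refine Finset.prod_nonneg fun k _ => ?_
  have hk : ∀ j, σ (k, j) = (ϖ k, f k j) := fun j => Prod.ext (hfst k j) rfl
  rw [hk, hk]
  have hfk : f k = 1 ∨ f k = Equiv.swap 0 1 := by
    generalize f k = p
    revert p; decide
  rcases hfk with e | e
  · simp [e, hb.pair]
  · rw [e]
    simp [alt_swap o (b (ϖ k, 1)), hb.pair]

/-- The identity permutation gives a positive term, and no term is negative. -/
theorem wedgeAt_pos {o : (Fin n → ℂ) [⋀^Fin 2]→L[ℝ] ℝ}
    {b : Fin n × Fin 2 → Fin n → ℂ} (hb : IsAdapted o b) : 0 < wedgeAt (fun _ => o) b := by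
  rw [wedgeAt_apply]
  refine mul_pos (by positivity) (Finset.sum_pos' (fun σ _ => sign_mul_blockProd_nonneg hb σ)
    ⟨1, Finset.mem_univ _, ?_⟩)
  simp [hb.pair]

/-- The real basis `e₁, √-1 e₁, …, eₙ, √-1 eₙ` of `ℂⁿ` attached to a complex basis. -/
def realify (b : Module.Basis (Fin n) ℂ (Fin n → ℂ)) :
    Module.Basis (Fin n × Fin 2) ℝ (Fin n → ℂ) :=
  (Complex.basisOneI.smulTower b).reindex (Equiv.prodComm _ _)

theorem realify_zero (b : Module.Basis (Fin n) ℂ (Fin n → ℂ)) (a : Fin n) :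
    realify b (a, 0) = b a := by
  simp [realify, Module.Basis.smulTower_apply]

theorem realify_one (b : Module.Basis (Fin n) ℂ (Fin n → ℂ)) (a : Fin n) :
    realify b (a, 1) = Complex.I • b a := by
  simp [realify, Module.Basis.smulTower_apply]

theorem realify_stdBasis : ⇑(realify (Pi.basisFun ℂ (Fin n))) = realBasis n := by
  funext ⟨a, j⟩
  fin_cases j
  · simp [realify_zero, realBasis]
  · simp only [Fin.mk_one, realify_one, realBasis, Pi.basisFun_apply]
    rw [← Pi.single_smul]
    simp

/-- The complex orientation: a complex linear map multiplies real top forms by `|det|²`. -/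
theorem alternating_comp_complex (τ : (Fin n → ℂ) [⋀^(Fin n × Fin 2)]→ₗ[ℝ] ℝ)
    (L : (Fin n → ℂ) →ₗ[ℂ] (Fin n → ℂ)) (v : Fin n × Fin 2 → Fin n → ℂ) :
    τ (fun q => L (v q)) = Complex.normSq (LinearMap.det L) * τ v := by
  rw [τ.eq_smul_basis_det (realify (Pi.basisFun ℂ (Fin n)))]
  simp only [AlternatingMap.smul_apply, smul_eq_mul]
  have := Module.Basis.det_comp (realify (Pi.basisFun ℂ (Fin n))) (L.restrictScalars ℝ) v
  rw [show (fun q => L (v q)) = (L.restrictScalars ℝ) ∘ v from rfl, this,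
    LinearMap.det_restrictScalars, Algebra.norm_complex_apply]
  ring

end Wedge

/-! ### Hermitian forms and the operator `Λ` -/

section Lambda

variable {n : ℕ}

/-- A positive definite Hermitian form on an `n`-dimensional complex vector space has an
orthonormal basis. -/
theorem exists_orthonormal_basis {V : Type*} [AddCommGroup V] [Module ℂ V]
    (e : Module.Basis (Fin n) ℂ V) (B : V →ₗ⋆[ℂ] V →ₗ[ℂ] ℂ)
    (hB : ∀ u v, starRingEnd ℂ (B v u) = B u v) (hpos : ∀ u, u ≠ 0 → 0 < (B u u).re) :
    ∃ u : Module.Basis (Fin n) ℂ V, ∀ i j, B (u i) (u j) = if i = j then 1 else 0 := by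
  let core : InnerProductSpace.Core ℂ V :=
    { inner := fun u v => B u v
      conj_inner_symm := hB
      re_inner_nonneg := fun u => by
        by_cases hu : u = 0
        · simp [hu]
        · exact (hpos u hu).le
      add_left := fun u v w => by simp
      smul_left := fun u v a => by simp
      definite := fun u hu => by
        by_contra hne
        have := hpos u hne
        rw [show B u u = 0 from hu] at this
        simp at this }
  have : FiniteDimensional ℂ V := Module.Basis.finiteDimensional_of_finite e
  let _ : NormedAddCommGroup V := core.toNormedAddCommGroup
  let _ : InnerProductSpace ℂ V := InnerProductSpace.ofCore core.toCore
  have hn : Module.finrank ℂ V = n := by simpa using Module.finrank_eq_card_basis e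
  let b := (stdOrthonormalBasis ℂ V).reindex (finCongr hn)
  refine ⟨b.toBasis, fun i j => ?_⟩
  change (inner ℂ (b.toBasis i) (b.toBasis j) : ℂ) = _
  simpa using orthonormal_iff_ite.1 b.orthonormal i j

/-- Real bilinearity of a map with values in a complex vector space. -/
structure IsRealBilin {V W : Type*} [AddCommGroup V] [Module ℂ V] [AddCommGroup W] [Module ℂ W]
    (ψ : V → V → W) : Prop where
  add_left : ∀ u u' v, ψ (u + u') v = ψ u v + ψ u' v
  add_right : ∀ u v v', ψ u (v + v') = ψ u v + ψ u v'
  smul_left : ∀ (t : ℝ) u v, ψ ((t : ℂ) • u) v = (t : ℂ) • ψ u v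
  smul_right : ∀ (t : ℝ) u v, ψ u ((t : ℂ) • v) = (t : ℂ) • ψ u v

variable {V W : Type*} [AddCommGroup V] [Module ℂ V] [AddCommGroup W] [Module ℂ W]

/-- The `(1,1)`-part `ψ(u^{1,0}, v^{0,1})` of a real bilinear map. -/
def oneOnePart (ψ : V → V → W) (u v : V) : W :=
  (1 / 4 : ℂ) • (ψ u v + ψ (Complex.I • u) (Complex.I • v)
    + Complex.I • (ψ u (Complex.I • v) - ψ (Complex.I • u) v))

theorem IsRealBilin.complex_smul_left {ψ : V → V → W} (h : IsRealBilin ψ) (z : ℂ) (u v : V) :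
    ψ (z • u) v = (z.re : ℂ) • ψ u v + (z.im : ℂ) • ψ (Complex.I • u) v := by
  conv_lhs => rw [← Complex.re_add_im z, add_smul, mul_smul]
  rw [h.add_left, h.smul_left, h.smul_left]

theorem IsRealBilin.complex_smul_right {ψ : V → V → W} (h : IsRealBilin ψ) (z : ℂ) (u v : V) :
    ψ u (z • v) = (z.re : ℂ) • ψ u v + (z.im : ℂ) • ψ u (Complex.I • v) := by
  conv_lhs => rw [← Complex.re_add_im z, add_smul, mul_smul]
  rw [h.add_right, h.smul_right, h.smul_right]

theorem IsRealBilin.oneOnePart_add_left {ψ : V → V → W} (h : IsRealBilin ψ) (u u' v : V) :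
    oneOnePart ψ (u + u') v = oneOnePart ψ u v + oneOnePart ψ u' v := by
  simp only [oneOnePart, smul_add, h.add_left]
  module

theorem IsRealBilin.oneOnePart_add_right {ψ : V → V → W} (h : IsRealBilin ψ) (u v v' : V) :
    oneOnePart ψ u (v + v') = oneOnePart ψ u v + oneOnePart ψ u v' := by
  simp only [oneOnePart, smul_add, h.add_right]
  module

theorem IsRealBilin.map_neg_left {ψ : V → V → W} (h : IsRealBilin ψ) (u v : V) :
    ψ (-u) v = - ψ u v := by
  have := h.smul_left (-1) u v
  simpa using this

theorem IsRealBilin.map_neg_right {ψ : V → V → W} (h : IsRealBilin ψ) (u v : V) :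
    ψ u (-v) = - ψ u v := by
  have := h.smul_right (-1) u v
  simpa using this

theorem IsRealBilin.oneOnePart_smul_left {ψ : V → V → W} (h : IsRealBilin ψ) (z : ℂ) (u v : V) :
    oneOnePart ψ (z • u) v = z • oneOnePart ψ u v := by
  have hI : ∀ w, Complex.I • z • w = z • (Complex.I • w : V) := fun w => smul_comm _ _ _
  have hII : ∀ w : V, Complex.I • Complex.I • w = -w := fun w => by
    rw [smul_smul, Complex.I_mul_I, neg_one_smul]
  conv_rhs => rw [← Complex.re_add_im z]
  simp only [oneOnePart, hI, h.complex_smul_left z, hII, h.map_neg_left]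
  match_scalars <;> ring_nf <;> simp <;> ring

theorem IsRealBilin.oneOnePart_smul_right {ψ : V → V → W} (h : IsRealBilin ψ) (z : ℂ) (u v : V) :
    oneOnePart ψ u (z • v) = starRingEnd ℂ z • oneOnePart ψ u v := by
  have hI : ∀ w, Complex.I • z • w = z • (Complex.I • w : V) := fun w => smul_comm _ _ _
  have hII : ∀ w : V, Complex.I • Complex.I • w = -w := fun w => by
    rw [smul_smul, Complex.I_mul_I, neg_one_smul]
  conv_rhs => rw [← Complex.re_add_im z]
  simp only [oneOnePart, hI, h.complex_smul_right z, hII, h.map_neg_right]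
  simp only [map_add, map_mul, Complex.conj_ofReal, Complex.conj_I]
  match_scalars <;> ring_nf <;> simp <;> ring

theorem IsRealBilin.oneOnePart_sum_left {ψ : V → V → W} (h : IsRealBilin ψ) {ι : Type*}
    (s : Finset ι) (c : ι → ℂ) (u : ι → V) (v : V) :
    oneOnePart ψ (∑ i ∈ s, c i • u i) v = ∑ i ∈ s, c i • oneOnePart ψ (u i) v := by
  let f : V →ₗ[ℂ] W :=
    { toFun := fun u => oneOnePart ψ u v
      map_add' := fun a b => h.oneOnePart_add_left a b v
      map_smul' := fun z a => h.oneOnePart_smul_left z a v }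
  change f _ = ∑ i ∈ s, c i • f (u i)
  simp

theorem IsRealBilin.oneOnePart_sum_right {ψ : V → V → W} (h : IsRealBilin ψ) {ι : Type*}
    (s : Finset ι) (c : ι → ℂ) (u : V) (v : ι → V) :
    oneOnePart ψ u (∑ i ∈ s, c i • v i) =
      ∑ i ∈ s, starRingEnd ℂ (c i) • oneOnePart ψ u (v i) := by
  let f : V →ₗ⋆[ℂ] W :=
    { toFun := fun v => oneOnePart ψ u v
      map_add' := fun a b => h.oneOnePart_add_right u a b
      map_smul' := fun z a => h.oneOnePart_smul_right z u a }
  change f _ = ∑ i ∈ s, starRingEnd ℂ (c i) • f (v i)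
  simp

/-- The matrix of a sesquilinear form in a family of vectors. -/
def formMatrix (B : V →ₗ⋆[ℂ] V →ₗ[ℂ] ℂ) (b : Fin n → V) : Matrix (Fin n) (Fin n) ℂ :=
  Matrix.of fun i j => B (b i) (b j)

/-- The operator `Λ` of a Hermitian form, computed in a complex basis `b`. -/
def lamWith (B : V →ₗ⋆[ℂ] V →ₗ[ℂ] ℂ) (b : Fin n → V) (ψ : V → V → W) : W :=
  (-Complex.I) • ∑ i, ∑ j, (formMatrix B b)⁻¹ i j • oneOnePart ψ (b i) (b j)

theorem formMatrix_change (B : V →ₗ⋆[ℂ] V →ₗ[ℂ] ℂ) (b : Fin n → V)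
    (L : Matrix (Fin n) (Fin n) ℂ) :
    formMatrix B (fun i => ∑ k, L k i • b k) = L.conjTranspose * formMatrix B b * L := by
  ext i j
  simp only [formMatrix, Matrix.of_apply, map_sum, LinearMap.map_smulₛₗ, LinearMap.sum_apply,
    LinearMap.smul_apply, smul_eq_mul, Matrix.mul_apply, Matrix.conjTranspose_apply,
    Finset.sum_mul, RingHom.id_apply]
  refine Finset.sum_congr rfl fun k _ => ?_
  rw [Finset.mul_sum]
  refine Finset.sum_congr rfl fun l _ => ?_
  simp only [starRingEnd_apply]
  ring

/-- `Λ` does not depend on the basis in which it is computed. -/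
theorem lamWith_change (B : V →ₗ⋆[ℂ] V →ₗ[ℂ] ℂ) (b : Fin n → V) {L : Matrix (Fin n) (Fin n) ℂ}
    (hL : IsUnit L.det) {ψ : V → V → W} (h : IsRealBilin ψ) :
    lamWith B (fun i => ∑ k, L k i • b k) ψ = lamWith B b ψ := by
  have hLs : IsUnit L.conjTranspose.det := by
    rw [Matrix.det_conjTranspose]; exact hL.star
  rw [lamWith, lamWith, formMatrix_change]
  congr 1
  set M := formMatrix B b
  set N := (L.conjTranspose * M * L)⁻¹ with hN
  have hM : L * N * L.conjTranspose = M⁻¹ := by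
    rw [hN, Matrix.mul_inv_rev, Matrix.mul_inv_rev, ← mul_assoc, ← mul_assoc,
      Matrix.mul_nonsing_inv _ hL, one_mul, mul_assoc, Matrix.nonsing_inv_mul _ hLs, mul_one]
  rw [← hM]
  simp only [h.oneOnePart_sum_left, h.oneOnePart_sum_right, Finset.smul_sum, Matrix.mul_apply,
    Finset.sum_mul, Finset.sum_smul, smul_smul, Matrix.conjTranspose_apply]
  -- both sides are the same sum over four indices, in different orders
  calc ∑ i, ∑ j, ∑ k, ∑ l, (N i j * (L k i * starRingEnd ℂ (L l j))) • oneOnePart ψ (b k) (b l)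
      = ∑ i, ∑ k, ∑ j, ∑ l, (N i j * (L k i * starRingEnd ℂ (L l j))) •
          oneOnePart ψ (b k) (b l) := Finset.sum_congr rfl fun i _ => Finset.sum_comm
    _ = ∑ k, ∑ i, ∑ j, ∑ l, (N i j * (L k i * starRingEnd ℂ (L l j))) •
          oneOnePart ψ (b k) (b l) := Finset.sum_comm
    _ = ∑ k, ∑ i, ∑ l, ∑ j, (N i j * (L k i * starRingEnd ℂ (L l j))) •
          oneOnePart ψ (b k) (b l) := Finset.sum_congr rfl fun k _ =>
            Finset.sum_congr rfl fun i _ => Finset.sum_comm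
    _ = ∑ k, ∑ l, ∑ i, ∑ j, (N i j * (L k i * starRingEnd ℂ (L l j))) •
          oneOnePart ψ (b k) (b l) := Finset.sum_congr rfl fun k _ => Finset.sum_comm
    _ = ∑ k, ∑ l, ∑ j, ∑ i, (N i j * (L k i * starRingEnd ℂ (L l j))) •
          oneOnePart ψ (b k) (b l) := Finset.sum_congr rfl fun k _ =>
            Finset.sum_congr rfl fun l _ => Finset.sum_comm
    _ = _ := Finset.sum_congr rfl fun k _ => Finset.sum_congr rfl fun l _ =>
      Finset.sum_congr rfl fun j _ => Finset.sum_congr rfl fun i _ => by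
        congr 1
        rw [starRingEnd_apply]
        ring

theorem lamWith_basis (B : V →ₗ⋆[ℂ] V →ₗ[ℂ] ℂ) (b b' : Module.Basis (Fin n) ℂ V)
    {ψ : V → V → W} (h : IsRealBilin ψ) : lamWith B b' ψ = lamWith B b ψ := by
  have hb : ⇑b' = fun i => ∑ k, (b.toMatrix b') k i • b k := by
    funext i
    simp [Module.Basis.toMatrix_apply, b.sum_repr]
  rw [hb]
  have := b.invertibleToMatrix b'
  exact lamWith_change B b (Matrix.isUnit_det_of_invertible _) h

theorem lamWith_orthonormal (B : V →ₗ⋆[ℂ] V →ₗ[ℂ] ℂ) (b : Fin n → V)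
    (hb : ∀ i j, B (b i) (b j) = if i = j then 1 else 0) (ψ : V → V → W) :
    lamWith B b ψ = (-Complex.I) • ∑ i, oneOnePart ψ (b i) (b i) := by
  have : formMatrix B b = 1 := by
    ext i j
    simp [formMatrix, hb, Matrix.one_apply]
  rw [lamWith, this]
  simp [Matrix.one_apply]

theorem linearMap_lamWith {W' : Type*} [AddCommGroup W'] [Module ℂ W'] (f : W →ₗ[ℂ] W')
    (B : V →ₗ⋆[ℂ] V →ₗ[ℂ] ℂ) (b : Fin n → V) (ψ : V → V → W) :
    f (lamWith B b ψ) = lamWith B b fun u v => f (ψ u v) := by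
  simp [lamWith, oneOnePart]

theorem isRealBilin_alt (β : (Fin n → ℂ) [⋀^Fin 2]→L[ℝ] ℝ) :
    IsRealBilin fun u v => ((β ![u, v] : ℝ) : ℂ) where
  add_left u u' v := by
    have := β.map_update_add ![0, v] 0 u u'
    simp only [Matrix.vecCons, Fin.update_cons_zero] at this
    exact_mod_cast this
  add_right u v v' := by
    have := β.map_update_add ![u, 0] 1 v v'
    have hu : ∀ w, Function.update ![u, 0] 1 w = ![u, w] := fun w => by
      funext j; fin_cases j <;> simp
    simp only [hu] at this
    exact_mod_cast this
  smul_left t u v := by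
    have := β.map_update_smul ![0, v] 0 t u
    simp only [Matrix.vecCons, Fin.update_cons_zero] at this
    rw [smul_eq_mul, Complex.coe_smul]
    exact_mod_cast this
  smul_right t u v := by
    have := β.map_update_smul ![u, 0] 1 t v
    have hu : ∀ w, Function.update ![u, 0] 1 w = ![u, w] := fun w => by
      funext j; fin_cases j <;> simp
    simp only [hu] at this
    rw [smul_eq_mul, Complex.coe_smul]
    exact_mod_cast this

theorem alt_self (β : (Fin n → ℂ) [⋀^Fin 2]→L[ℝ] ℝ) (u : Fin n → ℂ) : β ![u, u] = 0 :=
  β.map_eq_zero_of_eq ![u, u] (i := 0) (j := 1) rfl (by decide)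

variable {B : (Fin n → ℂ) →ₗ⋆[ℂ] (Fin n → ℂ) →ₗ[ℂ] ℂ}

/-- If `u` is a unitary basis, then `u₁, √-1 u₁, …, uₙ, √-1 uₙ` is adapted to `2 Im B`. -/
theorem isAdapted_twoImForm (hB : ∀ u v, starRingEnd ℂ (B v u) = B u v)
    (u : Module.Basis (Fin n) ℂ (Fin n → ℂ))
    (hu : ∀ i j, B (u i) (u j) = if i = j then 1 else 0) :
    IsAdapted (twoImForm B hB) (realify u) where
  pair a := by
    rw [realify_zero, realify_one]
    change 2 * (B (u a) (Complex.I • u a)).im = 2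
    simp [hu]
  ne p q hpq := by
    obtain ⟨a, i⟩ := p
    obtain ⟨c, j⟩ := q
    change a ≠ c at hpq
    change 2 * (B (realify u (a, i)) (realify u (c, j))).im = 0
    fin_cases i <;> fin_cases j <;>
      simp [realify_zero, realify_one, hu, hpq]

theorem lamWith_alt (u : Fin n → Fin n → ℂ)
    (hu : ∀ i j, B (u i) (u j) = if i = j then 1 else 0) (β : (Fin n → ℂ) [⋀^Fin 2]→L[ℝ] ℝ) :
    lamWith B u (fun u v => ((β ![u, v] : ℝ) : ℂ)) =
      ((1 / 2 * ∑ a, β ![u a, Complex.I • u a] : ℝ) : ℂ) := by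
  rw [lamWith_orthonormal B u hu]
  simp only [oneOnePart, alt_self, alt_swap β (Complex.I • u _) (u _)]
  push_cast
  rw [Finset.smul_sum, Finset.mul_sum]
  refine Finset.sum_congr rfl fun i _ => ?_
  simp only [smul_eq_mul]
  ring_nf
  simp
  ring

/-- The pointwise identity `n β ∧ ωⁿ⁻¹ = (Λ β) ωⁿ`; in particular `Λ β` is real. -/
theorem wedgeAt_eq_lam (hB : ∀ u v, starRingEnd ℂ (B v u) = B u v)
    (hpos : ∀ u, u ≠ 0 → 0 < (B u u).re) (b : Module.Basis (Fin n) ℂ (Fin n → ℂ))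
    (β : (Fin n → ℂ) [⋀^Fin 2]→L[ℝ] ℝ) (k₀ : Fin n) (v : Fin n × Fin 2 → Fin n → ℂ) :
    lamWith B b (fun u v => ((β ![u, v] : ℝ) : ℂ)) =
        ((lamWith B b (fun u v => ((β ![u, v] : ℝ) : ℂ))).re : ℂ) ∧
      n * wedgeAt (fun k => if k = k₀ then β else twoImForm B hB) v =
        (lamWith B b (fun u v => ((β ![u, v] : ℝ) : ℂ))).re *
          wedgeAt (fun _ => twoImForm B hB) v := by
  obtain ⟨u, hu⟩ := exists_orthonormal_basis (Pi.basisFun ℂ (Fin n)) B hB hpos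
  have had := isAdapted_twoImForm hB u hu
  rw [lamWith_basis B u b (isRealBilin_alt β), lamWith_alt u hu β]
  refine ⟨by simp, ?_⟩
  rw [Complex.ofReal_re, (wedgeAt _).eq_smul_basis_det (realify u),
    (wedgeAt fun _ => twoImForm B hB).eq_smul_basis_det (realify u)]
  simp only [AlternatingMap.smul_apply, smul_eq_mul]
  rw [← mul_assoc, wedgeAt_slot had β k₀]
  simp only [realify_zero, realify_one]
  ring

/-- The volume form `ωⁿ` of a Hermitian form is positive on the standard real basis of `ℂⁿ`, and
on its image under a complex isomorphism. -/
theorem wedgeAt_twoImForm_pos (hB : ∀ u v, starRingEnd ℂ (B v u) = B u v)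
    (hpos : ∀ u, u ≠ 0 → 0 < (B u u).re) (b : Module.Basis (Fin n) ℂ (Fin n → ℂ)) :
    0 < wedgeAt (fun _ => twoImForm B hB) (realify b) := by
  obtain ⟨u, hu⟩ := exists_orthonormal_basis (Pi.basisFun ℂ (Fin n)) B hB hpos
  have had := isAdapted_twoImForm hB u hu
  set L : (Fin n → ℂ) ≃ₗ[ℂ] (Fin n → ℂ) := u.equiv b (Equiv.refl _)
  have hL : ⇑(realify b) = fun q => L (realify u q) := by
    funext ⟨a, j⟩
    fin_cases j <;> simp [realify_zero, realify_one, L]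
  rw [hL]
  have := alternating_comp_complex (wedgeAt fun _ => twoImForm B hB)
    (L : (Fin n → ℂ) →ₗ[ℂ] (Fin n → ℂ)) (realify u)
  rw [LinearEquiv.coe_coe] at this
  rw [this]
  refine mul_pos (Complex.normSq_pos.2 ?_) (wedgeAt_pos had)
  exact L.isUnit_det'.ne_zero

end Lambda

/-! ### Changes of charts -/

section Charts

open Set Filter Topology

variable {n : ℕ} {X : Type*} [TopologicalSpace X] [ChartedSpace (Fin n → ℂ) X]

section General

variable {𝕜 H M : Type*} [NontriviallyNormedField 𝕜] [NormedAddCommGroup H] [NormedSpace 𝕜 H]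
  [TopologicalSpace M] [ChartedSpace H M] [IsManifold 𝓘(𝕜, H) 1 M]

/-- The derivative of the inverse of a chart, read in the preferred chart at the image point. -/
theorem mfderiv_chart_symm {c : OpenPartialHomeomorph M H} (hc : c ∈ atlas H M) {y : H}
    (hy : y ∈ c.target) :
    mfderiv 𝓘(𝕜, H) 𝓘(𝕜, H) c.symm y = fderiv 𝕜 (chartAt H (c.symm y) ∘ c.symm) y := by
  have key : fderivWithin 𝕜 (writtenInExtChartAt 𝓘(𝕜, H) 𝓘(𝕜, H) y c.symm) (range 𝓘(𝕜, H))
      (extChartAt 𝓘(𝕜, H) y y) = fderiv 𝕜 (chartAt H (c.symm y) ∘ c.symm) y := by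
    change fderivWithin 𝕜 (chartAt H (c.symm y) ∘ c.symm) (range id) y = _
    rw [range_id, fderivWithin_univ]
  exact (mdifferentiableAt_atlas_symm hc hy).mfderiv.trans key

theorem mfderiv_chartAt_self (x : M) :
    mfderiv 𝓘(𝕜, H) 𝓘(𝕜, H) (chartAt H x) x = ContinuousLinearMap.id 𝕜 H := by
  have h : writtenInExtChartAt 𝓘(𝕜, H) 𝓘(𝕜, H) x (chartAt H x) =ᶠ[𝓝 (chartAt H x x)] id := by
    filter_upwards [(chartAt H x).open_target.mem_nhds (mem_chart_target H x)] with y hy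
    simp only [writtenInExtChartAt, mfld_simps]
    exact (chartAt H x).right_inv hy
  have key : fderivWithin 𝕜 (writtenInExtChartAt 𝓘(𝕜, H) 𝓘(𝕜, H) x (chartAt H x)) (range 𝓘(𝕜, H))
      (extChartAt 𝓘(𝕜, H) x x) = ContinuousLinearMap.id 𝕜 H := by
    rw [modelWithCornersSelf_coe, range_id, fderivWithin_univ]
    exact h.fderiv_eq.trans fderiv_id
  exact (mdifferentiableAt_atlas (I := 𝓘(𝕜, H)) (chart_mem_atlas H x)
    (mem_chart_source H x)).mfderiv.trans key

end General

/-- The transition function from the chart `c` to the chart `c'`. -/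
def transition (c c' : OpenPartialHomeomorph X (Fin n → ℂ)) : (Fin n → ℂ) → Fin n → ℂ :=
  c' ∘ c.symm

/-- The coordinates `y` of the chart `c` of the points in the domain of the chart `c'`. -/
def overlap (c c' : OpenPartialHomeomorph X (Fin n → ℂ)) : Set (Fin n → ℂ) :=
  c.target ∩ c.symm ⁻¹' c'.source

theorem isOpen_overlap (c c' : OpenPartialHomeomorph X (Fin n → ℂ)) : IsOpen (overlap c c') :=
  c.isOpen_inter_preimage_symm c'.open_source

variable {c c' : OpenPartialHomeomorph X (Fin n → ℂ)}

theorem symm_transition {y : Fin n → ℂ} (hy : y ∈ overlap c c') :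
    c'.symm (transition c c' y) = c.symm y :=
  c'.left_inv hy.2

theorem transition_mem_target {y : Fin n → ℂ} (hy : y ∈ overlap c c') :
    transition c c' y ∈ c'.target :=
  c'.map_source hy.2

theorem transition_mem_overlap {y : Fin n → ℂ} (hy : y ∈ overlap c c') :
    transition c c' y ∈ overlap c' c :=
  ⟨transition_mem_target hy, by
    rw [mem_preimage, symm_transition hy]; exact c.map_target hy.1⟩

theorem transition_transition {y : Fin n → ℂ} (hy : y ∈ overlap c c') :
    transition c' c (transition c c' y) = y := by
  change c (c'.symm (transition c c' y)) = y
  rw [symm_transition hy, c.right_inv hy.1]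

theorem mem_overlap_chartAt {y : Fin n → ℂ} (hy : y ∈ c.target) :
    y ∈ overlap c (chartAt (Fin n → ℂ) (c.symm y)) :=
  ⟨hy, mem_chart_source _ _⟩

variable [IsManifold 𝓘(ℂ, Fin n → ℂ) ω X]

theorem contDiffOn_transition (hc : c ∈ atlas (Fin n → ℂ) X) (hc' : c' ∈ atlas (Fin n → ℂ) X) :
    ContDiffOn ℂ ω (transition c c') (overlap c c') := by
  have h := (contDiffGroupoid ω 𝓘(ℂ, Fin n → ℂ)).compatible hc hc'
  rw [contDiffGroupoid, mem_groupoid_of_pregroupoid] at h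
  have := h.1
  simpa [contDiffPregroupoid, transition, overlap, OpenPartialHomeomorph.trans_source,
    Function.comp_def] using this

theorem contDiffAt_transition (hc : c ∈ atlas (Fin n → ℂ) X) (hc' : c' ∈ atlas (Fin n → ℂ) X)
    {y : Fin n → ℂ} (hy : y ∈ overlap c c') : ContDiffAt ℂ ω (transition c c') y :=
  (contDiffOn_transition hc hc').contDiffAt ((isOpen_overlap c c').mem_nhds hy)

theorem contDiffAt_transition_real (hc : c ∈ atlas (Fin n → ℂ) X)
    (hc' : c' ∈ atlas (Fin n → ℂ) X) {y : Fin n → ℂ} (hy : y ∈ overlap c c') :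
    ContDiffAt ℝ ∞ (transition c c') y :=
  ((contDiffAt_transition hc hc' hy).restrict_scalars ℝ).of_le le_top

theorem differentiableAt_transition (hc : c ∈ atlas (Fin n → ℂ) X)
    (hc' : c' ∈ atlas (Fin n → ℂ) X) {y : Fin n → ℂ} (hy : y ∈ overlap c c') :
    DifferentiableAt ℂ (transition c c') y :=
  (contDiffAt_transition hc hc' hy).differentiableAt (by simp)

/-- The derivative of the inverse of a chart, as a complex linear endomorphism of `ℂⁿ`. -/
def chartJac (c : OpenPartialHomeomorph X (Fin n → ℂ)) (y : Fin n → ℂ) :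
    (Fin n → ℂ) →L[ℂ] (Fin n → ℂ) :=
  mfderiv 𝓘(ℂ, Fin n → ℂ) 𝓘(ℂ, Fin n → ℂ) c.symm y

theorem chartJac_eq (hc : c ∈ atlas (Fin n → ℂ) X) {y : Fin n → ℂ} (hy : y ∈ c.target) :
    chartJac c y = fderiv ℂ (transition c (chartAt (Fin n → ℂ) (c.symm y))) y :=
  mfderiv_chart_symm (𝕜 := ℂ) hc hy

theorem mfderiv_real_chart_symm (hc : c ∈ atlas (Fin n → ℂ) X) {y : Fin n → ℂ}
    (hy : y ∈ c.target) :
    mfderiv 𝓘(ℝ, Fin n → ℂ) 𝓘(ℝ, Fin n → ℂ) c.symm y = (chartJac c y).restrictScalars ℝ := by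
  have := isManifold_real n X
  have : IsManifold 𝓘(ℝ, Fin n → ℂ) 1 X := IsManifold.of_le (n := ∞) (by simp)
  rw [mfderiv_chart_symm (𝕜 := ℝ) hc hy, chartJac_eq hc hy]
  exact (differentiableAt_transition hc (chart_mem_atlas _ _)
    (mem_overlap_chartAt hy)).fderiv_restrictScalars ℝ

theorem mfderiv_real_chartAt (x : X) :
    mfderiv 𝓘(ℝ, Fin n → ℂ) 𝓘(ℝ, Fin n → ℂ) (chartAt (Fin n → ℂ) x) x =
      ContinuousLinearMap.id ℝ (Fin n → ℂ) := by
  have := isManifold_real n X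
  have : IsManifold 𝓘(ℝ, Fin n → ℂ) 1 X := IsManifold.of_le (n := ∞) (by simp)
  exact mfderiv_chartAt_self x

theorem transition_comp_eventuallyEq {c'' : OpenPartialHomeomorph X (Fin n → ℂ)} {y : Fin n → ℂ}
    (hy : y ∈ overlap c c') :
    transition c c'' =ᶠ[𝓝 y] transition c' c'' ∘ transition c c' := by
  filter_upwards [(isOpen_overlap c c').mem_nhds hy] with z hz
  simp only [Function.comp_apply]
  rw [transition, transition, Function.comp_apply, Function.comp_apply, symm_transition hz]

theorem chartJac_transition (hc : c ∈ atlas (Fin n → ℂ) X) (hc' : c' ∈ atlas (Fin n → ℂ) X)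
    {y : Fin n → ℂ} (hy : y ∈ overlap c c') :
    chartJac c y = (chartJac c' (transition c c' y)).comp (fderiv ℂ (transition c c') y) := by
  rw [chartJac_eq hc hy.1, chartJac_eq hc' (transition_mem_target hy), symm_transition hy,
    (transition_comp_eventuallyEq hy).fderiv_eq, fderiv_comp]
  · refine differentiableAt_transition hc' (chart_mem_atlas _ _)
      ⟨transition_mem_target hy, ?_⟩
    rw [mem_preimage, symm_transition hy]
    exact mem_chart_source _ _
  · exact differentiableAt_transition hc hc' hy

theorem fderiv_transition_real (hc : c ∈ atlas (Fin n → ℂ) X) (hc' : c' ∈ atlas (Fin n → ℂ) X)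
    {y : Fin n → ℂ} (hy : y ∈ overlap c c') :
    fderiv ℝ (transition c c') y = (fderiv ℂ (transition c c') y).restrictScalars ℝ :=
  (differentiableAt_transition hc hc' hy).fderiv_restrictScalars ℝ

theorem det_fderiv_transition_ne_zero (hc : c ∈ atlas (Fin n → ℂ) X)
    (hc' : c' ∈ atlas (Fin n → ℂ) X) {y : Fin n → ℂ} (hy : y ∈ overlap c c') :
    LinearMap.det (fderiv ℂ (transition c c') y : (Fin n → ℂ) →ₗ[ℂ] (Fin n → ℂ)) ≠ 0 := by
  have h : transition c' c ∘ transition c c' =ᶠ[𝓝 y] id := by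
    filter_upwards [(isOpen_overlap c c').mem_nhds hy] with z hz
    exact transition_transition hz
  have h2 := h.fderiv_eq (𝕜 := ℂ)
  rw [fderiv_id, fderiv_comp _ (differentiableAt_transition hc' hc (transition_mem_overlap hy))
    (differentiableAt_transition hc hc' hy)] at h2
  have h3 := congrArg (fun L : (Fin n → ℂ) →L[ℂ] (Fin n → ℂ) =>
    LinearMap.det (L : (Fin n → ℂ) →ₗ[ℂ] (Fin n → ℂ))) h2
  simp only [ContinuousLinearMap.toLinearMap_comp, LinearMap.det_comp] at h3
  exact right_ne_zero_of_mul_eq_one (h3.trans LinearMap.det_id)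

theorem det_chartJac_ne_zero (hc : c ∈ atlas (Fin n → ℂ) X) {y : Fin n → ℂ}
    (hy : y ∈ c.target) :
    LinearMap.det (chartJac c y : (Fin n → ℂ) →ₗ[ℂ] (Fin n → ℂ)) ≠ 0 := by
  rw [chartJac_eq hc hy]
  exact det_fderiv_transition_ne_zero hc (chart_mem_atlas _ _) (mem_overlap_chartAt hy)

/-! ### Differential forms in charts -/

theorem DForm.inChart_eq {k : ℕ} (α : DForm n X k) (hc : c ∈ atlas (Fin n → ℂ) X)
    {y : Fin n → ℂ} (hy : y ∈ c.target) :
    α.inChart c y = (α (c.symm y) : (Fin n → ℂ) [⋀^Fin k]→L[ℝ] ℝ).compContinuousLinearMap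
      ((chartJac c y).restrictScalars ℝ) := by
  rw [DForm.inChart, mfderiv_real_chart_symm hc hy]

theorem DForm.inChart_apply {k : ℕ} (α : DForm n X k) (hc : c ∈ atlas (Fin n → ℂ) X)
    {y : Fin n → ℂ} (hy : y ∈ c.target) (v : Fin k → Fin n → ℂ) :
    α.inChart c y v = α (c.symm y) fun i => chartJac c y (v i) := by
  rw [DForm.inChart_eq α hc hy]
  rfl

theorem DForm.inChart_transition {k : ℕ} (α : DForm n X k) (hc : c ∈ atlas (Fin n → ℂ) X)
    (hc' : c' ∈ atlas (Fin n → ℂ) X) {y : Fin n → ℂ} (hy : y ∈ overlap c c') :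
    α.inChart c y = (α.inChart c' (transition c c' y)).compContinuousLinearMap
      (fderiv ℝ (transition c c') y) := by
  ext v
  rw [ContinuousAlternatingMap.compContinuousLinearMap_apply, DForm.inChart_apply α hc hy.1,
    DForm.inChart_apply α hc' (transition_mem_target hy), symm_transition hy,
    chartJac_transition hc hc' hy, fderiv_transition_real hc hc' hy]
  rfl

theorem DForm.d_eq {k : ℕ} (η : DForm n X k) (x : X) :
    η.d x = extDeriv (η.inChart (chartAt (Fin n → ℂ) x)) (chartAt (Fin n → ℂ) x x) := by
  ext v
  change extDeriv (η.inChart (chartAt (Fin n → ℂ) x)) (chartAt (Fin n → ℂ) x x)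
    (fun i => mfderiv 𝓘(ℝ, Fin n → ℂ) 𝓘(ℝ, Fin n → ℂ) (chartAt (Fin n → ℂ) x) x (v i)) = _
  rw [mfderiv_real_chartAt]
  rfl

theorem two_le_smooth : minSmoothness ℝ 2 ≤ (∞ : WithTop ℕ∞) := by
  rw [minSmoothness_of_isRCLikeNormedField]
  exact WithTop.coe_le_coe.2 (le_top (a := (2 : ℕ∞)))

/-- The exterior derivative can be computed in any chart. -/
theorem DForm.d_inChart {k : ℕ} {η : DForm n X k} (hη : η.IsSmooth)
    (hc : c ∈ atlas (Fin n → ℂ) X) {y : Fin n → ℂ} (hy : y ∈ c.target) :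
    η.d.inChart c y = extDeriv (η.inChart c) y := by
  set x := c.symm y with hx
  set c₀ := chartAt (Fin n → ℂ) x with hc₀
  have hy' : y ∈ overlap c c₀ := mem_overlap_chartAt hy
  have h1 : η.inChart c =ᶠ[𝓝 y] fun z => (η.inChart c₀ (transition c c₀ z)).compContinuousLinearMap
      (fderiv ℝ (transition c c₀) z) := by
    filter_upwards [(isOpen_overlap c c₀).mem_nhds hy'] with z hz
    exact η.inChart_transition hc (chart_mem_atlas _ _) hz
  have h2 : DifferentiableAt ℝ (η.inChart c₀) (transition c c₀ y) :=
    ((hη c₀ (chart_mem_atlas _ _)).contDiffAt (c₀.open_target.mem_nhds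
      (transition_mem_target hy'))).differentiableAt (by simp)
  rw [h1.extDeriv_eq, extDeriv_pullback h2
    (contDiffAt_transition_real hc (chart_mem_atlas _ _) hy') (two_le_smooth),
    DForm.inChart_eq _ hc hy, DForm.d_eq, chartJac_eq hc hy,
    fderiv_transition_real hc (chart_mem_atlas _ _) hy']
  rfl

theorem contDiffOn_extDeriv {k : ℕ} {θ : (Fin n → ℂ) → (Fin n → ℂ) [⋀^Fin k]→L[ℝ] ℝ}
    {U : Set (Fin n → ℂ)} (hU : IsOpen U) (hθ : ContDiffOn ℝ ∞ θ U) :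
    ContDiffOn ℝ ∞ (extDeriv θ) U := by
  have h : ContDiffOn ℝ ∞ (fderiv ℝ θ) U := hθ.fderiv_of_isOpen hU (by simp)
  exact (ContinuousAlternatingMap.alternatizeUncurryFinCLM ℝ (Fin n → ℂ) ℝ).contDiff.comp_contDiffOn h

theorem DForm.IsSmooth.d {k : ℕ} {η : DForm n X k} (hη : η.IsSmooth) : η.d.IsSmooth :=
  fun c hc => (contDiffOn_extDeriv c.open_target (hη c hc)).congr fun _ hy =>
    DForm.d_inChart hη hc hy

/-- Smooth closed forms. Closedness is required of the expressions in all charts, which for a smooth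
form is equivalent to `α.d = 0`. -/
structure DForm.IsClosedForm {k : ℕ} (α : DForm n X k) : Prop where
  smooth : α.IsSmooth
  closed : ∀ c ∈ atlas (Fin n → ℂ) X, ∀ y ∈ c.target, extDeriv (α.inChart c) y = 0

theorem DForm.IsSmooth.isClosedForm {k : ℕ} {α : DForm n X k} (hα : α.IsSmooth)
    (hd : α.d = 0) : α.IsClosedForm := by
  refine ⟨hα, fun c hc y hy => ?_⟩
  rw [← DForm.d_inChart hα hc hy, hd]
  ext v
  rw [DForm.inChart_apply _ hc hy]
  rfl

/-- A form which locally, in charts, is the exterior derivative of a smooth form is a smooth closed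
form. -/
theorem DForm.isClosedForm_of_locally_exact {k : ℕ} {α : DForm n X (k + 1)}
    (h : ∀ c ∈ atlas (Fin n → ℂ) X, ∀ y ∈ c.target,
      ∃ (U : Set (Fin n → ℂ)) (θ : (Fin n → ℂ) → (Fin n → ℂ) [⋀^Fin k]→L[ℝ] ℝ), IsOpen U ∧ y ∈ U ∧
        ContDiffOn ℝ ∞ θ U ∧ ∀ z ∈ U, α.inChart c z = extDeriv θ z) : α.IsClosedForm := by
  constructor
  · intro c hc y hy
    obtain ⟨U, θ, hU, hyU, hθ, h⟩ := h c hc y hy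
    refine (((contDiffOn_extDeriv hU hθ).congr h).contDiffAt (hU.mem_nhds hyU)).contDiffWithinAt
  · intro c hc y hy
    obtain ⟨U, θ, hU, hyU, hθ, h⟩ := h c hc y hy
    have h1 : α.inChart c =ᶠ[𝓝 y] extDeriv θ := by
      filter_upwards [hU.mem_nhds hyU] with z hz using h z hz
    rw [h1.extDeriv_eq]
    exact extDeriv_extDeriv_apply (hθ.contDiffAt (hU.mem_nhds hyU))
      (two_le_smooth)

/-! ### Top forms in charts -/

theorem TopForm.coeff_eq (τ : TopForm n X) (hc : c ∈ atlas (Fin n → ℂ) X) {y : Fin n → ℂ}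
    (hy : y ∈ c.target) :
    τ.coeff c y = τ (c.symm y) fun q => chartJac c y (realBasis n q) := by
  rw [TopForm.coeff, mfderiv_real_chart_symm hc hy]
  rfl

/-- Coefficients of top forms change by the (positive) real Jacobian determinant. -/
theorem TopForm.coeff_transition (τ : TopForm n X) (hc : c ∈ atlas (Fin n → ℂ) X)
    (hc' : c' ∈ atlas (Fin n → ℂ) X) {y : Fin n → ℂ} (hy : y ∈ overlap c c') :
    τ.coeff c y = Complex.normSq (LinearMap.det
      (fderiv ℂ (transition c c') y : (Fin n → ℂ) →ₗ[ℂ] (Fin n → ℂ))) *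
        τ.coeff c' (transition c c' y) := by
  rw [TopForm.coeff_eq τ hc hy.1, TopForm.coeff_eq τ hc' (transition_mem_target hy),
    symm_transition hy, chartJac_transition hc hc' hy]
  exact alternating_comp_complex (AlternatingMap.compLinearMap (τ (c.symm y))
    ((chartJac c' (transition c c' y) : (Fin n → ℂ) →ₗ[ℂ] (Fin n → ℂ)).restrictScalars ℝ)) _ _

theorem wedgeAt_comp (γ : Fin n → (Fin n → ℂ) [⋀^Fin 2]→L[ℝ] ℝ)
    (L : (Fin n → ℂ) →L[ℝ] (Fin n → ℂ)) (v : Fin n × Fin 2 → Fin n → ℂ) :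
    wedgeAt (fun k => (γ k).compContinuousLinearMap L) v = wedgeAt γ fun q => L (v q) := by
  rw [wedgeAt_apply, wedgeAt_apply]
  congr 1
  refine Finset.sum_congr rfl fun σ _ => ?_
  congr 1
  refine Finset.prod_congr rfl fun k _ => ?_
  rw [ContinuousAlternatingMap.compContinuousLinearMap_apply]
  refine congrArg (γ k) ?_
  funext j
  fin_cases j <;> rfl

theorem coeff_wedge (β : Fin n → DForm n X 2) (hc : c ∈ atlas (Fin n → ℂ) X) {y : Fin n → ℂ}
    (hy : y ∈ c.target) :
    TopForm.coeff (wedge β) c y = wedgeAt (fun k => (β k).inChart c y) (realBasis n) := by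
  rw [TopForm.coeff_eq _ hc hy]
  simp only [DForm.inChart_eq _ hc hy]
  exact (wedgeAt_comp (fun k => (β k (c.symm y) : (Fin n → ℂ) [⋀^Fin 2]→L[ℝ] ℝ))
    ((chartJac c y).restrictScalars ℝ) (realBasis n)).symm

end Charts

/-! ### Stokes' theorem in a chart -/

section LocalStokes

open Set Filter Topology MeasureTheory

/-- A sum over permutations vanishes if the dependence on three of the positions is through a
function whose cyclic sum is zero. -/
theorem sum_perm_cyclic {ι : Type*} [Fintype ι] [DecidableEq ι] {p q r : ι} (hpq : p ≠ q)
    (hqr : q ≠ r) (hpr : p ≠ r) (G : Equiv.Perm ι → ℝ)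
    (hG : ∀ σ, G (σ * (Equiv.swap p q * Equiv.swap q r)) = G σ) (H : ι → ι → ι → ℝ)
    (hH : ∀ a b c, H a b c + H b c a + H c a b = 0) :
    ∑ σ : Equiv.Perm ι, ((Equiv.Perm.sign σ : ℤ) : ℝ) * (G σ * H (σ p) (σ q) (σ r)) = 0 := by
  set τ : Equiv.Perm ι := Equiv.swap p q * Equiv.swap q r with hτ
  have hs : Equiv.Perm.sign τ = 1 := by
    simp [hτ, Equiv.Perm.sign_swap hpq, Equiv.Perm.sign_swap hqr]
  have hp : τ p = q := by
    simp [hτ, Equiv.swap_apply_of_ne_of_ne hpq hpr]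
  have hq : τ q = r := by
    simp [hτ, Equiv.swap_apply_of_ne_of_ne hpr.symm hqr.symm]
  have hr : τ r = p := by
    simp [hτ]
  set S := fun f : Equiv.Perm ι → ℝ =>
    ∑ σ : Equiv.Perm ι, ((Equiv.Perm.sign σ : ℤ) : ℝ) * (G σ * f σ) with hS
  have shift : ∀ f : Equiv.Perm ι → ℝ, S f = S fun σ => f (σ * τ) := fun f => by
    rw [hS]
    simp only
    rw [← Equiv.sum_comp (Equiv.mulRight τ)]
    simp only [Equiv.coe_mulRight, Equiv.Perm.sign_mul, hs, mul_one, hG]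
  have h1 := shift fun σ => H (σ p) (σ q) (σ r)
  have h2 := shift fun σ => H (σ q) (σ r) (σ p)
  simp only [Equiv.Perm.mul_apply, hp, hq, hr] at h1 h2
  have h3 : S (fun σ => H (σ p) (σ q) (σ r)) + S (fun σ => H (σ q) (σ r) (σ p)) +
      S (fun σ => H (σ r) (σ p) (σ q)) = 0 := by
    rw [hS]
    simp only
    rw [← Finset.sum_add_distrib, ← Finset.sum_add_distrib]
    refine Finset.sum_eq_zero fun σ _ => ?_
    rw [← mul_add, ← mul_add, ← mul_add, ← mul_add, hH]
    ring
  change S (fun σ => H (σ p) (σ q) (σ r)) = 0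
  linarith

variable {n : ℕ}

theorem extDeriv_one_apply {θ : (Fin n → ℂ) → (Fin n → ℂ) [⋀^Fin 1]→L[ℝ] ℝ} {y : Fin n → ℂ}
    (h : DifferentiableAt ℝ θ y) (u v : Fin n → ℂ) :
    extDeriv θ y ![u, v] =
      fderiv ℝ (fun z => θ z ![v]) y u - fderiv ℝ (fun z => θ z ![u]) y v := by
  rw [extDeriv_apply h, Fin.sum_univ_two]
  have h0 : (0 : Fin 2).removeNth ![u, v] = ![v] := by funext j; fin_cases j; rfl
  have h1 : (1 : Fin 2).removeNth ![u, v] = ![u] := by funext j; fin_cases j; rfl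
  simp [h0, h1, sub_eq_add_neg]

theorem extDeriv_two_apply {γ : (Fin n → ℂ) → (Fin n → ℂ) [⋀^Fin 2]→L[ℝ] ℝ} {y : Fin n → ℂ}
    (h : DifferentiableAt ℝ γ y) (u v w : Fin n → ℂ) :
    extDeriv γ y ![u, v, w] =
      fderiv ℝ (fun z => γ z ![v, w]) y u - fderiv ℝ (fun z => γ z ![u, w]) y v +
        fderiv ℝ (fun z => γ z ![u, v]) y w := by
  rw [extDeriv_apply h, Fin.sum_univ_three]
  have h0 : (0 : Fin 3).removeNth ![u, v, w] = ![v, w] := by funext j; fin_cases j <;> rfl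
  have h1 : (1 : Fin 3).removeNth ![u, v, w] = ![u, w] := by funext j; fin_cases j <;> rfl
  have h2 : (2 : Fin 3).removeNth ![u, v, w] = ![u, v] := by funext j; fin_cases j <;> rfl
  simp [h0, h1, h2, sub_eq_add_neg]

theorem cyclic_fderiv_of_closed {γ : (Fin n → ℂ) → (Fin n → ℂ) [⋀^Fin 2]→L[ℝ] ℝ} {y : Fin n → ℂ}
    (h : DifferentiableAt ℝ γ y) (hd : extDeriv γ y = 0) (u v w : Fin n → ℂ) :
    fderiv ℝ (fun z => γ z ![v, w]) y u + fderiv ℝ (fun z => γ z ![w, u]) y v +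
      fderiv ℝ (fun z => γ z ![u, v]) y w = 0 := by
  have := extDeriv_two_apply h u v w
  rw [hd] at this
  have h2 : (fun z => γ z ![w, u]) = fun z => -(γ z ![u, w]) := by
    funext z; exact alt_swap _ _ _
  rw [h2, fderiv_fun_neg]
  change (0 : ℝ) = _ at this
  simp only [neg_apply]
  linarith

theorem integral_fderiv_eq_zero {f : (Fin n → ℂ) → ℝ} (hf : ContDiff ℝ ∞ f)
    (hc : HasCompactSupport f) (v : Fin n → ℂ) : ∫ y, fderiv ℝ f y v = 0 := by
  have h1 : Continuous fun y => fderiv ℝ f y v :=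
    (hf.continuous_fderiv (by simp)).clm_apply continuous_const
  have h2 : HasCompactSupport fun y => fderiv ℝ f y v := hc.fderiv_apply ℝ v
  have := integral_mul_fderiv_eq_neg_fderiv_mul_of_integrable (μ := volume) (f := fun _ => (1 : ℝ))
    (g := f) (v := v) (by simp) (by simpa using h1.integrable_of_hasCompactSupport h2)
    (by simpa using hf.continuous.integrable_of_hasCompactSupport hc)
    (fun _ _ => by fun_prop) (fun _ _ => (hf.differentiable (by simp)).differentiableAt)
  simpa using this

/-- The term of index `σ` in the expansion of `θ ∧ γ₁ ∧ ⋯ ∧ γₙ` (with the slot `k₀` left out). -/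
def stokesTerm (θ : (Fin n → ℂ) → (Fin n → ℂ) [⋀^Fin 1]→L[ℝ] ℝ)
    (γ : Fin n → (Fin n → ℂ) → (Fin n → ℂ) [⋀^Fin 2]→L[ℝ] ℝ) (k₀ : Fin n)
    (σ : Equiv.Perm (Fin n × Fin 2)) (y : Fin n → ℂ) : ℝ :=
  θ y ![realBasis n (σ (k₀, 1))] *
    ∏ k ∈ Finset.univ.erase k₀, γ k y ![realBasis n (σ (k, 0)), realBasis n (σ (k, 1))]

variable {θ : (Fin n → ℂ) → (Fin n → ℂ) [⋀^Fin 1]→L[ℝ] ℝ}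
  {γ : Fin n → (Fin n → ℂ) → (Fin n → ℂ) [⋀^Fin 2]→L[ℝ] ℝ} {k₀ : Fin n}

theorem differentiableAt_alt_apply {k : ℕ} {θ : (Fin n → ℂ) → (Fin n → ℂ) [⋀^Fin k]→L[ℝ] ℝ}
    {y : Fin n → ℂ} (h : DifferentiableAt ℝ θ y) (v : Fin k → Fin n → ℂ) :
    DifferentiableAt ℝ (fun z => θ z v) y :=
  ((ContinuousAlternatingMap.apply ℝ (Fin n → ℂ) ℝ v).differentiableAt).comp y h

theorem contDiffOn_alt_apply {k : ℕ} {θ : (Fin n → ℂ) → (Fin n → ℂ) [⋀^Fin k]→L[ℝ] ℝ}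
    {U : Set (Fin n → ℂ)} (h : ContDiffOn ℝ ∞ θ U) (v : Fin k → Fin n → ℂ) :
    ContDiffOn ℝ ∞ (fun z => θ z v) U :=
  (ContinuousAlternatingMap.apply ℝ (Fin n → ℂ) ℝ v).contDiff.comp_contDiffOn h

/-- `dθ ∧ γ₂ ∧ ⋯ ∧ γₙ` is a divergence if the forms `γ` are closed: the terms with a derivative of
`γ_l` cancel when a coordinate direction is permuted cyclically with the two arguments of `γ_l`. -/
theorem wedgeAt_extDeriv_eq_div {y : Fin n → ℂ} (hθ : DifferentiableAt ℝ θ y)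
    (hγ : ∀ k, k ≠ k₀ → DifferentiableAt ℝ (γ k) y)
    (hd : ∀ k, k ≠ k₀ → extDeriv (γ k) y = 0) :
    wedgeAt (fun k => if k = k₀ then extDeriv θ y else γ k y) (realBasis n) =
      (1 / 2 : ℝ) ^ n * 2 * ∑ σ : Equiv.Perm (Fin n × Fin 2),
        ((Equiv.Perm.sign σ : ℤ) : ℝ) *
          fderiv ℝ (stokesTerm θ γ k₀ σ) y (realBasis n (σ (k₀, 0))) := by
  set b := realBasis n
  set P : Equiv.Perm (Fin n × Fin 2) → ℝ := fun σ =>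
    ∏ k ∈ Finset.univ.erase k₀, γ k y ![b (σ (k, 0)), b (σ (k, 1))] with hP
  set T : Equiv.Perm (Fin n × Fin 2) → ℝ := fun σ =>
    fderiv ℝ (fun z => θ z ![b (σ (k₀, 1))]) y (b (σ (k₀, 0))) with hT
  set R : Fin n → Equiv.Perm (Fin n × Fin 2) → ℝ := fun l σ =>
    (θ y ![b (σ (k₀, 1))] * ∏ k ∈ (Finset.univ.erase k₀).erase l,
      γ k y ![b (σ (k, 0)), b (σ (k, 1))]) *
      fderiv ℝ (fun z => γ l z ![b (σ (l, 0)), b (σ (l, 1))]) y (b (σ (k₀, 0))) with hR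
  have hder : ∀ σ, fderiv ℝ (stokesTerm θ γ k₀ σ) y (b (σ (k₀, 0))) =
      T σ * P σ + ∑ l ∈ Finset.univ.erase k₀, R l σ := by
    intro σ
    have h1 := (differentiableAt_alt_apply hθ ![b (σ (k₀, 1))]).hasFDerivAt
    have h2 := HasFDerivAt.finsetProd (u := Finset.univ.erase k₀)
      (g := fun k z => γ k z ![b (σ (k, 0)), b (σ (k, 1))]) (x := y)
      fun k hk => (differentiableAt_alt_apply (hγ k (Finset.ne_of_mem_erase hk))
        ![b (σ (k, 0)), b (σ (k, 1))]).hasFDerivAt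
    have h3 := (h1.fun_mul h2).fderiv
    change fderiv ℝ (fun z => θ z ![b (σ (k₀, 1))] *
      ∏ k ∈ Finset.univ.erase k₀, γ k z ![b (σ (k, 0)), b (σ (k, 1))]) y _ = _
    rw [h3]
    simp only [add_apply, smul_apply, sum_apply, smul_eq_mul, hT, hP, hR, Finset.mul_sum]
    rw [add_comm]
    congr 1
    · ring
    · exact Finset.sum_congr rfl fun l _ => by ring
  have hRsum : ∀ l ∈ Finset.univ.erase k₀,
      ∑ σ : Equiv.Perm (Fin n × Fin 2), ((Equiv.Perm.sign σ : ℤ) : ℝ) * R l σ = 0 := by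
    intro l hl
    have hlk : l ≠ k₀ := Finset.ne_of_mem_erase hl
    refine sum_perm_cyclic (p := (k₀, 0)) (q := (l, 0)) (r := (l, 1))
      (by simp [hlk.symm]) (by simp) (by simp [hlk.symm])
      (fun σ => θ y ![b (σ (k₀, 1))] * ∏ k ∈ (Finset.univ.erase k₀).erase l,
        γ k y ![b (σ (k, 0)), b (σ (k, 1))]) ?_
      (fun p q r => fderiv ℝ (fun z => γ l z ![b q, b r]) y (b p)) ?_
    · intro σ
      have hfix : ∀ q : Fin n × Fin 2, q ≠ (k₀, 0) → q.1 ≠ l →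
          (σ * (Equiv.swap (k₀, 0) (l, 0) * Equiv.swap (l, 0) (l, 1)) :
            Equiv.Perm (Fin n × Fin 2)) q = σ q := by
        intro q h1 h2
        have h3 : ∀ j, q ≠ (l, j) := fun j h => h2 (congrArg Prod.fst h)
        rw [Equiv.Perm.mul_apply, Equiv.Perm.mul_apply,
          Equiv.swap_apply_of_ne_of_ne (h3 0) (h3 1), Equiv.swap_apply_of_ne_of_ne h1 (h3 0)]
      rw [hfix (k₀, 1) (by simp) hlk.symm]
      congr 1
      refine Finset.prod_congr rfl fun k hk => ?_
      have hkl : k ≠ l := Finset.ne_of_mem_erase hk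
      have hkk : k ≠ k₀ := Finset.ne_of_mem_erase (Finset.mem_of_mem_erase hk)
      rw [hfix (k, 0) (by simp [hkk]) hkl, hfix (k, 1) (by simp) hkl]
    · intro p q r
      exact cyclic_fderiv_of_closed (hγ l hlk) (hd l hlk) (b p) (b q) (b r)
  have hsum : ∑ σ : Equiv.Perm (Fin n × Fin 2), ((Equiv.Perm.sign σ : ℤ) : ℝ) *
      fderiv ℝ (stokesTerm θ γ k₀ σ) y (b (σ (k₀, 0))) =
      ∑ σ : Equiv.Perm (Fin n × Fin 2), ((Equiv.Perm.sign σ : ℤ) : ℝ) * (T σ * P σ) := by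
    simp only [hder, mul_add, Finset.sum_add_distrib, Finset.mul_sum]
    rw [Finset.sum_comm, Finset.sum_eq_zero hRsum, add_zero]
  rw [hsum, wedgeAt_apply]
  -- exchanging the two arguments of `dθ` gives the second half of `dθ`
  set τ := Equiv.swap ((k₀, 0) : Fin n × Fin 2) (k₀, 1) with hτ
  have hτfix : ∀ σ : Equiv.Perm (Fin n × Fin 2), P (σ * τ) = P σ := by
    intro σ
    refine Finset.prod_congr rfl fun k hk => ?_
    have hkk : k ≠ k₀ := Finset.ne_of_mem_erase hk
    rw [Equiv.Perm.mul_apply, Equiv.Perm.mul_apply, hτ,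
      Equiv.swap_apply_of_ne_of_ne (by simp [hkk]) (by simp [hkk]),
      Equiv.swap_apply_of_ne_of_ne (by simp [hkk]) (by simp [hkk])]
  have hswap : ∑ σ : Equiv.Perm (Fin n × Fin 2), ((Equiv.Perm.sign σ : ℤ) : ℝ) *
      (fderiv ℝ (fun z => θ z ![b (σ (k₀, 0))]) y (b (σ (k₀, 1))) * P σ) =
      - ∑ σ : Equiv.Perm (Fin n × Fin 2), ((Equiv.Perm.sign σ : ℤ) : ℝ) * (T σ * P σ) := by
    rw [← Equiv.sum_comp (Equiv.mulRight τ), ← Finset.sum_neg_distrib]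
    refine Finset.sum_congr rfl fun σ _ => ?_
    rw [Equiv.coe_mulRight, hτfix, Equiv.Perm.sign_mul, hτ, Equiv.Perm.sign_swap (by simp)]
    simp [hT]
  have hterm : ∀ σ : Equiv.Perm (Fin n × Fin 2),
      ∏ k, (if k = k₀ then extDeriv θ y else γ k y) ![b (σ (k, 0)), b (σ (k, 1))] =
      T σ * P σ - fderiv ℝ (fun z => θ z ![b (σ (k₀, 0))]) y (b (σ (k₀, 1))) * P σ := by
    intro σ
    rw [← Finset.mul_prod_erase _ _ (Finset.mem_univ k₀), if_pos rfl, extDeriv_one_apply hθ,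
      Finset.prod_congr rfl (g := fun k => γ k y ![b (σ (k, 0)), b (σ (k, 1))])
        (fun k hk => by rw [if_neg (Finset.ne_of_mem_erase hk)])]
    ring
  simp only [hterm, mul_sub, Finset.sum_sub_distrib, hswap]
  ring

/-- Stokes' theorem for a compactly supported `1`-form and closed `2`-forms on an open set. -/
theorem setIntegral_wedgeAt_extDeriv {V K : Set (Fin n → ℂ)} (hV : IsOpen V) (hK : IsCompact K)
    (hKV : K ⊆ V) (hθ : ContDiffOn ℝ ∞ θ V) (hsupp : ∀ y ∈ V, y ∉ K → θ y = 0)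
    (hγ : ∀ k, k ≠ k₀ → ContDiffOn ℝ ∞ (γ k) V)
    (hd : ∀ k, k ≠ k₀ → ∀ y ∈ V, extDeriv (γ k) y = 0) :
    ∫ y in V, wedgeAt (fun k => if k = k₀ then extDeriv θ y else γ k y) (realBasis n) = 0 := by
  set F : Equiv.Perm (Fin n × Fin 2) → (Fin n → ℂ) → ℝ := fun σ =>
    V.indicator (stokesTerm θ γ k₀ σ) with hF
  have hzero : ∀ σ y, y ∉ K → F σ y = 0 := by
    intro σ y hy
    by_cases hyV : y ∈ V
    · simp [hF, hyV, stokesTerm, hsupp y hyV hy]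
    · simp [hF, hyV]
  have hFcd : ∀ σ, ContDiff ℝ ∞ (F σ) := by
    intro σ
    rw [contDiff_iff_contDiffAt]
    intro y
    by_cases hyV : y ∈ V
    · have h1 : ContDiffOn ℝ ∞ (stokesTerm θ γ k₀ σ) V :=
        (contDiffOn_alt_apply hθ _).mul (contDiffOn_prod fun k hk =>
          contDiffOn_alt_apply (hγ k (Finset.ne_of_mem_erase hk)) _)
      refine (h1.contDiffAt (hV.mem_nhds hyV)).congr_of_eventuallyEq ?_
      filter_upwards [hV.mem_nhds hyV] with z hz
      simp [hF, hz]
    · have h1 : F σ =ᶠ[𝓝 y] fun _ => 0 := by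
        filter_upwards [hK.isClosed.isOpen_compl.mem_nhds fun h => hyV (hKV h)] with z hz
        exact hzero σ z hz
      exact contDiffAt_const.congr_of_eventuallyEq h1
  have hFc : ∀ σ, HasCompactSupport (F σ) := fun σ =>
    HasCompactSupport.intro hK fun y hy => hzero σ y hy
  have hderiv : ∀ σ, ∀ y ∈ V, fderiv ℝ (stokesTerm θ γ k₀ σ) y = fderiv ℝ (F σ) y := by
    intro σ y hy
    refine Filter.EventuallyEq.fderiv_eq ?_
    filter_upwards [hV.mem_nhds hy] with z hz
    simp [hF, hz]
  have hint : ∀ σ v, Integrable fun y => fderiv ℝ (F σ) y v := fun σ v =>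
    (((hFcd σ).continuous_fderiv (by simp)).clm_apply
      continuous_const).integrable_of_hasCompactSupport ((hFc σ).fderiv_apply ℝ v)
  have hout : ∀ σ v, ∫ y in V, fderiv ℝ (F σ) y v = 0 := by
    intro σ v
    rw [setIntegral_eq_integral_of_forall_compl_eq_zero, integral_fderiv_eq_zero (hFcd σ) (hFc σ)]
    intro y hy
    have h1 : F σ =ᶠ[𝓝 y] fun _ => 0 := by
      filter_upwards [hK.isClosed.isOpen_compl.mem_nhds fun h => hy (hKV h)] with z hz
      exact hzero σ z hz
    simp [h1.fderiv_eq]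
  calc _ = ∫ y in V, (1 / 2 : ℝ) ^ n * 2 * ∑ σ : Equiv.Perm (Fin n × Fin 2),
        ((Equiv.Perm.sign σ : ℤ) : ℝ) * fderiv ℝ (F σ) y (realBasis n (σ (k₀, 0))) := by
        refine setIntegral_congr_fun hV.measurableSet fun y hy => ?_
        have hnh := hV.mem_nhds hy
        rw [wedgeAt_extDeriv_eq_div ((hθ.contDiffAt hnh).differentiableAt (by simp))
          (fun k hk => ((hγ k hk).contDiffAt hnh).differentiableAt (by simp))
          (fun k hk => hd k hk y hy)]
        simp only [hderiv _ y hy]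
    _ = 0 := by
        rw [integral_const_mul, integral_finsetSum]
        · simp [integral_const_mul, hout]
        · exact fun σ _ => ((hint σ _).const_mul _).integrableOn

end LocalStokes

/-! ### Integration of top forms -/

section Integration

open Set Filter Topology MeasureTheory

variable {n : ℕ} {X : Type*} [TopologicalSpace X] [ChartedSpace (Fin n → ℂ) X]
  [IsManifold 𝓘(ℂ, Fin n → ℂ) ω X] [T2Space X] [CompactSpace X]

theorem integrableOn_of_continuousOn_of_support {f : (Fin n → ℂ) → ℝ} {V K : Set (Fin n → ℂ)}
    (hV : IsOpen V) (hK : IsCompact K) (hKV : K ⊆ V) (hf : ContinuousOn f V)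
    (h0 : ∀ y ∈ V, y ∉ K → f y = 0) : IntegrableOn f V :=
  ((hf.mono hKV).integrableOn_compact hK).of_forall_sdiff_eq_zero hV.measurableSet
    fun y hy => h0 y hy.1 hy.2

/-- A top form is continuous if its coefficient in every chart is. -/
def TopForm.IsContinuous (τ : TopForm n X) : Prop :=
  ∀ c ∈ atlas (Fin n → ℂ) X, ContinuousOn (τ.coeff c) c.target

variable (n) in
theorem chartPartition_isSubordinate (p : X) :
    tsupport (chartPartition n X p) ⊆ (chartAt (Fin n → ℂ) p).source :=
  haveI := isManifold_real n X
  (SmoothPartitionOfUnity.exists_isSubordinate_chartAt_source 𝓘(ℝ, Fin n → ℂ) X).choose_spec p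

variable (n X) in
theorem finite_chartPartition :
    {p : X | (Function.support (chartPartition n X p)).Nonempty}.Finite :=
  (chartPartition n X).locallyFinite.finite_nonempty_of_compact

variable (n X) in
/-- The finitely many indices of the non-zero functions of the partition of unity. -/
def partitionIndex : Finset X := (finite_chartPartition n X).toFinset

theorem chartPartition_eq_zero {p : X} (hp : p ∉ partitionIndex n X) (x : X) :
    chartPartition n X p x = 0 := by
  by_contra h
  exact hp ((finite_chartPartition n X).mem_toFinset.2 ⟨x, h⟩)

variable (n) in
theorem sum_chartPartition (x : X) : ∑ p ∈ partitionIndex n X, chartPartition n X p x = 1 := by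
  rw [← (chartPartition n X).sum_eq_one (mem_univ x)]
  refine (finsum_eq_sum_of_support_subset _ fun p hp => ?_).symm
  by_contra h
  exact hp (chartPartition_eq_zero h x)

theorem TopForm.integral_eq_sum (τ : TopForm n X) :
    τ.integral = ∑ p ∈ partitionIndex n X, ∫ y in (chartAt (Fin n → ℂ) p).target,
      chartPartition n X p ((chartAt (Fin n → ℂ) p).symm y) *
        τ.coeff (chartAt (Fin n → ℂ) p) y := by
  rw [TopForm.integral]
  refine finsum_eq_sum_of_support_subset _ fun p hp => ?_
  by_contra h
  exact hp (by simp [chartPartition_eq_zero h])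

theorem isCompact_image_chart (c : OpenPartialHomeomorph X (Fin n → ℂ)) {K : Set X}
    (hK : IsClosed K) (hKc : K ⊆ c.source) : IsCompact (c '' K) :=
  hK.isCompact.image_of_continuousOn (c.continuousOn.mono hKc)

theorem image_chart_subset (c : OpenPartialHomeomorph X (Fin n → ℂ)) {K : Set X}
    (hKc : K ⊆ c.source) : c '' K ⊆ c.target := by
  rintro _ ⟨x, hx, rfl⟩
  exact c.map_source (hKc hx)

theorem symm_notMem_of_notMem_image (c : OpenPartialHomeomorph X (Fin n → ℂ)) {K : Set X}
    {y : Fin n → ℂ} (hy : y ∈ c.target) (h : y ∉ c '' K) : c.symm y ∉ K :=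
  fun hK => h ⟨c.symm y, hK, c.right_inv hy⟩

theorem continuousOn_comp_symm (c : OpenPartialHomeomorph X (Fin n → ℂ)) {f : X → ℝ}
    (hf : Continuous f) : ContinuousOn (fun y => f (c.symm y)) c.target :=
  hf.comp_continuousOn c.continuousOn_symm

theorem chartPartition_continuous (p : X) : Continuous (chartPartition n X p) :=
  ((chartPartition n X p).contMDiff).continuous

theorem TopForm.IsContinuous.integrableOn {τ : TopForm n X} (hτ : τ.IsContinuous) (p : X) :
    IntegrableOn (fun y => chartPartition n X p ((chartAt (Fin n → ℂ) p).symm y) *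
      τ.coeff (chartAt (Fin n → ℂ) p) y) (chartAt (Fin n → ℂ) p).target := by
  set c := chartAt (Fin n → ℂ) p
  refine integrableOn_of_continuousOn_of_support c.open_target
    (isCompact_image_chart c (isClosed_tsupport _) (chartPartition_isSubordinate n p))
    (image_chart_subset c (chartPartition_isSubordinate n p))
    ((continuousOn_comp_symm c (chartPartition_continuous p)).mul (hτ c (chart_mem_atlas _ _)))
    fun y hy h => ?_
  rw [image_eq_zero_of_notMem_tsupport (symm_notMem_of_notMem_image c hy h), zero_mul]

theorem TopForm.integral_congr {τ τ' : TopForm n X} (h : ∀ x, τ x = τ' x) :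
    τ.integral = τ'.integral := by
  rw [funext h]

theorem TopForm.integral_add {τ τ' : TopForm n X} (hτ : τ.IsContinuous) (hτ' : τ'.IsContinuous) :
    TopForm.integral (fun x => τ x + τ' x) = τ.integral + τ'.integral := by
  rw [TopForm.integral_eq_sum, TopForm.integral_eq_sum, TopForm.integral_eq_sum,
    ← Finset.sum_add_distrib]
  refine Finset.sum_congr rfl fun p _ => ?_
  rw [← MeasureTheory.integral_add (hτ.integrableOn p) (hτ'.integrableOn p)]
  refine integral_congr_ae (Eventually.of_forall fun y => ?_)
  simp only [TopForm.coeff, AlternatingMap.add_apply]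
  ring

theorem TopForm.integral_smul (τ : TopForm n X) (a : ℝ) :
    TopForm.integral (fun x => a • τ x) = a * τ.integral := by
  rw [TopForm.integral_eq_sum, TopForm.integral_eq_sum, Finset.mul_sum]
  refine Finset.sum_congr rfl fun p _ => ?_
  rw [← integral_const_mul]
  refine integral_congr_ae (Eventually.of_forall fun y => ?_)
  simp only [TopForm.coeff, AlternatingMap.smul_apply, smul_eq_mul]
  ring

theorem TopForm.IsContinuous.add {τ τ' : TopForm n X} (hτ : τ.IsContinuous)
    (hτ' : τ'.IsContinuous) : TopForm.IsContinuous fun x => τ x + τ' x :=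
  fun c hc => (hτ c hc).add (hτ' c hc)

theorem TopForm.IsContinuous.fun_smul {τ : TopForm n X} (hτ : τ.IsContinuous) {f : X → ℝ}
    (hf : Continuous f) : TopForm.IsContinuous fun x => f x • τ x :=
  fun c hc => (continuousOn_comp_symm c hf).mul (hτ c hc)

theorem TopForm.isContinuous_zero : TopForm.IsContinuous (fun _ => 0 : TopForm n X) :=
  fun _ _ => continuousOn_const (c := (0 : ℝ))

theorem TopForm.isContinuous_sum {ι : Type*} (s : Finset ι) {τ : ι → TopForm n X}
    (hτ : ∀ i ∈ s, (τ i).IsContinuous) : TopForm.IsContinuous fun x => ∑ i ∈ s, τ i x := by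
  classical
  induction s using Finset.induction_on with
  | empty => simpa using TopForm.isContinuous_zero
  | insert i s hi ih =>
    simp only [Finset.sum_insert hi]
    exact (hτ i (Finset.mem_insert_self _ _)).add
      (ih fun j hj => hτ j (Finset.mem_insert_of_mem hj))

theorem TopForm.integral_zero : TopForm.integral (fun _ => 0 : TopForm n X) = 0 := by
  have := TopForm.integral_smul (fun _ => 0 : TopForm n X) 0
  simpa using this

theorem TopForm.integral_finsetSum {ι : Type*} (s : Finset ι) {τ : ι → TopForm n X}
    (hτ : ∀ i ∈ s, (τ i).IsContinuous) :
    TopForm.integral (fun x => ∑ i ∈ s, τ i x) = ∑ i ∈ s, (τ i).integral := by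
  classical
  induction s using Finset.induction_on with
  | empty => simpa using TopForm.integral_zero
  | insert i s hi ih =>
    have hs : ∀ j ∈ s, (τ j).IsContinuous := fun j hj => hτ j (Finset.mem_insert_of_mem hj)
    simp only [Finset.sum_insert hi]
    rw [TopForm.integral_add (hτ i (Finset.mem_insert_self _ _)) (TopForm.isContinuous_sum s hs),
      ih hs]

theorem image_transition {c c' : OpenPartialHomeomorph X (Fin n → ℂ)} :
    transition c c' '' overlap c c' = overlap c' c := by
  ext z
  constructor
  · rintro ⟨y, hy, rfl⟩
    exact transition_mem_overlap hy
  · intro hz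
    exact ⟨_, transition_mem_overlap hz, transition_transition hz⟩

/-- Change of variables between two charts. -/
theorem setIntegral_overlap {c c' : OpenPartialHomeomorph X (Fin n → ℂ)}
    (hc : c ∈ atlas (Fin n → ℂ) X) (hc' : c' ∈ atlas (Fin n → ℂ) X) (τ : TopForm n X) (f : X → ℝ) :
    ∫ y in overlap c' c, f (c'.symm y) * τ.coeff c' y =
      ∫ y in overlap c c', f (c.symm y) * τ.coeff c y := by
  have hinj : InjOn (transition c c') (overlap c c') := fun y hy z hz h => by
    rw [← transition_transition hy, h, transition_transition hz]
  rw [← image_transition (c := c) (c' := c'),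
    integral_image_eq_integral_abs_det_fderiv_smul volume (isOpen_overlap c c').measurableSet
      (f' := fun y => (fderiv ℂ (transition c c') y).restrictScalars ℝ)
      (fun y hy => ((differentiableAt_transition hc hc'
        hy).hasFDerivAt.restrictScalars ℝ).hasFDerivWithinAt) hinj]
  refine setIntegral_congr_fun (isOpen_overlap c c').measurableSet fun y hy => ?_
  have hdet : ((fderiv ℂ (transition c c') y).restrictScalars ℝ).det = Complex.normSq
      (LinearMap.det (fderiv ℂ (transition c c') y : (Fin n → ℂ) →ₗ[ℂ] (Fin n → ℂ))) := by
    rw [← Algebra.norm_complex_apply, ← LinearMap.det_restrictScalars]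
    rfl
  rw [hdet, abs_of_nonneg (Complex.normSq_nonneg _), symm_transition hy,
    TopForm.coeff_transition τ hc hc' hy, smul_eq_mul]
  ring

/-- The integral of a top form supported in the domain of a chart can be computed in this chart. -/
theorem TopForm.integral_eq_setIntegral {τ : TopForm n X} (hτ : τ.IsContinuous)
    {c : OpenPartialHomeomorph X (Fin n → ℂ)} (hc : c ∈ atlas (Fin n → ℂ) X) {K : Set X}
    (hK : IsClosed K) (hKc : K ⊆ c.source) (h0 : ∀ x, x ∉ K → τ x = 0) :
    τ.integral = ∫ y in c.target, τ.coeff c y := by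
  have hcoeff : ∀ (c : OpenPartialHomeomorph X (Fin n → ℂ)) (y : Fin n → ℂ), c.symm y ∉ K →
      τ.coeff c y = 0 := fun c y hy => by
    rw [TopForm.coeff, h0 _ hy]
    rfl
  have key : ∀ p : X, ∫ y in (chartAt (Fin n → ℂ) p).target,
      chartPartition n X p ((chartAt (Fin n → ℂ) p).symm y) * τ.coeff (chartAt (Fin n → ℂ) p) y =
      ∫ y in c.target, chartPartition n X p (c.symm y) * τ.coeff c y := by
    intro p
    set c' := chartAt (Fin n → ℂ) p
    have h1 : ∫ y in c'.target, chartPartition n X p (c'.symm y) * τ.coeff c' y =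
        ∫ y in overlap c' c, chartPartition n X p (c'.symm y) * τ.coeff c' y := by
      refine setIntegral_eq_of_subset_of_forall_sdiff_eq_zero c'.open_target.measurableSet
        (fun y hy => hy.1) fun y hy => ?_
      rw [hcoeff c' y fun h => hy.2 ⟨hy.1, hKc h⟩, mul_zero]
    have h2 : ∫ y in c.target, chartPartition n X p (c.symm y) * τ.coeff c y =
        ∫ y in overlap c c', chartPartition n X p (c.symm y) * τ.coeff c y := by
      refine setIntegral_eq_of_subset_of_forall_sdiff_eq_zero c.open_target.measurableSet
        (fun y hy => hy.1) fun y hy => ?_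
      rw [image_eq_zero_of_notMem_tsupport fun h => hy.2
        ⟨hy.1, chartPartition_isSubordinate n p h⟩, zero_mul]
    rw [h1, h2, setIntegral_overlap hc (chart_mem_atlas _ _)]
  rw [TopForm.integral_eq_sum, Finset.sum_congr rfl fun p _ => key p, ← MeasureTheory.integral_finsetSum]
  · refine setIntegral_congr_fun c.open_target.measurableSet fun y _ => ?_
    rw [← Finset.sum_mul, sum_chartPartition, one_mul]
  · intro p _
    refine integrableOn_of_continuousOn_of_support c.open_target
      (isCompact_image_chart c hK hKc) (image_chart_subset c hKc)
      ((continuousOn_comp_symm c (chartPartition_continuous p)).mul (hτ c hc)) fun y hy h => ?_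
    rw [hcoeff c y (symm_notMem_of_notMem_image c hy h), mul_zero]

/-! ### Stokes' theorem on a compact complex manifold -/

theorem prod_erase_slot (γ : Fin n → (Fin n → ℂ) [⋀^Fin 2]→L[ℝ] ℝ) (k₀ : Fin n)
    (β β' : (Fin n → ℂ) [⋀^Fin 2]→L[ℝ] ℝ) (v : Fin n × Fin 2 → Fin n → ℂ)
    (σ : Equiv.Perm (Fin n × Fin 2)) :
    ∏ k ∈ Finset.univ.erase k₀, (if k = k₀ then β else γ k) ![v (σ (k, 0)), v (σ (k, 1))] =
      ∏ k ∈ Finset.univ.erase k₀, (if k = k₀ then β' else γ k) ![v (σ (k, 0)), v (σ (k, 1))] :=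
  Finset.prod_congr rfl fun k hk => by
    rw [if_neg (Finset.ne_of_mem_erase hk), if_neg (Finset.ne_of_mem_erase hk)]

/-- The wedge product of `2`-forms on `ℂⁿ` as a linear function of one of the factors. -/
def wedgeSlot (γ : Fin n → (Fin n → ℂ) [⋀^Fin 2]→L[ℝ] ℝ) (k₀ : Fin n) :
    ((Fin n → ℂ) [⋀^Fin 2]→L[ℝ] ℝ) →ₗ[ℝ] (Fin n → ℂ) [⋀^(Fin n × Fin 2)]→ₗ[ℝ] ℝ where
  toFun β := wedgeAt fun k => if k = k₀ then β else γ k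
  map_add' β β' := by
    ext v
    rw [AlternatingMap.add_apply, wedgeAt_apply, wedgeAt_apply, wedgeAt_apply, ← mul_add,
      ← Finset.sum_add_distrib]
    congr 1
    refine Finset.sum_congr rfl fun σ _ => ?_
    rw [← mul_add]
    congr 1
    simp only [← Finset.mul_prod_erase _ _ (Finset.mem_univ k₀), if_pos]
    rw [ContinuousAlternatingMap.add_apply, add_mul,
      prod_erase_slot γ k₀ (β + β') β v σ, prod_erase_slot γ k₀ β' β v σ]
  map_smul' t β := by
    ext v
    rw [AlternatingMap.smul_apply, wedgeAt_apply, wedgeAt_apply, RingHom.id_apply, smul_eq_mul,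
      mul_left_comm]
    congr 1
    rw [Finset.mul_sum]
    refine Finset.sum_congr rfl fun σ _ => ?_
    rw [mul_left_comm]
    congr 1
    simp only [← Finset.mul_prod_erase _ _ (Finset.mem_univ k₀), if_pos]
    rw [ContinuousAlternatingMap.smul_apply, smul_eq_mul, mul_assoc,
      prod_erase_slot γ k₀ (t • β) β v σ]

theorem wedge_slot (γ : Fin n → DForm n X 2) (k₀ : Fin n) (α : DForm n X 2) (x : X) :
    wedge (fun k => if k = k₀ then α else γ k) x = wedgeSlot (fun k => γ k x) k₀ (α x) := by
  change wedgeAt (fun k => (if k = k₀ then α else γ k) x) =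
    wedgeAt (fun k => if k = k₀ then (α x : (Fin n → ℂ) [⋀^Fin 2]→L[ℝ] ℝ) else γ k x)
  congr 1
  funext k
  by_cases hk : k = k₀
  · rw [if_pos hk]
    exact (if_pos hk).symm
  · rw [if_neg hk]
    exact (if_neg hk).symm

theorem isContinuous_wedge {β : Fin n → DForm n X 2} (hβ : ∀ k, (β k).IsSmooth) :
    TopForm.IsContinuous (wedge β) := by
  intro c hc
  have h : ContinuousOn (fun y => (1 / 2 : ℝ) ^ n * ∑ σ : Equiv.Perm (Fin n × Fin 2),
      ((Equiv.Perm.sign σ : ℤ) : ℝ) * ∏ k, (β k).inChart c y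
        ![realBasis n (σ (k, 0)), realBasis n (σ (k, 1))]) c.target :=
    continuousOn_const.mul (continuousOn_finsetSum _ fun σ _ => continuousOn_const.mul
      (continuousOn_finsetProd _ fun k _ => (contDiffOn_alt_apply (hβ k c hc) _).continuousOn))
  exact h.congr fun y hy => by rw [coeff_wedge β hc hy, wedgeAt_apply]

theorem chartPartition_contDiffOn (p : X) {c : OpenPartialHomeomorph X (Fin n → ℂ)}
    (hc : c ∈ atlas (Fin n → ℂ) X) :
    ContDiffOn ℝ ∞ (fun y => chartPartition n X p (c.symm y)) c.target := by
  have := isManifold_real n X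
  have h1 : ContMDiffOn 𝓘(ℝ, Fin n → ℂ) 𝓘(ℝ, Fin n → ℂ) ∞ c.symm c.target :=
    contMDiffOn_symm_of_mem_maximalAtlas (IsManifold.subset_maximalAtlas hc)
  exact ((chartPartition n X p).contMDiff.comp_contMDiffOn h1).contDiffOn

/-- The product of a `1`-form with a function of the partition of unity. -/
def cutOff (p : X) (η : DForm n X 1) : DForm n X 1 := fun x => chartPartition n X p x • η x

theorem cutOff_inChart (p : X) (η : DForm n X 1) (c : OpenPartialHomeomorph X (Fin n → ℂ))
    (y : Fin n → ℂ) : (cutOff p η).inChart c y =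
      chartPartition n X p (c.symm y) • η.inChart c y := by
  ext v
  rfl

theorem cutOff_isSmooth (p : X) {η : DForm n X 1} (hη : η.IsSmooth) : (cutOff p η).IsSmooth :=
  fun c hc => ((chartPartition_contDiffOn p hc).smul (hη c hc)).congr fun y _ =>
    cutOff_inChart p η c y

theorem DForm.d_eq_zero_of_notMem {η : DForm n X 1} {K : Set X} (hK : IsClosed K)
    (h0 : ∀ x, x ∉ K → η x = 0) {x : X} (hx : x ∉ K) : η.d x = 0 := by
  set c := chartAt (Fin n → ℂ) x
  have hU : IsOpen (c.target ∩ c.symm ⁻¹' Kᶜ) := c.isOpen_inter_preimage_symm hK.isOpen_compl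
  have hxU : c x ∈ c.target ∩ c.symm ⁻¹' Kᶜ :=
    ⟨mem_chart_target _ x, by rwa [mem_preimage, c.left_inv (mem_chart_source _ x)]⟩
  have h1 : η.inChart c =ᶠ[𝓝 (c x)] fun _ => 0 := by
    filter_upwards [hU.mem_nhds hxU] with y hy
    rw [DForm.inChart, h0 _ hy.2]
    rfl
  rw [DForm.d_eq, h1.extDeriv_eq]
  simp only [extDeriv, fderiv_fun_const, Pi.zero_apply]
  exact map_zero (ContinuousAlternatingMap.alternatizeUncurryFinCLM ℝ (Fin n → ℂ) ℝ)

theorem sum_cutOff_d {η : DForm n X 1} (hη : η.IsSmooth) (x : X) :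
    ∑ p ∈ partitionIndex n X, (cutOff p η).d x = η.d x := by
  set c := chartAt (Fin n → ℂ) x
  have hc := chart_mem_atlas (Fin n → ℂ) x
  have hsum : η.inChart c = ∑ p ∈ partitionIndex n X, (cutOff p η).inChart c := by
    funext y
    rw [Finset.sum_apply]
    simp only [cutOff_inChart, ← Finset.sum_smul, sum_chartPartition, one_smul]
  have hdiff : ∀ p, DifferentiableAt ℝ ((cutOff p η).inChart c) (c x) := fun p =>
    ((cutOff_isSmooth p hη c hc).contDiffAt
      (c.open_target.mem_nhds (mem_chart_target _ x))).differentiableAt (by simp)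
  have hlin : ∀ θ : (Fin n → ℂ) → (Fin n → ℂ) [⋀^Fin 1]→L[ℝ] ℝ, extDeriv θ (c x) =
      ContinuousAlternatingMap.alternatizeUncurryFinCLM ℝ (Fin n → ℂ) ℝ (fderiv ℝ θ (c x)) :=
    fun _ => rfl
  simp only [DForm.d_eq]
  rw [hsum, hlin, fderiv_sum fun p _ => hdiff p, map_sum]
  exact Finset.sum_congr rfl fun p _ => hlin _

/-- **Stokes' theorem**: the integral of `dη ∧ γ₂ ∧ ⋯ ∧ γₙ`, with `dη` in any slot, vanishes for
closed `2`-forms `γ`. -/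
theorem integral_wedge_d_eq_zero {η : DForm n X 1} (hη : η.IsSmooth) (γ : Fin n → DForm n X 2)
    (k₀ : Fin n) (hγ : ∀ k, k ≠ k₀ → (γ k).IsClosedForm) :
    TopForm.integral (wedge fun k => if k = k₀ then η.d else γ k) = 0 := by
  set T : X → TopForm n X := fun p => wedge fun k => if k = k₀ then (cutOff p η).d else γ k with hT
  have hcont : ∀ p, (T p).IsContinuous := fun p => isContinuous_wedge fun k => by
    by_cases hk : k = k₀
    · simpa [hk] using (cutOff_isSmooth p hη).d
    · simpa [hk] using (hγ k hk).smooth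
  have hslot := wedge_slot γ k₀
  have hsum : ∀ x, wedge (fun k => if k = k₀ then η.d else γ k) x =
      ∑ p ∈ partitionIndex n X, T p x := by
    intro x
    simp only [hT, hslot]
    rw [← sum_cutOff_d hη x]
    exact map_sum (wedgeSlot (fun k => γ k x) k₀) _ _
  rw [TopForm.integral_congr hsum, TopForm.integral_finsetSum _ fun p _ => hcont p]
  refine Finset.sum_eq_zero fun p _ => ?_
  set c := chartAt (Fin n → ℂ) p
  have hc := chart_mem_atlas (Fin n → ℂ) p
  have hsub := chartPartition_isSubordinate n p
  have hcut : ∀ x, x ∉ tsupport (chartPartition n X p) → cutOff p η x = 0 := fun x hx => by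
    rw [cutOff, image_eq_zero_of_notMem_tsupport hx]
    exact zero_smul ℝ _
  rw [TopForm.integral_eq_setIntegral (hcont p) hc (isClosed_tsupport _) hsub]
  · rw [← setIntegral_wedgeAt_extDeriv (k₀ := k₀) (γ := fun k => (γ k).inChart c)
      (θ := (cutOff p η).inChart c) c.open_target
      (isCompact_image_chart c (isClosed_tsupport _) hsub) (image_chart_subset c hsub)
      (cutOff_isSmooth p hη c hc) (fun y hy h => ?_) (fun k hk => (hγ k hk).smooth c hc)
      (fun k hk => (hγ k hk).closed c hc)]
    · refine setIntegral_congr_fun c.open_target.measurableSet fun y hy => ?_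
      simp only [hT]
      rw [coeff_wedge _ hc hy, ← DForm.d_inChart (cutOff_isSmooth p hη) hc hy]
      congr 1
      congr 1
      funext k
      split_ifs <;> rfl
    · rw [DForm.inChart, hcut _ (symm_notMem_of_notMem_image c hy h)]
      rfl
  · intro x hx
    rw [hT]
    simp only
    rw [hslot, DForm.d_eq_zero_of_notMem (isClosed_tsupport _) hcut hx]
    exact map_zero _

/-- Replacing a closed factor by a cohomologous one does not change the integral of a wedge
product of closed forms. -/
theorem integral_wedge_slot_congr {α α' : DForm n X 2} (h : Cohomologous α α')
    (hα : α.IsSmooth) (γ : Fin n → DForm n X 2) (k₀ : Fin n)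
    (hγ : ∀ k, k ≠ k₀ → (γ k).IsClosedForm) :
    TopForm.integral (wedge fun k => if k = k₀ then α' else γ k) =
      TopForm.integral (wedge fun k => if k = k₀ then α else γ k) := by
  obtain ⟨η, hη, h⟩ := h
  have hslot := wedge_slot γ k₀
  have hcont : ∀ {α : DForm n X 2}, α.IsSmooth →
      TopForm.IsContinuous (wedge fun k => if k = k₀ then α else γ k) := fun {α} hα =>
    isContinuous_wedge fun k => by
      by_cases hk : k = k₀
      · simpa [hk] using hα
      · simpa [hk] using (hγ k hk).smooth
  have hadd : ∀ x, wedge (fun k => if k = k₀ then α' else γ k) x =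
      wedge (fun k => if k = k₀ then α else γ k) x +
        wedge (fun k => if k = k₀ then η.d else γ k) x := by
    intro x
    rw [hslot, hslot, hslot, h x]
    exact map_add (wedgeSlot (fun k => γ k x) k₀) _ _
  rw [TopForm.integral_congr hadd, TopForm.integral_add (hcont hα) (hcont hη.d),
    integral_wedge_d_eq_zero hη γ k₀ hγ, add_zero]

/-- The integral of a wedge product of closed `2`-forms depends only on their classes. -/
theorem integral_wedge_congr {α α' : Fin n → DForm n X 2} (h : ∀ k, Cohomologous (α k) (α' k))
    (hα : ∀ k, (α k).IsClosedForm) (hα' : ∀ k, (α' k).IsClosedForm) :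
    TopForm.integral (wedge α') = TopForm.integral (wedge α) := by
  classical
  have key : ∀ s : Finset (Fin n), TopForm.integral (wedge fun k => if k ∈ s then α' k else α k) =
      TopForm.integral (wedge α) := by
    intro s
    induction s using Finset.induction_on with
    | empty => simp
    | insert k₀ s hk₀ ih =>
      rw [← ih]
      have h1 := integral_wedge_slot_congr (h k₀) (hα k₀).smooth
        (fun k => if k ∈ s then α' k else α k) k₀ fun k _ => by
          split_ifs
          · exact hα' k
          · exact hα k
      convert h1 using 4 with k k
      · by_cases hk : k = k₀
        · subst hk; simp
        · simp [hk]
      · by_cases hk : k = k₀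
        · subst hk; simp [hk₀]
        · simp [hk]
  simpa using key Finset.univ

end Integration

/-! ### Gauge transformations of matrices of `1`-forms -/

section Gauge

open Set Filter Topology

variable {n r : ℕ}

/-- The entrywise derivative of a matrix valued function. -/
def matDeriv (M : (Fin n → ℂ) → Matrix (Fin r) (Fin r) ℂ) (y u : Fin n → ℂ) :
    Matrix (Fin r) (Fin r) ℂ :=
  Matrix.of fun i j => fderiv ℝ (fun z => M z i j) y u

/-- Entrywise differentiability of a matrix valued function. -/
def MatDifferentiableAt (M : (Fin n → ℂ) → Matrix (Fin r) (Fin r) ℂ) (y : Fin n → ℂ) : Prop :=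
  ∀ i j, DifferentiableAt ℝ (fun z => M z i j) y

variable {M N : (Fin n → ℂ) → Matrix (Fin r) (Fin r) ℂ} {y : Fin n → ℂ}

theorem MatDifferentiableAt.mul (hM : MatDifferentiableAt M y) (hN : MatDifferentiableAt N y) :
    MatDifferentiableAt (fun z => M z * N z) y := fun i j => by
  simp only [Matrix.mul_apply]
  exact DifferentiableAt.fun_sum fun k _ => (hM i k).mul (hN k j)

theorem matDeriv_mul (hM : MatDifferentiableAt M y) (hN : MatDifferentiableAt N y)
    (u : Fin n → ℂ) :
    matDeriv (fun z => M z * N z) y u = matDeriv M y u * N y + M y * matDeriv N y u := by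
  ext i j
  simp only [matDeriv, Matrix.of_apply, Matrix.mul_apply, Matrix.add_apply]
  rw [fderiv_fun_sum fun k _ => (hM i k).fun_mul (hN k j), ← Finset.sum_add_distrib,
    sum_apply]
  refine Finset.sum_congr rfl fun k _ => ?_
  rw [fderiv_fun_mul (hM i k) (hN k j)]
  simp only [add_apply, smul_apply, smul_eq_mul]
  ring

theorem matDeriv_add (hM : MatDifferentiableAt M y) (hN : MatDifferentiableAt N y)
    (u : Fin n → ℂ) :
    matDeriv (fun z => M z + N z) y u = matDeriv M y u + matDeriv N y u := by
  ext i j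
  simp only [matDeriv, Matrix.of_apply, Matrix.add_apply]
  rw [fderiv_fun_add (hM i j) (hN i j)]
  rfl

theorem matDeriv_congr (h : M =ᶠ[𝓝 y] N) (u : Fin n → ℂ) : matDeriv M y u = matDeriv N y u := by
  ext i j
  have : (fun z => M z i j) =ᶠ[𝓝 y] fun z => N z i j :=
    h.mono fun z hz => congrFun (congrFun hz i) j
  simp only [matDeriv, Matrix.of_apply]
  rw [this.fderiv_eq]

theorem curvatureMatrix_eq (B : (Fin n → ℂ) → (Fin n → ℂ) → Matrix (Fin r) (Fin r) ℂ)
    (y u v : Fin n → ℂ) : curvatureMatrix B y u v =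
      matDeriv (fun z => B z v) y u - matDeriv (fun z => B z u) y v +
        (B y u * B y v - B y v * B y u) := rfl

/-- A family of real linear maps which depends differentiably on a point, as a differentiable
function with values in the continuous linear maps. -/
theorem exists_clm_family {f : (Fin n → ℂ) → (Fin n → ℂ) → ℂ}
    (hlin : ∀ᶠ z in 𝓝 y, IsLinearMap ℝ (f z)) (hf : ∀ v, DifferentiableAt ℝ (fun z => f z v) y) :
    ∃ F : (Fin n → ℂ) → (Fin n → ℂ) →L[ℝ] ℂ, DifferentiableAt ℝ F y ∧
      ∀ᶠ z in 𝓝 y, ∀ v, F z v = f z v := by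
  set b := realify (Pi.basisFun ℂ (Fin n))
  set ε : Fin n × Fin 2 → (Fin n → ℂ) →L[ℝ] ℝ := fun q => LinearMap.toContinuousLinearMap (b.coord q)
  refine ⟨fun z => ∑ q, (ε q).smulRight (f z (b q)), ?_, ?_⟩
  · refine DifferentiableAt.fun_sum fun q _ => ?_
    exact ((ContinuousLinearMap.smulRightL ℝ (Fin n → ℂ) ℂ (ε q)).differentiableAt).comp y (hf (b q))
  · filter_upwards [hlin] with z hz v
    conv_rhs => rw [← b.sum_repr v]
    have := map_sum (hz.mk' (f z)) (fun q => b.repr v q • b q) Finset.univ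
    simp only [IsLinearMap.mk'_apply] at this
    rw [this]
    simp only [sum_apply]
    refine Finset.sum_congr rfl fun q _ => ?_
    rw [hz.map_smul]
    rfl

/-- The derivative of the pullback of a family of linear maps by a change of coordinates. -/
theorem fderiv_pullback_one {f : (Fin n → ℂ) → (Fin n → ℂ) → ℂ} {t : (Fin n → ℂ) → Fin n → ℂ}
    (hlin : ∀ᶠ z in 𝓝 (t y), IsLinearMap ℝ (f z))
    (hf : ∀ v, DifferentiableAt ℝ (fun z => f z v) (t y)) (ht : ContDiffAt ℝ 2 t y)
    (v : Fin n → ℂ) :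
    DifferentiableAt ℝ (fun z => f (t z) (fderiv ℝ t z v)) y ∧
    ∀ u, fderiv ℝ (fun z => f (t z) (fderiv ℝ t z v)) y u =
      fderiv ℝ (fun z => f z (fderiv ℝ t y v)) (t y) (fderiv ℝ t y u) +
        f (t y) (fderiv ℝ (fderiv ℝ t) y u v) := by
  obtain ⟨F, hF, hFf⟩ := exists_clm_family hlin hf
  have ht1 : DifferentiableAt ℝ t y := ht.differentiableAt (by simp)
  have ht2 : DifferentiableAt ℝ (fderiv ℝ t) y :=
    (ht.fderiv_right (m := 1) (by norm_num)).differentiableAt (by simp)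
  have h1 : (fun z => f (t z) (fderiv ℝ t z v)) =ᶠ[𝓝 y] fun z => F (t z) (fderiv ℝ t z v) := by
    filter_upwards [ht1.continuousAt.eventually hFf] with z hz
    rw [hz]
  have h2 : (fun z => f z (fderiv ℝ t y v)) =ᶠ[𝓝 (t y)] fun z => F z (fderiv ℝ t y v) := by
    filter_upwards [hFf] with z hz
    rw [hz]
  have hFt : HasFDerivAt (fun z => F (t z)) ((fderiv ℝ F (t y)).comp (fderiv ℝ t y)) y :=
    hF.hasFDerivAt.comp y ht1.hasFDerivAt
  have htv : HasFDerivAt (fun z => fderiv ℝ t z v)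
      ((fderiv ℝ (fderiv ℝ t) y).flip v) y := by
    simpa using ht2.hasFDerivAt.clm_apply (hasFDerivAt_const v y)
  have h3 := hFt.clm_apply htv
  have h4 : HasFDerivAt (fun z => F z (fderiv ℝ t y v))
      ((fderiv ℝ F (t y)).flip (fderiv ℝ t y v)) (t y) := by
    simpa using hF.hasFDerivAt.clm_apply (hasFDerivAt_const (fderiv ℝ t y v) (t y))
  refine ⟨h3.differentiableAt.congr_of_eventuallyEq h1, fun u => ?_⟩
  rw [h1.fderiv_eq, h2.fderiv_eq, h3.fderiv, h4.fderiv, ← hFf.self_of_nhds]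
  simp [add_comm]

/-- The curvature matrix transforms tensorially: if `B' = a⁻¹ t^*B a + a⁻¹ da` near `y`, then
`F' = a⁻¹ (t^*F) a` at `y`. -/
theorem curvatureMatrix_gauge {B B' : (Fin n → ℂ) → (Fin n → ℂ) → Matrix (Fin r) (Fin r) ℂ}
    {a : (Fin n → ℂ) → Matrix (Fin r) (Fin r) ℂ} {t : (Fin n → ℂ) → Fin n → ℂ}
    (ht : ContDiffAt ℝ 2 t y) (ha : ∀ i j, ContDiffAt ℝ 2 (fun z => a z i j) y)
    (hlin : ∀ᶠ z in 𝓝 (t y), IsLinearMap ℝ (B z))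
    (hB : ∀ v, MatDifferentiableAt (fun z => B z v) (t y))
    (hB' : ∀ v, MatDifferentiableAt (fun z => B' z v) y)
    (hrel : ∀ᶠ z in 𝓝 y, ∀ v, a z * B' z v = B (t z) (fderiv ℝ t z v) * a z + matDeriv a z v)
    (u v : Fin n → ℂ) :
    a y * curvatureMatrix B' y u v =
      curvatureMatrix B (t y) (fderiv ℝ t y u) (fderiv ℝ t y v) * a y := by
  have ha1 : MatDifferentiableAt a y := fun i j => (ha i j).differentiableAt (by simp)
  have ha2 : ∀ i j, DifferentiableAt ℝ (fderiv ℝ fun z => a z i j) y := fun i j =>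
    ((ha i j).fderiv_right (m := 1) (by norm_num)).differentiableAt (by simp)
  have hda : ∀ v, MatDifferentiableAt (fun z => matDeriv a z v) y := fun v i j =>
    (ha2 i j).clm_apply (differentiableAt_const v)
  have hsymm_a : ∀ u v, matDeriv (fun z => matDeriv a z v) y u =
      matDeriv (fun z => matDeriv a z u) y v := by
    intro u v
    ext i j
    have key : ∀ w w', fderiv ℝ (fun z => fderiv ℝ (fun z => a z i j) z w) y w' =
        fderiv ℝ (fderiv ℝ fun z => a z i j) y w' w := fun w w' => by
      have := (ha2 i j).hasFDerivAt.clm_apply (hasFDerivAt_const w y)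
      rw [this.fderiv]
      simp
    change fderiv ℝ (fun z => fderiv ℝ (fun z => a z i j) z v) y u =
      fderiv ℝ (fun z => fderiv ℝ (fun z => a z i j) z u) y v
    rw [key, key]
    exact (ha i j).isSymmSndFDerivAt (by simp [minSmoothness_of_isRCLikeNormedField]) u v
  have hsymm_t : ∀ u v, fderiv ℝ (fderiv ℝ t) y u v = fderiv ℝ (fderiv ℝ t) y v u :=
    ht.isSymmSndFDerivAt (by simp [minSmoothness_of_isRCLikeNormedField])
  have hlin' : ∀ i j, ∀ᶠ z in 𝓝 (t y), IsLinearMap ℝ fun v => B z v i j := fun i j =>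
    hlin.mono fun z hz => ⟨fun v w => by rw [hz.map_add]; rfl, fun c v => by rw [hz.map_smul]; rfl⟩
  have hpull : ∀ v, MatDifferentiableAt (fun z => B (t z) (fderiv ℝ t z v)) y := fun v i j =>
    (fderiv_pullback_one (hlin' i j) (fun v => hB v i j) ht v).1
  have hpull_deriv : ∀ u v, matDeriv (fun z => B (t z) (fderiv ℝ t z v)) y u =
      matDeriv (fun z => B z (fderiv ℝ t y v)) (t y) (fderiv ℝ t y u) +
        B (t y) (fderiv ℝ (fderiv ℝ t) y u v) := by
    intro u v
    ext i j
    exact (fderiv_pullback_one (hlin' i j) (fun v => hB v i j) ht v).2 u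
  -- the derivative of the transformation rule
  have hder : ∀ u v, matDeriv a y u * B' y v + a y * matDeriv (fun z => B' z v) y u =
      (matDeriv (fun z => B z (fderiv ℝ t y v)) (t y) (fderiv ℝ t y u) +
        B (t y) (fderiv ℝ (fderiv ℝ t) y u v)) * a y +
        B (t y) (fderiv ℝ t y v) * matDeriv a y u + matDeriv (fun z => matDeriv a z v) y u := by
    intro u v
    have h1 : (fun z => a z * B' z v) =ᶠ[𝓝 y]
        fun z => B (t z) (fderiv ℝ t z v) * a z + matDeriv a z v :=
      hrel.mono fun z hz => hz v
    have h2 := matDeriv_congr h1 u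
    rw [matDeriv_mul ha1 (hB' v), matDeriv_add ((hpull v).mul ha1) (hda v),
      matDeriv_mul (hpull v) ha1, hpull_deriv] at h2
    exact h2
  have hr := hrel.self_of_nhds
  rw [curvatureMatrix_eq, curvatureMatrix_eq]
  set Bu := B (t y) (fderiv ℝ t y u)
  set Bv := B (t y) (fderiv ℝ t y v)
  set au := matDeriv a y u
  set av := matDeriv a y v
  have e1 := hder u v
  have e2 := hder v u
  rw [hsymm_a v u, hsymm_t v u] at e2
  have hu : a y * B' y u = Bu * a y + au := hr u
  have hv : a y * B' y v = Bv * a y + av := hr v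
  have h3 : a y * (B' y u * B' y v) = Bu * (Bv * a y + av) + au * B' y v := by
    rw [← mul_assoc, hu, add_mul, mul_assoc, hv]
  have h4 : a y * (B' y v * B' y u) = Bv * (Bu * a y + au) + av * B' y u := by
    rw [← mul_assoc, hv, add_mul, mul_assoc, hu]
  rw [mul_add, mul_sub, mul_sub, h3, h4]
  have e1' := eq_sub_of_add_eq' e1
  have e2' := eq_sub_of_add_eq' e2
  rw [e1', e2']
  noncomm_ring

end Gauge

/-! ### Frames of vector bundles -/

section Frames

variable {X : Type*} [TopologicalSpace X]
  {r : ℕ} {E : X → Type*} [∀ x, AddCommGroup (E x)] [∀ x, Module ℂ (E x)]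
  [∀ x, TopologicalSpace (E x)] [TopologicalSpace (TotalSpace (Fin r → ℂ) E)]
  [FiberBundle (Fin r → ℂ) E] [VectorBundle ℂ (Fin r → ℂ) E]

/-- The basis of a fibre given by a local trivialization. -/
def frameBasis (e : Trivialization (Fin r → ℂ) (π (Fin r → ℂ) E)) [MemTrivializationAtlas e]
    {x : X} (hx : x ∈ e.baseSet) : Module.Basis (Fin r) ℂ (E x) :=
  Module.Basis.ofEquivFun (e.continuousLinearEquivAt ℂ x hx).toLinearEquiv

variable {e e' : Trivialization (Fin r → ℂ) (π (Fin r → ℂ) E)} [MemTrivializationAtlas e]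
  [MemTrivializationAtlas e'] {x : X}

theorem frameBasis_apply (hx : x ∈ e.baseSet) (j : Fin r) :
    frameBasis e hx j = frame e x j := by
  rw [frameBasis, Module.Basis.coe_ofEquivFun, frame]
  exact congrFun (e.symm_continuousLinearEquivAt_eq hx) _

theorem frameBasis_repr (hx : x ∈ e.baseSet) (w : E x) (i : Fin r) :
    (frameBasis e hx).repr w i = e.continuousLinearMapAt ℂ x w i := by
  have : (e.continuousLinearEquivAt ℂ x hx : E x → (Fin r → ℂ)) w =
      e.continuousLinearMapAt ℂ x w := by
    rw [e.coe_continuousLinearEquivAt_eq hx]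
  rw [← this]
  rfl

theorem endMatrix_eq_toMatrix (hx : x ∈ e.baseSet) (f : Module.End ℂ (E x)) :
    endMatrix e x f = LinearMap.toMatrix (frameBasis e hx) (frameBasis e hx) f := by
  ext i j
  rw [LinearMap.toMatrix_apply, frameBasis_apply, frameBasis_repr]
  rfl

theorem endOfMatrix_eq_toLin (hx : x ∈ e.baseSet) (M : Matrix (Fin r) (Fin r) ℂ) :
    endOfMatrix e x M = Matrix.toLin (frameBasis e hx) (frameBasis e hx) M := by
  refine (frameBasis e hx).ext fun j => ?_
  rw [Matrix.toLin_self]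
  simp only [frameBasis_apply, endOfMatrix, LinearMap.comp_apply, ContinuousLinearMap.coe_coe]
  have h1 : e.continuousLinearMapAt ℂ x (frame e x j) = Pi.single j 1 := by
    rw [frame, e.continuousLinearMapAt_symmL hx]
  rw [h1, Matrix.toLin'_apply, Matrix.mulVec_single_one, pi_eq_sum_univ' (M.col j), map_sum]
  refine Finset.sum_congr rfl fun i _ => ?_
  rw [map_smul]
  rfl

theorem endMatrix_endOfMatrix (hx : x ∈ e.baseSet) (M : Matrix (Fin r) (Fin r) ℂ) :
    endMatrix e x (endOfMatrix e x M) = M := by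
  rw [endMatrix_eq_toMatrix hx, endOfMatrix_eq_toLin hx, LinearMap.toMatrix_toLin]

theorem endMatrix_mul (hx : x ∈ e.baseSet) (f g : Module.End ℂ (E x)) :
    endMatrix e x (f * g) = endMatrix e x f * endMatrix e x g := by
  simp only [endMatrix_eq_toMatrix hx]
  exact LinearMap.toMatrix_mul _ _ _

theorem trace_eq_trace_endMatrix (hx : x ∈ e.baseSet) (f : Module.End ℂ (E x)) :
    LinearMap.trace ℂ (E x) f = (endMatrix e x f).trace := by
  rw [endMatrix_eq_toMatrix hx, LinearMap.trace_eq_matrix_trace ℂ (frameBasis e hx)]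

variable (e e') in
/-- The transition matrix from the frame `e` to the frame `e'`: `e'ⱼ = ∑ᵢ aᵢⱼ eᵢ`. -/
def changeMatrix (x : X) : Matrix (Fin r) (Fin r) ℂ :=
  Matrix.of fun i j => e.continuousLinearMapAt ℂ x (frame e' x j) i

theorem changeMatrix_eq_toMatrix (hx : x ∈ e.baseSet) (hx' : x ∈ e'.baseSet) :
    changeMatrix e e' x = (frameBasis e hx).toMatrix (frameBasis e' hx') := by
  ext i j
  rw [Module.Basis.toMatrix_apply, frameBasis_apply, frameBasis_repr]
  rfl

theorem isUnit_det_changeMatrix (hx : x ∈ e.baseSet) (hx' : x ∈ e'.baseSet) :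
    IsUnit (changeMatrix e e' x).det := by
  rw [changeMatrix_eq_toMatrix hx hx']
  have := (frameBasis e hx).invertibleToMatrix (frameBasis e' hx')
  exact Matrix.isUnit_det_of_invertible _

theorem frame_change (hx : x ∈ e.baseSet) (j : Fin r) :
    frame e' x j = ∑ i, changeMatrix e e' x i j • frame e x i := by
  have := ((frameBasis e hx).sum_repr (frame e' x j)).symm
  simp only [frameBasis_apply, frameBasis_repr] at this
  exact this

/-- Matrices of endomorphisms in two frames are conjugate. -/
theorem changeMatrix_mul_endMatrix (hx : x ∈ e.baseSet) (hx' : x ∈ e'.baseSet)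
    (f : Module.End ℂ (E x)) :
    changeMatrix e e' x * endMatrix e' x f = endMatrix e x f * changeMatrix e e' x := by
  rw [changeMatrix_eq_toMatrix hx hx', endMatrix_eq_toMatrix hx, endMatrix_eq_toMatrix hx',
    basis_toMatrix_mul_linearMap_toMatrix, linearMap_toMatrix_mul_basis_toMatrix]

end Frames

/-! ### The Chern connection in local frames -/

section Chern

open Set Filter Topology Matrix

section MatrixCalculus

variable {n r : ℕ} {M N : (Fin n → ℂ) → Matrix (Fin r) (Fin r) ℂ} {y : Fin n → ℂ}

/-- The entrywise `∂`-derivative of a matrix valued function. -/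
def matDel (M : (Fin n → ℂ) → Matrix (Fin r) (Fin r) ℂ) (y v : Fin n → ℂ) :
    Matrix (Fin r) (Fin r) ℂ :=
  Matrix.of fun i j => delHol (fun z => M z i j) y v

theorem matDel_eq (M : (Fin n → ℂ) → Matrix (Fin r) (Fin r) ℂ) (y v : Fin n → ℂ) :
    matDel M y v = (1 / 2 : ℂ) • (matDeriv M y v - Complex.I • matDeriv M y (Complex.I • v)) := by
  ext i j
  simp only [matDel, delHol, matDeriv, Matrix.of_apply, Matrix.smul_apply, Matrix.sub_apply,
    smul_eq_mul]
  ring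

theorem matDeriv_smul_of_holomorphic (h : ∀ i j, DifferentiableAt ℂ (fun z => M z i j) y)
    (a : ℂ) (v : Fin n → ℂ) : matDeriv M y (a • v) = a • matDeriv M y v := by
  ext i j
  simp only [matDeriv, Matrix.of_apply, Matrix.smul_apply]
  rw [(h i j).fderiv_restrictScalars ℝ]
  simp

theorem matDel_of_holomorphic (h : ∀ i j, DifferentiableAt ℂ (fun z => M z i j) y)
    (v : Fin n → ℂ) : matDel M y v = matDeriv M y v := by
  rw [matDel_eq, matDeriv_smul_of_holomorphic h, smul_smul, Complex.I_mul_I]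
  module

theorem matDeriv_conjTranspose (h : MatDifferentiableAt M y) (v : Fin n → ℂ) :
    matDeriv (fun z => (M z)ᴴ) y v = (matDeriv M y v)ᴴ := by
  ext i j
  simp only [matDeriv, Matrix.of_apply, Matrix.conjTranspose_apply]
  have := Complex.conjCLE.hasFDerivAt.comp y (h j i).hasFDerivAt
  exact congrArg (fun L : (Fin n → ℂ) →L[ℝ] ℂ => L v) this.fderiv

theorem MatDifferentiableAt.conjTranspose (h : MatDifferentiableAt M y) :
    MatDifferentiableAt (fun z => (M z)ᴴ) y := fun i j =>
  (Complex.conjCLE.hasFDerivAt.comp y (h j i).hasFDerivAt).differentiableAt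

theorem matDel_conjTranspose_of_holomorphic (h : ∀ i j, DifferentiableAt ℂ (fun z => M z i j) y)
    (v : Fin n → ℂ) : matDel (fun z => (M z)ᴴ) y v = 0 := by
  have hd : MatDifferentiableAt M y := fun i j => (h i j).restrictScalars ℝ
  rw [matDel_eq, matDeriv_conjTranspose hd, matDeriv_conjTranspose hd,
    matDeriv_smul_of_holomorphic h, Matrix.conjTranspose_smul, smul_smul]
  simp

theorem matDel_mul (hM : MatDifferentiableAt M y) (hN : MatDifferentiableAt N y)
    (v : Fin n → ℂ) :
    matDel (fun z => M z * N z) y v = matDel M y v * N y + M y * matDel N y v := by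
  rw [matDel_eq, matDel_eq, matDel_eq, matDeriv_mul hM hN, matDeriv_mul hM hN]
  simp only [Matrix.smul_mul, Matrix.mul_smul, sub_mul, mul_sub, smul_add]
  module

theorem matDeriv_comp {t : (Fin n → ℂ) → Fin n → ℂ} (hM : MatDifferentiableAt M (t y))
    (ht : DifferentiableAt ℝ t y) (v : Fin n → ℂ) :
    matDeriv (fun z => M (t z)) y v = matDeriv M (t y) (fderiv ℝ t y v) := by
  ext i j
  simp only [matDeriv, Matrix.of_apply]
  have := (hM i j).hasFDerivAt.comp y ht.hasFDerivAt
  exact congrArg (fun L : (Fin n → ℂ) →L[ℝ] ℂ => L v) this.fderiv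

theorem MatDifferentiableAt.comp {t : (Fin n → ℂ) → Fin n → ℂ} (hM : MatDifferentiableAt M (t y))
    (ht : DifferentiableAt ℝ t y) : MatDifferentiableAt (fun z => M (t z)) y := fun i j =>
  ((hM i j).hasFDerivAt.comp y ht.hasFDerivAt).differentiableAt

theorem matDel_comp {t : (Fin n → ℂ) → Fin n → ℂ} (hM : MatDifferentiableAt M (t y))
    (ht : DifferentiableAt ℂ t y) (v : Fin n → ℂ) :
    matDel (fun z => M (t z)) y v = matDel M (t y) (fderiv ℝ t y v) := by
  have htr : DifferentiableAt ℝ t y := ht.restrictScalars ℝ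
  have hI : fderiv ℝ t y (Complex.I • v) = Complex.I • fderiv ℝ t y v := by
    rw [ht.fderiv_restrictScalars ℝ]
    simp
  rw [matDel_eq, matDel_eq, matDeriv_comp hM htr, matDeriv_comp hM htr, hI]

theorem matDel_congr (h : M =ᶠ[𝓝 y] N) (v : Fin n → ℂ) : matDel M y v = matDel N y v := by
  rw [matDel_eq, matDel_eq, matDeriv_congr h, matDeriv_congr h]

theorem contDiffOn_matrix_det {U : Set (Fin n → ℂ)} {k : WithTop ℕ∞}
    (h : ∀ i j, ContDiffOn ℝ k (fun z => M z i j) U) : ContDiffOn ℝ k (fun z => (M z).det) U := by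
  simp only [Matrix.det_apply]
  exact ContDiffOn.sum fun σ _ => (contDiffOn_prod fun i _ => h _ _).const_smul _

theorem contDiffOn_matrix_inv {U : Set (Fin n → ℂ)} {k : WithTop ℕ∞}
    (h : ∀ i j, ContDiffOn ℝ k (fun z => M z i j) U) (hdet : ∀ z ∈ U, IsUnit (M z).det)
    (i j : Fin r) : ContDiffOn ℝ k (fun z => (M z)⁻¹ i j) U := by
  simp only [Matrix.inv_def, Ring.inverse_eq_inv', Matrix.smul_apply, smul_eq_mul,
    Matrix.adjugate_apply]
  refine ((contDiffOn_matrix_det h).inv fun z hz => (hdet z hz).ne_zero).mul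
    (contDiffOn_matrix_det fun k l => ?_)
  by_cases hk : k = j
  · subst hk
    simpa using contDiffOn_const
  · simpa [Matrix.updateRow_ne hk] using h k l

theorem contDiffOn_matrix_mul {U : Set (Fin n → ℂ)} {k : WithTop ℕ∞}
    (hM : ∀ i j, ContDiffOn ℝ k (fun z => M z i j) U)
    (hN : ∀ i j, ContDiffOn ℝ k (fun z => N z i j) U) (i j : Fin r) :
    ContDiffOn ℝ k (fun z => (M z * N z) i j) U := by
  simp only [Matrix.mul_apply]
  exact ContDiffOn.sum fun l _ => (hM i l).mul (hN l j)

theorem contDiffOn_matDel {U : Set (Fin n → ℂ)} (hU : IsOpen U)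
    (hM : ∀ i j, ContDiffOn ℝ ∞ (fun z => M z i j) U) (v : Fin n → ℂ) (i j : Fin r) :
    ContDiffOn ℝ ∞ (fun z => matDel M z v i j) U := by
  have h : ∀ w, ContDiffOn ℝ ∞ (fun z => fderiv ℝ (fun z => M z i j) z w) U := fun w =>
    ((hM i j).fderiv_of_isOpen hU (by simp)).clm_apply contDiffOn_const
  simp only [matDel, Matrix.of_apply, delHol]
  exact ((h v).sub (contDiffOn_const.mul (h _))).div_const 2

theorem matDel_isLinear (M : (Fin n → ℂ) → Matrix (Fin r) (Fin r) ℂ) (y : Fin n → ℂ) :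
    IsLinearMap ℝ (matDel M y) where
  map_add u v := by
    ext i j
    simp only [matDel, delHol, Matrix.of_apply, Matrix.add_apply, smul_add, map_add]
    ring
  map_smul t v := by
    ext i j
    simp only [matDel, delHol, Matrix.of_apply, Matrix.smul_apply, smul_comm Complex.I t, map_smul]
    simp only [Complex.real_smul]
    ring

end MatrixCalculus

variable {n : ℕ} {X : Type*} [TopologicalSpace X] [ChartedSpace (Fin n → ℂ) X]
  {r : ℕ} {E : X → Type*} [∀ x, AddCommGroup (E x)] [∀ x, Module ℂ (E x)]
  [∀ x, TopologicalSpace (E x)] [TopologicalSpace (TotalSpace (Fin r → ℂ) E)]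
  [FiberBundle (Fin r → ℂ) E] [VectorBundle ℂ (Fin r → ℂ) E]

/-- The coordinates in the chart `c` of the points over which `E` is trivialized by `e`. -/
def frameDom (c : OpenPartialHomeomorph X (Fin n → ℂ))
    (e : Trivialization (Fin r → ℂ) (π (Fin r → ℂ) E)) : Set (Fin n → ℂ) :=
  c.target ∩ c.symm ⁻¹' e.baseSet

/-- The coordinates in the chart `c'` of the common domain of two charts and two frames. -/
def gaugeDom (c c' : OpenPartialHomeomorph X (Fin n → ℂ))
    (e e' : Trivialization (Fin r → ℂ) (π (Fin r → ℂ) E)) : Set (Fin n → ℂ) :=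
  overlap c' c ∩ (frameDom c' e ∩ frameDom c' e')

variable {c c' : OpenPartialHomeomorph X (Fin n → ℂ)}
  {e e' : Trivialization (Fin r → ℂ) (π (Fin r → ℂ) E)}

theorem isOpen_frameDom (c : OpenPartialHomeomorph X (Fin n → ℂ))
    (e : Trivialization (Fin r → ℂ) (π (Fin r → ℂ) E)) : IsOpen (frameDom c e) :=
  c.isOpen_inter_preimage_symm e.open_baseSet

theorem isOpen_gaugeDom (c c' : OpenPartialHomeomorph X (Fin n → ℂ))
    (e e' : Trivialization (Fin r → ℂ) (π (Fin r → ℂ) E)) : IsOpen (gaugeDom c c' e e') :=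
  (isOpen_overlap c' c).inter ((isOpen_frameDom c' e).inter (isOpen_frameDom c' e'))

theorem transition_mem_frameDom {z : Fin n → ℂ} (hz : z ∈ gaugeDom c c' e e') :
    transition c' c z ∈ frameDom c e :=
  ⟨transition_mem_target hz.1, by
    rw [mem_preimage, symm_transition hz.1]; exact hz.2.1.2⟩

variable [MemTrivializationAtlas e] [MemTrivializationAtlas e']

theorem gram_conjTranspose (h : HermitianMetric n r E) (y : Fin n → ℂ) :
    (h.gram c e y)ᴴ = h.gram c e y := by
  ext i j
  exact h.conj_symm _ _ _

theorem gram_eq_formMatrix (h : HermitianMetric n r E) (y : Fin n → ℂ) :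
    h.gram c e y = formMatrix (h.form (c.symm y)) (frame e (c.symm y)) := rfl

/-- The Gram matrix of a positive definite form in a basis is invertible. -/
theorem isUnit_det_formMatrix {V : Type*} [AddCommGroup V] [Module ℂ V]
    (b : Module.Basis (Fin r) ℂ V) (B : V →ₗ⋆[ℂ] V →ₗ[ℂ] ℂ)
    (hpos : ∀ u, u ≠ 0 → 0 < (B u u).re) : IsUnit (formMatrix B b).det := by
  rw [isUnit_iff_ne_zero]
  intro h0
  obtain ⟨w, hw, hMw⟩ := Matrix.exists_mulVec_eq_zero_iff.2 h0
  set u := ∑ j, w j • b j with hu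
  have hu0 : u ≠ 0 := fun h => hw (by
    have := Fintype.linearIndependent_iff.1 b.linearIndependent w h
    exact funext this)
  have h1 : ∀ i, B (b i) u = 0 := fun i => by
    have := congrFun hMw i
    simp only [Matrix.mulVec, dotProduct, formMatrix, Matrix.of_apply, Pi.zero_apply] at this
    rw [hu, map_sum, ← this]
    refine Finset.sum_congr rfl fun j _ => ?_
    rw [map_smul, smul_eq_mul, mul_comm]
  have h2 : B (∑ j, w j • b j) u = 0 := by
    rw [LinearMap.map_sum₂]
    refine Finset.sum_eq_zero fun j _ => ?_
    rw [LinearMap.map_smulₛₗ, LinearMap.smul_apply, h1, smul_zero]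
  have := hpos u hu0
  rw [show B u u = 0 from h2] at this
  simp at this

theorem isUnit_det_gram (h : HermitianMetric n r E) {y : Fin n → ℂ} (hy : y ∈ frameDom c e) :
    IsUnit (h.gram c e y).det := by
  have := isUnit_det_formMatrix (frameBasis e hy.2) (h.form (c.symm y)) (h.pos _)
  rwa [show ⇑(frameBasis e hy.2) = frame e (c.symm y) from
    funext fun j => frameBasis_apply hy.2 j] at this

theorem gram_change (h : HermitianMetric n r E) {z : Fin n → ℂ} (hz : z ∈ gaugeDom c c' e e') :
    h.gram c' e' z = (changeMatrix e e' (c'.symm z))ᴴ * h.gram c e (transition c' c z) *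
      changeMatrix e e' (c'.symm z) := by
  rw [gram_eq_formMatrix, gram_eq_formMatrix, symm_transition hz.1, ← formMatrix_change]
  congr 1
  funext j
  exact frame_change hz.2.1.2 j

/-- The matrix of the adjoint is `G⁻¹ Φᴴ G`. -/
theorem endMatrix_adjoint (h : HermitianMetric n r E) {y : Fin n → ℂ} (hy : y ∈ frameDom c e)
    (f : Module.End ℂ (E (c.symm y))) :
    endMatrix e (c.symm y) (h.adjoint (c.symm y) f) =
      (h.gram c e y)⁻¹ * (endMatrix e (c.symm y) f)ᴴ * h.gram c e y := by
  set b := frameBasis e hy.2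
  have hb : ∀ j, frame e (c.symm y) j = b j := fun j => (frameBasis_apply hy.2 j).symm
  set G := h.gram c e y with hG
  have hdet := isUnit_det_gram h hy
  have hexp : ∀ (f : Module.End ℂ (E (c.symm y))) j,
      f (b j) = ∑ k, endMatrix e (c.symm y) f k j • b k := fun f j => by
    rw [endMatrix_eq_toMatrix hy.2]
    conv_lhs => rw [← b.sum_repr (f (b j))]
    simp only [LinearMap.toMatrix_apply]
    rfl
  have key : (endMatrix e (c.symm y) (h.adjoint (c.symm y) f))ᴴ * G =
      G * endMatrix e (c.symm y) f := by
    ext i j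
    have h1 := (h.exists_adjoint (c.symm y) f).choose_spec (b i) (b j)
    change h.form (c.symm y) (h.adjoint (c.symm y) f (b i)) (b j) = _ at h1
    rw [hexp, hexp f j] at h1
    simp only [map_sum, LinearMap.sum_apply, LinearMap.map_smulₛₗ, LinearMap.smul_apply,
      smul_eq_mul, RingHom.id_apply] at h1
    simp only [Matrix.mul_apply, Matrix.conjTranspose_apply, hG, HermitianMetric.gram,
      Matrix.of_apply, hb]
    simp only [starRingEnd_apply] at h1
    rw [h1]
    exact Finset.sum_congr rfl fun k _ => mul_comm _ _
  have key2 := congrArg Matrix.conjTranspose key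
  rw [Matrix.conjTranspose_mul, Matrix.conjTranspose_mul, Matrix.conjTranspose_conjTranspose,
    gram_conjTranspose] at key2
  rw [mul_assoc, ← key2, ← mul_assoc, Matrix.nonsing_inv_mul _ hdet, one_mul]

variable [IsManifold 𝓘(ℂ, Fin n → ℂ) ω X]

theorem contDiffOn_gram (h : HermitianMetric n r E) (hc : c ∈ atlas (Fin n → ℂ) X) (i j : Fin r) :
    ContDiffOn ℝ ∞ (fun y => h.gram c e y i j) (frameDom c e) := by
  have := isManifold_real n X
  have h1 : ContMDiffOn 𝓘(ℝ, Fin n → ℂ) 𝓘(ℝ, Fin n → ℂ) ∞ c.symm c.target :=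
    contMDiffOn_symm_of_mem_maximalAtlas (IsManifold.subset_maximalAtlas hc)
  exact ((h.smooth e i j).comp (h1.mono fun y hy => hy.1) fun y hy => hy.2).contDiffOn

theorem matDifferentiableAt_of_contDiffOn {M : (Fin n → ℂ) → Matrix (Fin r) (Fin r) ℂ}
    {U : Set (Fin n → ℂ)} (hU : IsOpen U) (hM : ∀ i j, ContDiffOn ℝ 1 (fun z => M z i j) U)
    {y : Fin n → ℂ} (hy : y ∈ U) : MatDifferentiableAt M y := fun i j =>
  ((hM i j).contDiffAt (hU.mem_nhds hy)).differentiableAt (by simp)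

theorem matDifferentiableAt_gram (h : HermitianMetric n r E) (hc : c ∈ atlas (Fin n → ℂ) X)
    {y : Fin n → ℂ} (hy : y ∈ frameDom c e) : MatDifferentiableAt (h.gram c e) y :=
  matDifferentiableAt_of_contDiffOn (isOpen_frameDom c e)
    (fun i j => (contDiffOn_gram h hc i j).of_le (by simp)) hy

theorem contDiffOn_gram_inv (h : HermitianMetric n r E) (hc : c ∈ atlas (Fin n → ℂ) X)
    (i j : Fin r) : ContDiffOn ℝ ∞ (fun y => (h.gram c e y)⁻¹ i j) (frameDom c e) :=
  contDiffOn_matrix_inv (contDiffOn_gram h hc) (fun _ hy => isUnit_det_gram h hy) i j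

theorem chernConnection_eq (h : HermitianMetric n r E) (y v : Fin n → ℂ) :
    h.chernConnection c e y v = (h.gram c e y)⁻¹ * matDel (h.gram c e) y v := rfl

theorem contDiffOn_chernConnection (h : HermitianMetric n r E) (hc : c ∈ atlas (Fin n → ℂ) X)
    (v : Fin n → ℂ) (i j : Fin r) :
    ContDiffOn ℝ ∞ (fun y => h.chernConnection c e y v i j) (frameDom c e) :=
  contDiffOn_matrix_mul (contDiffOn_gram_inv h hc)
    (contDiffOn_matDel (isOpen_frameDom c e) (contDiffOn_gram h hc) v) i j

theorem chernConnection_isLinear (h : HermitianMetric n r E) (y : Fin n → ℂ) :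
    IsLinearMap ℝ (h.chernConnection c e y) where
  map_add u v := by
    rw [chernConnection_eq, chernConnection_eq, chernConnection_eq, (matDel_isLinear _ _).map_add,
      mul_add]
  map_smul t v := by
    rw [chernConnection_eq, chernConnection_eq, (matDel_isLinear _ _).map_smul, Matrix.mul_smul]

variable [ContMDiffVectorBundle ω (Fin r → ℂ) E 𝓘(ℂ, Fin n → ℂ)]

/-- The transition matrices of a holomorphic vector bundle are holomorphic. -/
theorem contDiffOn_changeMatrix (hc : c ∈ atlas (Fin n → ℂ) X) (i j : Fin r) :
    ContDiffOn ℂ ω (fun y => changeMatrix e e' (c.symm y) i j)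
      (frameDom c e ∩ frameDom c e') := by
  have h1 : ContMDiffOn 𝓘(ℂ, Fin n → ℂ) 𝓘(ℂ, Fin n → ℂ) ω c.symm c.target :=
    contMDiffOn_symm_of_mem_maximalAtlas (IsManifold.subset_maximalAtlas hc)
  have h2 := (contMDiffOn_coordChangeL (𝕜 := ℂ) (n := ω) (IB := 𝓘(ℂ, Fin n → ℂ)) e' e).comp
    (h1.mono fun y (hy : y ∈ frameDom c e ∩ frameDom c e') => hy.1.1) fun y hy => ⟨hy.2.2, hy.1.2⟩
  have h3 := h2.contDiffOn.clm_apply (contDiffOn_const (c := (Pi.single j 1 : Fin r → ℂ)))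
  refine (contDiffOn_pi.1 h3 i).congr fun y hy => ?_
  simp only [Function.comp_apply, ContinuousLinearEquiv.coe_coe]
  rw [e'.coordChangeL_apply e ⟨hy.2.2, hy.1.2⟩, changeMatrix, Matrix.of_apply, frame,
    e.continuousLinearMapAt_apply_of_mem ℂ hy.1.2, e'.symmL_apply hy.2.2]

theorem contDiffAt_changeMatrix (hc' : c' ∈ atlas (Fin n → ℂ) X) {z : Fin n → ℂ}
    (hz : z ∈ gaugeDom c c' e e') (i j : Fin r) :
    ContDiffAt ℂ ω (fun y => changeMatrix e e' (c'.symm y) i j) z :=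
  (contDiffOn_changeMatrix hc' i j).contDiffAt
    (((isOpen_frameDom c' e).inter (isOpen_frameDom c' e')).mem_nhds hz.2)

/-- The transformation rule of the Chern connection. -/
theorem chernConnection_gauge (h : HermitianMetric n r E) (hc : c ∈ atlas (Fin n → ℂ) X)
    (hc' : c' ∈ atlas (Fin n → ℂ) X) {z : Fin n → ℂ} (hz : z ∈ gaugeDom c c' e e')
    (v : Fin n → ℂ) :
    changeMatrix e e' (c'.symm z) * h.chernConnection c' e' z v =
      h.chernConnection c e (transition c' c z) (fderiv ℝ (transition c' c) z v) *
        changeMatrix e e' (c'.symm z) + matDeriv (fun y => changeMatrix e e' (c'.symm y)) z v := by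
  set t := transition c' c
  set a : (Fin n → ℂ) → Matrix (Fin r) (Fin r) ℂ := fun y => changeMatrix e e' (c'.symm y) with ha
  set G := h.gram c e
  have hah : ∀ i j, DifferentiableAt ℂ (fun y => a y i j) z := fun i j =>
    (contDiffAt_changeMatrix hc' hz i j).differentiableAt (by simp)
  have had : MatDifferentiableAt a z := fun i j => (hah i j).restrictScalars ℝ
  have ht : DifferentiableAt ℂ t z := differentiableAt_transition hc' hc hz.1
  have hG : MatDifferentiableAt G (t z) :=
    matDifferentiableAt_gram h hc (transition_mem_frameDom hz)
  have hGt : MatDifferentiableAt (fun y => G (t y)) z := hG.comp (ht.restrictScalars ℝ)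
  have hcongr : h.gram c' e' =ᶠ[𝓝 z] fun y => (a y)ᴴ * G (t y) * a y := by
    filter_upwards [(isOpen_gaugeDom c c' e e').mem_nhds hz] with y hy
    exact gram_change h hy
  have hua : IsUnit (a z).det := isUnit_det_changeMatrix hz.2.1.2 hz.2.2.2
  have huah : IsUnit ((a z)ᴴ).det := by
    rw [Matrix.det_conjTranspose]; exact hua.star
  rw [chernConnection_eq, chernConnection_eq, hcongr.self_of_nhds, matDel_congr hcongr,
    matDel_mul (had.conjTranspose.mul hGt) had, matDel_mul had.conjTranspose hGt,
    matDel_conjTranspose_of_holomorphic hah, matDel_of_holomorphic hah, matDel_comp hG ht,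
    zero_mul, zero_add, Matrix.mul_inv_rev, Matrix.mul_inv_rev, ← mul_assoc (a z),
    Matrix.mul_nonsing_inv_cancel_left _ _ hua]
  have huG : IsUnit (G (t z)).det := isUnit_det_gram h (transition_mem_frameDom hz)
  calc (G (t z))⁻¹ * ((a z)ᴴ)⁻¹ * ((a z)ᴴ * matDel G (t z) (fderiv ℝ t z v) * a z +
        (a z)ᴴ * G (t z) * matDeriv a z v)
      = (G (t z))⁻¹ * (((a z)ᴴ)⁻¹ * (a z)ᴴ) * matDel G (t z) (fderiv ℝ t z v) * a z +
        (G (t z))⁻¹ * (((a z)ᴴ)⁻¹ * (a z)ᴴ) * G (t z) * matDeriv a z v := by noncomm_ring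
    _ = _ := by
        rw [Matrix.nonsing_inv_mul _ huah, mul_one, Matrix.nonsing_inv_mul _ huG, one_mul]

/-! ### Connections and their curvature -/

/-- A family of connection matrices, for all charts and frames, which represents a connection of
class `C¹` on `E`. -/
structure IsConnection (B : OpenPartialHomeomorph X (Fin n → ℂ) →
      ∀ e : Trivialization (Fin r → ℂ) (π (Fin r → ℂ) E), [MemTrivializationAtlas e] →
        (Fin n → ℂ) → (Fin n → ℂ) → Matrix (Fin r) (Fin r) ℂ) : Prop where
  isLinear : ∀ c ∈ atlas (Fin n → ℂ) X, ∀ (e : Trivialization (Fin r → ℂ) (π (Fin r → ℂ) E))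
    [MemTrivializationAtlas e], ∀ y ∈ frameDom c e, IsLinearMap ℝ (B c e y)
  contDiffOn : ∀ c ∈ atlas (Fin n → ℂ) X, ∀ (e : Trivialization (Fin r → ℂ) (π (Fin r → ℂ) E))
    [MemTrivializationAtlas e] (v : Fin n → ℂ) (i j : Fin r),
      ContDiffOn ℝ 1 (fun y => B c e y v i j) (frameDom c e)
  gauge : ∀ c ∈ atlas (Fin n → ℂ) X, ∀ c' ∈ atlas (Fin n → ℂ) X,
    ∀ (e e' : Trivialization (Fin r → ℂ) (π (Fin r → ℂ) E)) [MemTrivializationAtlas e]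
      [MemTrivializationAtlas e'], ∀ z ∈ gaugeDom c c' e e', ∀ v,
      changeMatrix e e' (c'.symm z) * B c' e' z v =
        B c e (transition c' c z) (fderiv ℝ (transition c' c) z v) *
          changeMatrix e e' (c'.symm z) + matDeriv (fun y => changeMatrix e e' (c'.symm y)) z v

theorem isConnection_chern (h : HermitianMetric n r E) :
    IsConnection fun c e => h.chernConnection c e where
  isLinear _ _ _ _ _ _ := chernConnection_isLinear h _
  contDiffOn _ hc _ _ v i j := (contDiffOn_chernConnection h hc v i j).of_le (by simp)
  gauge _ hc _ hc' _ _ _ _ _ hz v := chernConnection_gauge h hc hc' hz v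

variable {B : OpenPartialHomeomorph X (Fin n → ℂ) →
      ∀ e : Trivialization (Fin r → ℂ) (π (Fin r → ℂ) E), [MemTrivializationAtlas e] →
        (Fin n → ℂ) → (Fin n → ℂ) → Matrix (Fin r) (Fin r) ℂ}

theorem IsConnection.matDifferentiableAt (hB : IsConnection B) (hc : c ∈ atlas (Fin n → ℂ) X)
    {y : Fin n → ℂ} (hy : y ∈ frameDom c e) (v : Fin n → ℂ) :
    MatDifferentiableAt (fun z => B c e z v) y :=
  matDifferentiableAt_of_contDiffOn (isOpen_frameDom c e) (hB.contDiffOn c hc e v) hy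

theorem chartAt_mem_frameDom (x : X) :
    chartAt (Fin n → ℂ) x x ∈
      frameDom (chartAt (Fin n → ℂ) x) (trivializationAt (Fin r → ℂ) E x) :=
  ⟨mem_chart_target _ x, by
    rw [mem_preimage, (chartAt (Fin n → ℂ) x).left_inv (mem_chart_source _ x)]
    exact mem_baseSet_trivializationAt _ _ x⟩

theorem curvature_apply (x : X) (u v : Fin n → ℂ) : curvature B x u v =
    endOfMatrix (trivializationAt (Fin r → ℂ) E x) x
      (curvatureMatrix (B (chartAt (Fin n → ℂ) x) (trivializationAt (Fin r → ℂ) E x))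
        (chartAt (Fin n → ℂ) x x) u v) := by
  change endOfMatrix _ x (curvatureMatrix _ _
    (mfderiv 𝓘(ℝ, Fin n → ℂ) 𝓘(ℝ, Fin n → ℂ) (chartAt (Fin n → ℂ) x) x u)
    (mfderiv 𝓘(ℝ, Fin n → ℂ) 𝓘(ℝ, Fin n → ℂ) (chartAt (Fin n → ℂ) x) x v)) = _
  rw [mfderiv_real_chartAt]
  rfl

/-- The curvature can be computed in any chart and frame. -/
theorem IsConnection.endMatrix_curvature (hB : IsConnection B) (hc : c ∈ atlas (Fin n → ℂ) X)
    {y : Fin n → ℂ} (hy : y ∈ frameDom c e) (u v : Fin n → ℂ) :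
    endMatrix e (c.symm y) (curvature B (c.symm y) (chartJac c y u) (chartJac c y v)) =
      curvatureMatrix (B c e) y u v := by
  set x := c.symm y with hx
  set c₀ := chartAt (Fin n → ℂ) x
  set e₀ := trivializationAt (Fin r → ℂ) E x
  have hc₀ : c₀ ∈ atlas (Fin n → ℂ) X := chart_mem_atlas _ _
  have he₀ : x ∈ e₀.baseSet := mem_baseSet_trivializationAt _ _ x
  have hov : y ∈ overlap c c₀ := mem_overlap_chartAt hy.1
  have hz : y ∈ gaugeDom c₀ c e₀ e := ⟨hov, ⟨hy.1, he₀⟩, hy⟩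
  have ht : c₀ x = transition c c₀ y := rfl
  have hgauge := curvatureMatrix_gauge (B := B c₀ e₀) (B' := B c e)
    (a := fun z => changeMatrix e₀ e (c.symm z)) (t := transition c c₀) (y := y)
    ((contDiffAt_transition_real hc hc₀ hov).of_le
      (WithTop.coe_le_coe.2 (le_top (a := (2 : ℕ∞)))))
    (fun i j => ((contDiffAt_changeMatrix hc hz i j).restrict_scalars ℝ).of_le le_top)
    (by
      filter_upwards [(isOpen_frameDom c₀ e₀).mem_nhds (transition_mem_frameDom hz)] with z hz
      exact hB.isLinear c₀ hc₀ e₀ z hz)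
    (hB.matDifferentiableAt hc₀ (transition_mem_frameDom hz))
    (hB.matDifferentiableAt hc hy)
    (by
      filter_upwards [(isOpen_gaugeDom c₀ c e₀ e).mem_nhds hz] with z hz v
      exact hB.gauge c₀ hc₀ c hc e₀ e z hz v) u v
  have hJ : ∀ w, chartJac c y w = fderiv ℝ (transition c c₀) y w := fun w => by
    rw [chartJac_eq hc hy.1, fderiv_transition_real hc hc₀ hov]
    rfl
  have h1 := changeMatrix_mul_endMatrix he₀ hy.2
    (curvature B x (chartJac c y u) (chartJac c y v))
  have h2 : endMatrix e₀ x (curvature B x (chartJac c y u) (chartJac c y v)) =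
      curvatureMatrix (B c₀ e₀) (transition c c₀ y) (fderiv ℝ (transition c c₀) y u)
        (fderiv ℝ (transition c c₀) y v) := by
    rw [curvature_apply, endMatrix_endOfMatrix he₀, ht, hJ, hJ]
  rw [h2, ← hgauge] at h1
  have hua : IsUnit (changeMatrix e₀ e x).det := isUnit_det_changeMatrix he₀ hy.2
  have h3 : (changeMatrix e₀ e x)⁻¹ * (changeMatrix e₀ e x * endMatrix e x
      (curvature B x (chartJac c y u) (chartJac c y v))) = (changeMatrix e₀ e x)⁻¹ *
        (changeMatrix e₀ e x * curvatureMatrix (B c e) y u v) :=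
    congrArg ((changeMatrix e₀ e x)⁻¹ * ·) h1
  rwa [Matrix.nonsing_inv_mul_cancel_left _ _ hua,
    Matrix.nonsing_inv_mul_cancel_left _ _ hua] at h3

theorem curvatureMatrix_isRealBilin {B : (Fin n → ℂ) → (Fin n → ℂ) → Matrix (Fin r) (Fin r) ℂ}
    {y : Fin n → ℂ} (hlin : ∀ᶠ z in 𝓝 y, IsLinearMap ℝ (B z))
    (hB : ∀ v, MatDifferentiableAt (fun z => B z v) y) : IsRealBilin (curvatureMatrix B y) := by
  have hadd : ∀ v v' u, matDeriv (fun z => B z (v + v')) y u =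
      matDeriv (fun z => B z v) y u + matDeriv (fun z => B z v') y u := fun v v' u => by
    rw [← matDeriv_add (hB v) (hB v')]
    exact matDeriv_congr (hlin.mono fun z hz => hz.map_add v v') u
  have hsmul : ∀ (t : ℝ) v u, matDeriv (fun z => B z (t • v)) y u =
      t • matDeriv (fun z => B z v) y u := fun t v u => by
    rw [matDeriv_congr (hlin.mono fun z hz => hz.map_smul t v : _ =ᶠ[𝓝 y] fun z => t • B z v) u]
    ext i j
    simp only [matDeriv, Matrix.of_apply, Matrix.smul_apply]
    rw [fderiv_fun_const_smul (hB v i j)]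
    rfl
  have hdadd : ∀ M : (Fin n → ℂ) → Matrix (Fin r) (Fin r) ℂ, ∀ u u', matDeriv M y (u + u') =
      matDeriv M y u + matDeriv M y u' := fun M u u' => by
    ext i j; simp [matDeriv]
  have hdsmul : ∀ M : (Fin n → ℂ) → Matrix (Fin r) (Fin r) ℂ, ∀ (t : ℝ) u, matDeriv M y (t • u) =
      t • matDeriv M y u := fun M t u => by
    ext i j; simp [matDeriv]
  have hl := hlin.self_of_nhds
  constructor
  · intro u u' v
    simp only [curvatureMatrix_eq, hadd, hdadd, hl.map_add]
    noncomm_ring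
  · intro u v v'
    simp only [curvatureMatrix_eq, hadd, hdadd, hl.map_add]
    noncomm_ring
  · intro t u v
    simp only [curvatureMatrix_eq, Complex.coe_smul, hsmul, hdsmul, hl.map_smul, Matrix.smul_mul,
      Matrix.mul_smul]
    module
  · intro t u v
    simp only [curvatureMatrix_eq, Complex.coe_smul, hsmul, hdsmul, hl.map_smul, Matrix.smul_mul,
      Matrix.mul_smul]
    module

theorem IsConnection.isRealBilin_curvature (hB : IsConnection B) (x : X) :
    IsRealBilin (V := Fin n → ℂ) fun u v => curvature B x u v := by
  have hc := chart_mem_atlas (Fin n → ℂ) x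
  have hx := chartAt_mem_frameDom (n := n) (r := r) (E := E) x
  have h := curvatureMatrix_isRealBilin
    (B := B (chartAt (Fin n → ℂ) x) (trivializationAt (Fin r → ℂ) E x))
    (by
      filter_upwards [(isOpen_frameDom _ _).mem_nhds hx] with z hz
      exact hB.isLinear _ hc _ z hz)
    (hB.matDifferentiableAt hc hx)
  have hadd : ∀ M N : Matrix (Fin r) (Fin r) ℂ, endOfMatrix (trivializationAt (Fin r → ℂ) E x) x
      (M + N) = endOfMatrix (trivializationAt (Fin r → ℂ) E x) x M +
        endOfMatrix (trivializationAt (Fin r → ℂ) E x) x N := fun M N => by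
    simp [endOfMatrix, LinearMap.add_comp, LinearMap.comp_add]
  have hsmul : ∀ (a : ℂ) (M : Matrix (Fin r) (Fin r) ℂ),
      endOfMatrix (trivializationAt (Fin r → ℂ) E x) x (a • M) =
        a • endOfMatrix (trivializationAt (Fin r → ℂ) E x) x M := fun a M => by
    simp [endOfMatrix, LinearMap.smul_comp, LinearMap.comp_smul]
  constructor
  · intro u u' v
    simp only [curvature_apply]
    rw [h.add_left, hadd]
  · intro u v v'
    simp only [curvature_apply]
    rw [h.add_right, hadd]
  · intro t u v
    simp only [curvature_apply]
    rw [h.smul_left, hsmul]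
  · intro t u v
    simp only [curvature_apply]
    rw [h.smul_right, hsmul]

theorem IsConnection.continuousOn_curvatureMatrix (hB : IsConnection B)
    (hc : c ∈ atlas (Fin n → ℂ) X) (u v : Fin n → ℂ) (i j : Fin r) :
    ContinuousOn (fun y => curvatureMatrix (B c e) y u v i j) (frameDom c e) := by
  have hd : ∀ u v, ContinuousOn (fun y => fderiv ℝ (fun z => B c e z v i j) y u)
      (frameDom c e) := fun u v =>
    ((hB.contDiffOn c hc e v i j).continuousOn_fderiv_of_isOpen (isOpen_frameDom c e)
      (by simp)).clm_apply continuousOn_const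
  have hm : ∀ u v, ContinuousOn (fun y => (B c e y u * B c e y v) i j) (frameDom c e) := fun u v =>
    (contDiffOn_matrix_mul (hB.contDiffOn c hc e u) (hB.contDiffOn c hc e v) i j).continuousOn
  exact ((hd u v).sub (hd v u)).add ((hm u v).sub (hm v u))

end Chern

section Higgs

open Set Filter Topology Matrix

/-! ### Holomorphic functions are continuously differentiable -/

section Holomorphic

variable {V : Type*} [NormedAddCommGroup V] [NormedSpace ℂ V] [FiniteDimensional ℂ V]

/-- The directional derivatives of a holomorphic function of several variables are continuous, by
Cauchy's estimate applied to the restrictions of `f` to parallel discs. -/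
theorem continuousOn_fderiv_of_holomorphic {f : V → ℂ} {U : Set V} (hU : IsOpen U)
    (hf : DifferentiableOn ℂ f U) (v : V) : ContinuousOn (fun y => fderiv ℂ f y v) U := by
  have : ProperSpace V := FiniteDimensional.proper_rclike ℂ V
  intro y hy
  obtain ⟨ρ, hρ, hball⟩ := Metric.nhds_basis_closedBall.mem_iff.1 (hU.mem_nhds hy)
  have huc : UniformContinuousOn f (Metric.closedBall y ρ) :=
    (isCompact_closedBall y ρ).uniformContinuousOn_of_continuous (hf.continuousOn.mono hball)
  -- discs of radius `R` in the direction `v` with centres close to `y` lie in the ball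
  set R := ρ / (2 * (‖v‖ + 1)) with hR
  have hR0 : 0 < R := by positivity
  have hRv : R * ‖v‖ ≤ ρ / 2 := by
    rw [hR, div_mul_eq_mul_div, div_le_div_iff₀ (by positivity) (by positivity)]
    nlinarith [norm_nonneg v]
  have hdisc : ∀ y' ∈ Metric.ball y (ρ / 2), ∀ ζ ∈ Metric.closedBall (0 : ℂ) R,
      y' + ζ • v ∈ Metric.closedBall y ρ := by
    intro y' hy' ζ hζ
    rw [Metric.mem_ball, dist_eq_norm] at hy'
    rw [mem_closedBall_zero_iff] at hζ
    rw [Metric.mem_closedBall, dist_eq_norm, add_sub_right_comm]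
    calc ‖y' - y + ζ • v‖ ≤ ‖y' - y‖ + ‖ζ‖ * ‖v‖ := (norm_add_le _ _).trans_eq (by rw [norm_smul])
      _ ≤ ρ / 2 + R * ‖v‖ := by gcongr
      _ ≤ ρ := by linarith
  have hdiff : ∀ y' ∈ Metric.ball y (ρ / 2), ∀ ζ ∈ Metric.closedBall (0 : ℂ) R,
      HasDerivAt (fun ζ : ℂ => f (y' + ζ • v)) (fderiv ℂ f (y' + ζ • v) v) ζ := by
    intro y' hy' ζ hζ
    have h1 : HasDerivAt (fun ζ : ℂ => y' + ζ • v) v ζ := by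
      simpa using ((hasDerivAt_id ζ).smul_const v).const_add y'
    exact ((hf.differentiableAt (hU.mem_nhds (hball (hdisc y' hy' ζ hζ)))).hasFDerivAt
      ).comp_hasDerivAt ζ h1
  have h0 : (0 : ℂ) ∈ Metric.closedBall (0 : ℂ) R := by simpa using hR0.le
  refine ContinuousAt.continuousWithinAt (Metric.continuousAt_iff.2 fun ε hε => ?_)
  obtain ⟨δ, hδ, hfδ⟩ := Metric.uniformContinuousOn_iff.1 huc (ε * R / 2) (by positivity)
  refine ⟨min δ (ρ / 2), by positivity, fun y' hy' => ?_⟩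
  have hy'ρ : y' ∈ Metric.ball y (ρ / 2) := hy'.trans_le (min_le_right _ _)
  have hyρ : y ∈ Metric.ball y (ρ / 2) := Metric.mem_ball_self (by positivity)
  set F : ℂ → ℂ := fun ζ => f (y' + ζ • v) - f (y + ζ • v) with hF
  have hFd : ∀ ζ ∈ Metric.closedBall (0 : ℂ) R, HasDerivAt F
      (fderiv ℂ f (y' + ζ • v) v - fderiv ℂ f (y + ζ • v) v) ζ := fun ζ hζ =>
    (hdiff y' hy'ρ ζ hζ).sub (hdiff y hyρ ζ hζ)
  have hcl : DiffContOnCl ℂ F (Metric.ball 0 R) :=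
    DifferentiableOn.diffContOnCl_ball (U := Metric.closedBall 0 R)
      (fun ζ hζ => (hFd ζ hζ).differentiableAt.differentiableWithinAt) subset_rfl
  have hbound : ∀ ζ ∈ Metric.sphere (0 : ℂ) R, ‖F ζ‖ ≤ ε * R / 2 := fun ζ hζ => by
    have hζ' := Metric.sphere_subset_closedBall hζ
    rw [hF, ← dist_eq_norm]
    refine (hfδ _ (hdisc y' hy'ρ ζ hζ') _ (hdisc y hyρ ζ hζ') ?_).le
    rw [dist_add_right]
    exact hy'.trans_le (min_le_left _ _)
  have h := Complex.norm_deriv_le_of_forall_mem_sphere_norm_le hR0 hcl hbound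
  rw [(hFd 0 h0).deriv] at h
  simp only [zero_smul, add_zero] at h
  rw [dist_eq_norm]
  refine h.trans_lt ?_
  rw [div_lt_iff₀ hR0]
  nlinarith [mul_pos hε hR0]

/-- The components of a Higgs field are only required to be holomorphic; this is what makes its
curvature continuous. -/
theorem contDiffOn_of_holomorphic {f : V → ℂ} {U : Set V} (hU : IsOpen U)
    (hf : DifferentiableOn ℂ f U) : ContDiffOn ℝ 1 f U := by
  have h : ContDiffOn ℂ 1 f U := by
    rw [show (1 : WithTop ℕ∞) = 0 + 1 from rfl, contDiffOn_succ_iff_fderiv_of_isOpen hU]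
    exact ⟨hf, by simp, contDiffOn_zero.2
      (continuousOn_clm_apply.2 (continuousOn_fderiv_of_holomorphic hU hf))⟩
  exact h.restrict_scalars ℝ

end Holomorphic

variable {n : ℕ} {X : Type*} [TopologicalSpace X] [ChartedSpace (Fin n → ℂ) X]
  {c c' : OpenPartialHomeomorph X (Fin n → ℂ)} [IsManifold 𝓘(ℂ, Fin n → ℂ) ω X]

/-! ### The Gram matrix of a Hermitian metric on the manifold -/

/-- The trivialization of the tangent bundle given by a chart. -/
def tangentTriv (hc : c ∈ atlas (Fin n → ℂ) X) : Trivialization (Fin n → ℂ)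
    (π (Fin n → ℂ) (fun x : X => TangentSpace 𝓘(ℂ, Fin n → ℂ) x)) :=
  (tangentBundleCore 𝓘(ℂ, Fin n → ℂ) X).localTriv ⟨c, hc⟩

instance memTrivializationAtlas_tangentTriv (hc : c ∈ atlas (Fin n → ℂ) X) :
    MemTrivializationAtlas (tangentTriv hc) :=
  ⟨⟨⟨c, hc⟩, rfl⟩⟩

theorem frameDom_tangentTriv (hc : c ∈ atlas (Fin n → ℂ) X) :
    frameDom c (tangentTriv hc) = c.target :=
  inter_eq_left.2 fun _ hy => c.map_target hy

theorem frame_tangentTriv (hc : c ∈ atlas (Fin n → ℂ) X) {y : Fin n → ℂ} (hy : y ∈ c.target)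
    (j : Fin n) : frame (tangentTriv hc) (c.symm y) j = chartJac c y (Pi.single j 1) := by
  have h : (tangentTriv hc).symmL ℂ (c.symm y) = chartJac c y := by
    refine ((tangentBundleCore 𝓘(ℂ, Fin n → ℂ) X).localTriv_symmL (i := ⟨c, hc⟩)
      (c.map_target hy)).trans ?_
    rw [chartJac_eq hc hy]
    change fderivWithin ℂ ((chartAt (Fin n → ℂ) (c.symm y)).extend 𝓘(ℂ, Fin n → ℂ) ∘
      (c.extend 𝓘(ℂ, Fin n → ℂ)).symm) (range 𝓘(ℂ, Fin n → ℂ)) (c.extend 𝓘(ℂ, Fin n → ℂ) _) = _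
    simp only [OpenPartialHomeomorph.extend, mfld_simps, fderivWithin_univ, c.right_inv hy]
    rfl
  exact congrArg (fun L : (Fin n → ℂ) →L[ℂ] (Fin n → ℂ) => L (Pi.single j 1)) h

/-- The matrix of a Hermitian metric on `X` with respect to the coordinate frame of a chart. -/
def chartGram (g : HermitianStructure n X) (c : OpenPartialHomeomorph X (Fin n → ℂ))
    (y : Fin n → ℂ) : Matrix (Fin n) (Fin n) ℂ :=
  formMatrix (V := Fin n → ℂ) (g.form (c.symm y)) fun i => chartJac c y (Pi.single i 1)

theorem gram_tangentTriv (g : HermitianStructure n X) (hc : c ∈ atlas (Fin n → ℂ) X)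
    {y : Fin n → ℂ} (hy : y ∈ c.target) : g.gram c (tangentTriv hc) y = chartGram g c y := by
  have h : frame (tangentTriv hc) (c.symm y) = fun i => chartJac c y (Pi.single i 1) :=
    funext (frame_tangentTriv hc hy)
  ext i j
  exact congrArg (fun b : Fin n → Fin n → ℂ => (g.form (c.symm y)) (b i) (b j)) h

theorem contDiffOn_chartGram (g : HermitianStructure n X) (hc : c ∈ atlas (Fin n → ℂ) X)
    (i j : Fin n) : ContDiffOn ℝ ∞ (fun y => chartGram g c y i j) c.target := by
  have h := contDiffOn_gram (e := tangentTriv hc) g hc i j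
  rw [frameDom_tangentTriv] at h
  exact h.congr fun y hy => (congrFun (congrFun (gram_tangentTriv g hc hy) i) j).symm

theorem isUnit_det_chartGram (g : HermitianStructure n X) (hc : c ∈ atlas (Fin n → ℂ) X)
    {y : Fin n → ℂ} (hy : y ∈ c.target) : IsUnit (chartGram g c y).det := by
  rw [← gram_tangentTriv g hc hy]
  exact isUnit_det_gram g (by rwa [frameDom_tangentTriv])

/-- The basis of `ℂⁿ` which represents the coordinate frame of a chart. -/
def chartBasis (hc : c ∈ atlas (Fin n → ℂ) X) {y : Fin n → ℂ} (hy : y ∈ c.target) :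
    Module.Basis (Fin n) ℂ (Fin n → ℂ) :=
  (Pi.basisFun ℂ (Fin n)).map
    (LinearMap.equivOfDetNeZero (chartJac c y : (Fin n → ℂ) →ₗ[ℂ] (Fin n → ℂ))
      (det_chartJac_ne_zero hc hy))

theorem chartBasis_apply (hc : c ∈ atlas (Fin n → ℂ) X) {y : Fin n → ℂ} (hy : y ∈ c.target)
    (i : Fin n) : chartBasis hc hy i = chartJac c y (Pi.single i 1) := by
  simp [chartBasis]

/-- `Λ` on the tangent space at `x` is `lamWith` in the standard basis of the model space. -/
theorem Lam_eq_lamWith (g : HermitianStructure n X) {W : Type*} [AddCommGroup W] [Module ℂ W]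
    (x : X) (ψ : (Fin n → ℂ) → (Fin n → ℂ) → W) : Lam g x ψ =
      lamWith (V := Fin n → ℂ) (g.form x) (fun i => Pi.single i 1) ψ := by
  have h : ∀ α : Fin n, (Pi.single α Complex.I : Fin n → ℂ) = Complex.I • Pi.single α 1 :=
    fun α => by rw [← Pi.single_smul]; simp
  simp only [Lam, lamWith, coeffOneOne, oneOnePart, h]
  rfl

/-- `Λ` can be computed in any chart. -/
theorem Lam_chart (g : HermitianStructure n X) {W : Type*} [AddCommGroup W] [Module ℂ W]
    (hc : c ∈ atlas (Fin n → ℂ) X) {y : Fin n → ℂ} (hy : y ∈ c.target)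
    {ψ : (Fin n → ℂ) → (Fin n → ℂ) → W} (hψ : IsRealBilin ψ) :
    Lam g (c.symm y) ψ = (-Complex.I) • ∑ i, ∑ j, (chartGram g c y)⁻¹ i j •
      oneOnePart (fun u v => ψ (chartJac c y u) (chartJac c y v)) (Pi.single i 1)
        (Pi.single j 1) := by
  rw [Lam_eq_lamWith]
  have h := lamWith_basis (V := Fin n → ℂ) (g.form (c.symm y)) (chartBasis hc hy)
    (Pi.basisFun ℂ (Fin n)) hψ
  have h1 : (fun i => Pi.single i 1) = ⇑(Pi.basisFun ℂ (Fin n)) := funext fun i => by simp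
  have h2 : ⇑(chartBasis hc hy) = fun i => chartJac c y (Pi.single i 1) :=
    funext (chartBasis_apply hc hy)
  have key := (congrArg (fun b : Fin n → Fin n → ℂ =>
    lamWith (V := Fin n → ℂ) (g.form (c.symm y)) b ψ) h1).trans (h.trans
      (congrArg (fun b : Fin n → Fin n → ℂ =>
        lamWith (V := Fin n → ℂ) (g.form (c.symm y)) b ψ) h2))
  refine key.trans ?_
  simp only [lamWith, oneOnePart, map_smul]
  rfl

end Higgs

section HitchinSimpson

open Set Filter Topology Matrix

variable {n : ℕ} {X : Type*} [TopologicalSpace X] [ChartedSpace (Fin n → ℂ) X]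
  {r : ℕ} {E : X → Type*} [∀ x, AddCommGroup (E x)] [∀ x, Module ℂ (E x)]
  [∀ x, TopologicalSpace (E x)] [TopologicalSpace (TotalSpace (Fin r → ℂ) E)]
  [FiberBundle (Fin r → ℂ) E] [VectorBundle ℂ (Fin r → ℂ) E]
  {c c' : OpenPartialHomeomorph X (Fin n → ℂ)}
  {e e' : Trivialization (Fin r → ℂ) (π (Fin r → ℂ) E)}
  [MemTrivializationAtlas e] [MemTrivializationAtlas e']

/-! ### The Hitchin–Simpson connection -/

theorem endMatrix_add (x : X) (f f' : Module.End ℂ (E x)) :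
    endMatrix e x (f + f') = endMatrix e x f + endMatrix e x f' := by
  ext i j
  simp [endMatrix]

theorem endMatrix_smul (x : X) (a : ℂ) (f : Module.End ℂ (E x)) :
    endMatrix e x (a • f) = a • endMatrix e x f := by
  ext i j
  simp [endMatrix]

/-- The matrix of a Higgs field in a chart and a frame. -/
def higgsMatrix (φ : HiggsField n r E) (c : OpenPartialHomeomorph X (Fin n → ℂ))
    (e : Trivialization (Fin r → ℂ) (π (Fin r → ℂ) E)) [MemTrivializationAtlas e]
    (y v : Fin n → ℂ) : Matrix (Fin r) (Fin r) ℂ :=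
  endMatrix e (c.symm y) (φ.toFun (c.symm y) (chartJac c y v))

theorem higgsMatrix_add (φ : HiggsField n r E) (y u v : Fin n → ℂ) :
    higgsMatrix φ c e y (u + v) = higgsMatrix φ c e y u + higgsMatrix φ c e y v := by
  rw [higgsMatrix, map_add]
  exact (congrArg (endMatrix e (c.symm y)) ((φ.toFun (c.symm y)).map_add _ _)).trans
    (endMatrix_add _ _ _)

theorem higgsMatrix_smul (φ : HiggsField n r E) (y : Fin n → ℂ) (a : ℂ) (v : Fin n → ℂ) :
    higgsMatrix φ c e y (a • v) = a • higgsMatrix φ c e y v := by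
  rw [higgsMatrix, map_smul]
  exact (congrArg (endMatrix e (c.symm y)) ((φ.toFun (c.symm y)).map_smul _ _)).trans
    (endMatrix_smul _ _ _)

theorem differentiableOn_higgsMatrix (φ : HiggsField n r E) (hc : c ∈ atlas (Fin n → ℂ) X)
    (v : Fin n → ℂ) (i j : Fin r) :
    DifferentiableOn ℂ (fun y => higgsMatrix φ c e y v i j) (frameDom c e) :=
  φ.holomorphic c hc e v i j

theorem contDiffOn_higgsMatrix (φ : HiggsField n r E) (hc : c ∈ atlas (Fin n → ℂ) X)
    (v : Fin n → ℂ) (i j : Fin r) :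
    ContDiffOn ℝ 1 (fun y => higgsMatrix φ c e y v i j) (frameDom c e) :=
  contDiffOn_of_holomorphic (isOpen_frameDom c e) (differentiableOn_higgsMatrix φ hc v i j)

/-- The matrix of the Hitchin–Simpson connection is `A + Φ + G⁻¹ Φᴴ G`. -/
theorem hsConnection_eq (φ : HiggsField n r E) (h : HermitianMetric n r E) {y : Fin n → ℂ}
    (hy : y ∈ frameDom c e) (v : Fin n → ℂ) : φ.hsConnection h c e y v =
      h.chernConnection c e y v + higgsMatrix φ c e y v +
        (h.gram c e y)⁻¹ * (higgsMatrix φ c e y v)ᴴ * h.gram c e y := by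
  rw [higgsMatrix, ← endMatrix_adjoint h hy]
  rfl

variable [IsManifold 𝓘(ℂ, Fin n → ℂ) ω X] [ContMDiffVectorBundle ω (Fin r → ℂ) E 𝓘(ℂ, Fin n → ℂ)]

/-- The components of a Higgs field, or of its image under a fibrewise operation `F`, in a fixed frame
transform under changes of charts like those of a `1`-form. -/
theorem higgs_transition (φ : HiggsField n r E) (F : ∀ x, Module.End ℂ (E x) → Module.End ℂ (E x))
    (hc : c ∈ atlas (Fin n → ℂ) X) (hc' : c' ∈ atlas (Fin n → ℂ) X) {z : Fin n → ℂ}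
    (hz : z ∈ overlap c' c) (v : Fin n → ℂ) :
    endMatrix e (c.symm (transition c' c z)) (F _ (φ.toFun (c.symm (transition c' c z))
      (chartJac c (transition c' c z) (fderiv ℝ (transition c' c) z v)))) =
    endMatrix e (c'.symm z) (F _ (φ.toFun (c'.symm z) (chartJac c' z v))) := by
  rw [chartJac_transition hc' hc hz, fderiv_transition_real hc' hc hz]
  have h := symm_transition hz
  generalize c.symm (transition c' c z) = x at h
  subst h
  rfl

/-- The Hitchin–Simpson connection is a connection: its tensorial part `φ + φ*` has conjugate
matrices in two frames. -/
theorem isConnection_hs (φ : HiggsField n r E) (h : HermitianMetric n r E) :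
    IsConnection fun c e => φ.hsConnection h c e where
  isLinear c hc e _ y hy := by
    have hA := chernConnection_isLinear (c := c) (e := e) h y
    constructor
    · intro u v
      rw [hsConnection_eq φ h hy, hsConnection_eq φ h hy, hsConnection_eq φ h hy, hA.map_add,
        higgsMatrix_add, Matrix.conjTranspose_add]
      noncomm_ring
    · intro t v
      have : higgsMatrix φ c e y (t • v) = t • higgsMatrix φ c e y v := by
        rw [← Complex.coe_smul, higgsMatrix_smul, Complex.coe_smul]
      rw [hsConnection_eq φ h hy, hsConnection_eq φ h hy, hA.map_smul, this,
        Matrix.conjTranspose_smul, Matrix.mul_smul, Matrix.smul_mul, smul_add, smul_add]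
      simp
  contDiffOn c hc e _ v i j := by
    have hΦ := contDiffOn_higgsMatrix (e := e) φ hc v
    have hΦ' : ∀ i j, ContDiffOn ℝ 1 (fun y => (higgsMatrix φ c e y v)ᴴ i j) (frameDom c e) :=
      fun i j => Complex.conjCLE.contDiff.comp_contDiffOn (hΦ j i)
    have hG : ∀ i j, ContDiffOn ℝ 1 (fun y => h.gram c e y i j) (frameDom c e) :=
      fun i j => (contDiffOn_gram h hc i j).of_le (by simp)
    have hG' : ∀ i j, ContDiffOn ℝ 1 (fun y => (h.gram c e y)⁻¹ i j) (frameDom c e) :=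
      fun i j => (contDiffOn_gram_inv h hc i j).of_le (by simp)
    have hA := (contDiffOn_chernConnection (e := e) h hc v i j).of_le
      (show (1 : WithTop ℕ∞) ≤ ∞ by simp)
    refine ((hA.add (hΦ i j)).add
      (contDiffOn_matrix_mul (contDiffOn_matrix_mul hG' hΦ') hG i j)).congr fun y hy => ?_
    exact congrFun (congrFun (hsConnection_eq φ h hy v) i) j
  gauge c hc c' hc' e e' _ _ z hz v := by
    have hA := chernConnection_gauge h hc hc' hz v
    have h1 := changeMatrix_mul_endMatrix hz.2.1.2 hz.2.2.2 (φ.toFun (c'.symm z) (chartJac c' z v))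
    have h2 := changeMatrix_mul_endMatrix hz.2.1.2 hz.2.2.2
      (h.adjoint _ (φ.toFun (c'.symm z) (chartJac c' z v)))
    rw [← higgs_transition (e := e) φ (fun _ f => f) hc hc' hz.1] at h1
    rw [← higgs_transition (e := e) φ h.adjoint hc hc' hz.1] at h2
    change changeMatrix e e' (c'.symm z) * (h.chernConnection c' e' z v +
        endMatrix e' (c'.symm z) (φ.toFun (c'.symm z) (chartJac c' z v)) +
        endMatrix e' (c'.symm z) (h.adjoint _ (φ.toFun (c'.symm z) (chartJac c' z v)))) =
      (h.chernConnection c e (transition c' c z) (fderiv ℝ (transition c' c) z v) +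
        endMatrix e (c.symm (transition c' c z)) (φ.toFun (c.symm (transition c' c z))
          (chartJac c (transition c' c z) (fderiv ℝ (transition c' c) z v))) +
        endMatrix e (c.symm (transition c' c z)) (h.adjoint _ (φ.toFun
          (c.symm (transition c' c z))
          (chartJac c (transition c' c z) (fderiv ℝ (transition c' c) z v))))) *
        changeMatrix e e' (c'.symm z) + _
    rw [mul_add, mul_add, hA, h1, h2]
    noncomm_ring

/-! ### The trace of the curvature -/

theorem trace_matDeriv {M : (Fin n → ℂ) → Matrix (Fin r) (Fin r) ℂ} {y : Fin n → ℂ}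
    (hM : MatDifferentiableAt M y) (u : Fin n → ℂ) :
    (matDeriv M y u).trace = fderiv ℝ (fun z => (M z).trace) y u := by
  simp only [Matrix.trace, Matrix.diag, matDeriv, Matrix.of_apply]
  rw [fderiv_fun_sum fun i _ => hM i i, _root_.sum_apply]

/-- The trace of the curvature of `d + B` is the exterior derivative of the trace of `B`. -/
theorem trace_curvatureMatrix {B : (Fin n → ℂ) → (Fin n → ℂ) → Matrix (Fin r) (Fin r) ℂ}
    {y : Fin n → ℂ} (hB : ∀ v, MatDifferentiableAt (fun z => B z v) y) (u v : Fin n → ℂ) :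
    (curvatureMatrix B y u v).trace =
      fderiv ℝ (fun z => (B z v).trace) y u - fderiv ℝ (fun z => (B z u).trace) y v := by
  rw [curvatureMatrix_eq, Matrix.trace_add, Matrix.trace_sub, Matrix.trace_sub,
    trace_matDeriv (hB v), trace_matDeriv (hB u),
    Matrix.trace_mul_comm, sub_self, add_zero]

theorem differentiableOn_trace_higgsMatrix (φ : HiggsField n r E)
    (hc : c ∈ atlas (Fin n → ℂ) X) (v : Fin n → ℂ) :
    DifferentiableOn ℂ (fun y => (higgsMatrix φ c e y v).trace) (frameDom c e) :=
  DifferentiableOn.fun_sum fun i _ => differentiableOn_higgsMatrix φ hc v i i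

/-- The exterior derivative of the trace of a Higgs field. -/
def dTraceHiggs (φ : HiggsField n r E) (c : OpenPartialHomeomorph X (Fin n → ℂ))
    (e : Trivialization (Fin r → ℂ) (π (Fin r → ℂ) E)) [MemTrivializationAtlas e]
    (y u v : Fin n → ℂ) : ℂ :=
  fderiv ℂ (fun z => (higgsMatrix φ c e z v).trace) y u -
    fderiv ℂ (fun z => (higgsMatrix φ c e z u).trace) y v

theorem dTraceHiggs_smul_left (φ : HiggsField n r E) (hc : c ∈ atlas (Fin n → ℂ) X)
    {y : Fin n → ℂ} (hy : y ∈ frameDom c e) (a : ℂ) (u v : Fin n → ℂ) :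
    dTraceHiggs φ c e y (a • u) v = a * dTraceHiggs φ c e y u v := by
  have hd := (differentiableOn_trace_higgsMatrix (e := e) φ hc u).differentiableAt
    ((isOpen_frameDom c e).mem_nhds hy)
  simp only [dTraceHiggs, higgsMatrix_smul, Matrix.trace_smul, smul_eq_mul]
  rw [fderiv_const_mul hd, map_smul]
  simp only [_root_.smul_apply, smul_eq_mul]
  ring

theorem dTraceHiggs_smul_right (φ : HiggsField n r E) (hc : c ∈ atlas (Fin n → ℂ) X)
    {y : Fin n → ℂ} (hy : y ∈ frameDom c e) (a : ℂ) (u v : Fin n → ℂ) :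
    dTraceHiggs φ c e y u (a • v) = a * dTraceHiggs φ c e y u v := by
  have h : ∀ u v, dTraceHiggs φ c e y u v = -dTraceHiggs φ c e y v u := fun u v => by
    simp [dTraceHiggs]
  rw [h, dTraceHiggs_smul_left φ hc hy, h v u]
  ring

/-- The traces of the curvatures of the Hitchin–Simpson and Chern connections differ by
`d tr φ` and its conjugate. -/
theorem trace_hsCurvatureMatrix (φ : HiggsField n r E) (h : HermitianMetric n r E)
    (hc : c ∈ atlas (Fin n → ℂ) X) {y : Fin n → ℂ} (hy : y ∈ frameDom c e) (u v : Fin n → ℂ) :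
    (curvatureMatrix (φ.hsConnection h c e) y u v).trace =
      (curvatureMatrix (h.chernConnection c e) y u v).trace +
        (dTraceHiggs φ c e y u v + starRingEnd ℂ (dTraceHiggs φ c e y u v)) := by
  rw [trace_curvatureMatrix ((isConnection_hs φ h).matDifferentiableAt hc hy),
    trace_curvatureMatrix ((isConnection_chern h).matDifferentiableAt hc hy)]
  have hA : ∀ v, DifferentiableAt ℝ (fun z => (h.chernConnection c e z v).trace) y := fun v =>
    DifferentiableAt.fun_sum fun i _ => (isConnection_chern h).matDifferentiableAt hc hy v i i
  have hΦ : ∀ v, DifferentiableAt ℂ (fun z => (higgsMatrix φ c e z v).trace) y := fun v =>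
    (differentiableOn_trace_higgsMatrix φ hc v).differentiableAt ((isOpen_frameDom c e).mem_nhds hy)
  have key : ∀ v u, fderiv ℝ (fun z => (φ.hsConnection h c e z v).trace) y u =
      fderiv ℝ (fun z => (h.chernConnection c e z v).trace) y u +
        (fderiv ℂ (fun z => (higgsMatrix φ c e z v).trace) y u +
          starRingEnd ℂ (fderiv ℂ (fun z => (higgsMatrix φ c e z v).trace) y u)) := by
    intro v u
    have heq : (fun z => (φ.hsConnection h c e z v).trace) =ᶠ[𝓝 y] fun z =>
        (h.chernConnection c e z v).trace + ((higgsMatrix φ c e z v).trace +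
          Complex.conjCLE ((higgsMatrix φ c e z v).trace)) := by
      filter_upwards [(isOpen_frameDom c e).mem_nhds hy] with z hz
      rw [hsConnection_eq φ h hz, Matrix.trace_add, Matrix.trace_add, mul_assoc,
        Matrix.trace_mul_comm, mul_assoc, Matrix.mul_nonsing_inv _ (isUnit_det_gram h hz), mul_one,
        Matrix.trace_conjTranspose, add_assoc]
      rfl
    have hR := (hΦ v).hasFDerivAt.restrictScalars ℝ
    have := ((hA v).hasFDerivAt.add (hR.add (Complex.conjCLE.hasFDerivAt.comp y hR))).congr_of_eventuallyEq heq
    rw [this.fderiv]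
    rfl
  rw [key, key, dTraceHiggs, map_sub]
  ring

theorem trace_hsCurvature (φ : HiggsField n r E) (h : HermitianMetric n r E) (x : X)
    (u v : Fin n → ℂ) : LinearMap.trace ℂ (E x) (φ.hsCurvature h x u v) =
      LinearMap.trace ℂ (E x) (h.chernCurvature x u v) +
        (dTraceHiggs φ (chartAt (Fin n → ℂ) x) (trivializationAt (Fin r → ℂ) E x)
            (chartAt (Fin n → ℂ) x x) u v +
          starRingEnd ℂ (dTraceHiggs φ (chartAt (Fin n → ℂ) x) (trivializationAt (Fin r → ℂ) E x)
            (chartAt (Fin n → ℂ) x x) u v)) := by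
  have hx : x ∈ (trivializationAt (Fin r → ℂ) E x).baseSet := mem_baseSet_trivializationAt _ _ x
  have h1 : φ.hsCurvature h x u v = _ := curvature_apply (B := fun c e => φ.hsConnection h c e) x u v
  have h2 : h.chernCurvature x u v = _ :=
    curvature_apply (B := fun c e => h.chernConnection c e) x u v
  rw [h1, h2, trace_eq_trace_endMatrix hx, trace_eq_trace_endMatrix hx, endMatrix_endOfMatrix hx,
    endMatrix_endOfMatrix hx]
  exact trace_hsCurvatureMatrix φ h (chart_mem_atlas _ _) (chartAt_mem_frameDom x) u v

theorem lamWith_congr {V W : Type*} [AddCommGroup V] [Module ℂ V] [AddCommGroup W] [Module ℂ W]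
    {B : V →ₗ⋆[ℂ] V →ₗ[ℂ] ℂ} {b : Fin n → V} {ψ ψ' : V → V → W}
    (h : ∀ i j, oneOnePart ψ (b i) (b j) = oneOnePart ψ' (b i) (b j)) :
    lamWith B b ψ = lamWith B b ψ' := by
  simp only [lamWith, h]

/-- Complex bilinear maps have type `(2,0)`, so that they and their conjugates have no
`(1,1)`-part. -/
theorem oneOnePart_add_conj {V : Type*} [AddCommGroup V] [Module ℂ V] {ψ ψ' D : V → V → ℂ}
    (hl : ∀ (a : ℂ) u v, D (a • u) v = a * D u v) (hr : ∀ (a : ℂ) u v, D u (a • v) = a * D u v)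
    (h : ∀ u v, ψ u v = ψ' u v + (D u v + starRingEnd ℂ (D u v))) (u v : V) :
    oneOnePart ψ u v = oneOnePart ψ' u v := by
  simp only [oneOnePart, h, hl, hr, map_mul, Complex.conj_I, smul_eq_mul]
  linear_combination 1 / 4 * (D u v + starRingEnd ℂ (D u v)) * Complex.I_sq

/-- The Higgs field does not contribute to `tr K`, since `d tr φ` has type `(2,0)`. -/
theorem trace_meanCurvature (g : HermitianStructure n X) (φ : HiggsField n r E)
    (h : HermitianMetric n r E) (x : X) :
    LinearMap.trace ℂ (E x) (meanCurvature g φ h x) = Complex.I *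
      Lam g x (fun u v => LinearMap.trace ℂ (E x) (h.chernCurvature x u v)) := by
  rw [meanCurvature, map_smul, smul_eq_mul]
  congr 1
  have h1 : LinearMap.trace ℂ (E x) (Lam g x (φ.hsCurvature h x)) =
      Lam g x fun u v => LinearMap.trace ℂ (E x) (φ.hsCurvature h x u v) :=
    (congrArg (LinearMap.trace ℂ (E x)) (Lam_eq_lamWith g x (φ.hsCurvature h x))).trans
      ((linearMap_lamWith (V := Fin n → ℂ) (LinearMap.trace ℂ (E x)) (g.form x) _ _).trans
        (Lam_eq_lamWith g x _).symm)
  refine h1.trans ((Lam_eq_lamWith g x _).trans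
    (Eq.trans (lamWith_congr fun i j => ?_) (Lam_eq_lamWith g x _).symm))
  have hx := chartAt_mem_frameDom (n := n) (r := r) (E := E) x
  exact oneOnePart_add_conj (dTraceHiggs_smul_left φ (chart_mem_atlas _ _) hx)
    (dTraceHiggs_smul_right φ (chart_mem_atlas _ _) hx) (trace_hsCurvature φ h x) _ _

/-! ### Continuity of the mean curvature -/

variable (e) in
/-- The matrix of an endomorphism of a fibre, as a linear map. -/
def endMatrixLin (x : X) : Module.End ℂ (E x) →ₗ[ℂ] Matrix (Fin r) (Fin r) ℂ where
  toFun := endMatrix e x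
  map_add' := endMatrix_add x
  map_smul' := endMatrix_smul x

variable {B : OpenPartialHomeomorph X (Fin n → ℂ) →
      ∀ e : Trivialization (Fin r → ℂ) (π (Fin r → ℂ) E), [MemTrivializationAtlas e] →
        (Fin n → ℂ) → (Fin n → ℂ) → Matrix (Fin r) (Fin r) ℂ}

/-- `Λ` of the curvature in a chart and a frame. -/
theorem IsConnection.endMatrix_Lam (hB : IsConnection B) (g : HermitianStructure n X)
    (hc : c ∈ atlas (Fin n → ℂ) X) {y : Fin n → ℂ} (hy : y ∈ frameDom c e) :
    endMatrix e (c.symm y) (Lam g (c.symm y) (curvature B (c.symm y))) =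
      (-Complex.I) • ∑ i, ∑ j, (chartGram g c y)⁻¹ i j •
        oneOnePart (curvatureMatrix (B c e) y) (Pi.single i 1) (Pi.single j 1) := by
  have h := congrArg (endMatrixLin e (c.symm y))
    (Lam_chart g hc hy.1 (hB.isRealBilin_curvature (c.symm y)))
  refine h.trans ?_
  have hone : ∀ (ψ : (Fin n → ℂ) → (Fin n → ℂ) → Module.End ℂ (E (c.symm y))) (u v : Fin n → ℂ),
      endMatrixLin e (c.symm y) (oneOnePart ψ u v) =
        oneOnePart (fun u v => endMatrixLin e (c.symm y) (ψ u v)) u v := fun ψ u v => by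
    simp [oneOnePart]
  simp only [map_smul, map_sum, hone]
  simp only [endMatrixLin, LinearMap.coe_mk, AddHom.coe_mk, hB.endMatrix_curvature hc hy]

theorem IsConnection.continuousOn_endMatrix_Lam (hB : IsConnection B)
    (g : HermitianStructure n X) (hc : c ∈ atlas (Fin n → ℂ) X) (i j : Fin r) :
    ContinuousOn (fun y => endMatrix e (c.symm y) (Lam g (c.symm y) (curvature B (c.symm y))) i j)
      (frameDom c e) := by
  have hG : ∀ i j, ContinuousOn (fun y => (chartGram g c y)⁻¹ i j) (frameDom c e) := fun i j =>
    (contDiffOn_matrix_inv (contDiffOn_chartGram g hc)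
      (fun _ hy => isUnit_det_chartGram g hc hy) i j).continuousOn.mono inter_subset_left
  have hR := fun u v => hB.continuousOn_curvatureMatrix (e := e) hc u v i j
  have : ContinuousOn (fun y => (-Complex.I) * ∑ k, ∑ l, (chartGram g c y)⁻¹ k l *
      (oneOnePart (curvatureMatrix (B c e) y) (Pi.single k 1) (Pi.single l 1)) i j)
      (frameDom c e) := by
    refine continuousOn_const.mul (continuousOn_finsetSum _ fun k _ =>
      continuousOn_finsetSum _ fun l _ => (hG k l).mul ?_)
    exact continuousOn_const.mul (((hR _ _).add (hR _ _)).add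
      (continuousOn_const.mul ((hR _ _).sub (hR _ _))))
  refine this.congr fun y hy => ?_
  refine (congrFun (congrFun (hB.endMatrix_Lam g hc hy) i) j).trans ?_
  simp [Matrix.sum_apply]

theorem continuousOn_endMatrix_meanCurvature (g : HermitianStructure n X) (φ : HiggsField n r E)
    (h : HermitianMetric n r E) (hc : c ∈ atlas (Fin n → ℂ) X) (i j : Fin r) :
    ContinuousOn (fun y => endMatrix e (c.symm y) (meanCurvature g φ h (c.symm y)) i j)
      (frameDom c e) := by
  refine (continuousOn_const (c := Complex.I)).mul
    ((isConnection_hs φ h).continuousOn_endMatrix_Lam (e := e) g hc i j) |>.congr fun y _ => ?_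
  exact congrFun (congrFun (endMatrix_smul _ _ _) i) j

variable (n r E) in
/-- Continuity on `X` can be checked in charts and frames. -/
theorem continuous_of_continuousOn_frameDom {F : X → ℝ}
    (h : ∀ x, ContinuousOn (fun y => F ((chartAt (Fin n → ℂ) x).symm y))
      (frameDom (chartAt (Fin n → ℂ) x) (trivializationAt (Fin r → ℂ) E x))) : Continuous F := by
  refine continuous_iff_continuousAt.2 fun x => ?_
  set c := chartAt (Fin n → ℂ) x
  have h1 : ContinuousAt (fun y => F (c.symm y)) (c x) :=
    (h x).continuousAt ((isOpen_frameDom _ _).mem_nhds (chartAt_mem_frameDom x))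
  have h2 : ContinuousAt (fun z => F (c.symm (c z))) x :=
    ContinuousAt.comp (f := c) h1 (c.continuousAt (mem_chart_source _ x))
  refine h2.congr ?_
  filter_upwards [c.open_source.mem_nhds (mem_chart_source _ x)] with z hz
  rw [c.left_inv hz]

theorem continuous_trace_meanCurvature (g : HermitianStructure n X) (φ : HiggsField n r E)
    (h : HermitianMetric n r E) :
    Continuous fun x => (LinearMap.trace ℂ (E x) (meanCurvature g φ h x)).re := by
  refine continuous_of_continuousOn_frameDom n r E fun x => ?_
  have hK := fun i j => continuousOn_endMatrix_meanCurvature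
    (e := trivializationAt (Fin r → ℂ) E x) g φ h (chart_mem_atlas (Fin n → ℂ) x) i j
  have : ContinuousOn (fun y => (∑ i, endMatrix (trivializationAt (Fin r → ℂ) E x)
      ((chartAt (Fin n → ℂ) x).symm y) (meanCurvature g φ h ((chartAt (Fin n → ℂ) x).symm y))
        i i).re) _ :=
    Complex.continuous_re.comp_continuousOn (continuousOn_finsetSum Finset.univ fun i _ => hK i i)
  exact this.congr fun y hy => congrArg Complex.re (trace_eq_trace_endMatrix hy.2 _)

theorem normSq_eq_trace (h : HermitianMetric n r E) {y : Fin n → ℂ} (hy : y ∈ frameDom c e)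
    (f : Module.End ℂ (E (c.symm y))) : h.normSq (c.symm y) f =
      (endMatrix e (c.symm y) f *
        ((h.gram c e y)⁻¹ * (endMatrix e (c.symm y) f)ᴴ * h.gram c e y)).trace.re := by
  rw [HermitianMetric.normSq, trace_eq_trace_endMatrix hy.2, endMatrix_mul hy.2,
    endMatrix_adjoint h hy]

theorem continuous_normSq_meanCurvature (g : HermitianStructure n X) (φ : HiggsField n r E)
    (h : HermitianMetric n r E) :
    Continuous fun x => h.normSq x (meanCurvature g φ h x) := by
  refine continuous_of_continuousOn_frameDom n r E fun x => ?_
  set c := chartAt (Fin n → ℂ) x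
  set e := trivializationAt (Fin r → ℂ) E x
  have hc : c ∈ atlas (Fin n → ℂ) X := chart_mem_atlas _ _
  set κ : (Fin n → ℂ) → Matrix (Fin r) (Fin r) ℂ := fun y =>
    endMatrix e (c.symm y) (meanCurvature g φ h (c.symm y))
  have hK : ContinuousOn κ (frameDom c e) := continuousOn_pi.2 fun i => continuousOn_pi.2 fun j =>
    continuousOn_endMatrix_meanCurvature (e := e) g φ h hc i j
  have hG : ContinuousOn (h.gram c e) (frameDom c e) :=
    continuousOn_pi.2 fun i => continuousOn_pi.2 fun j => (contDiffOn_gram h hc i j).continuousOn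
  have hG' : ContinuousOn (fun y => (h.gram c e y)⁻¹) (frameDom c e) :=
    continuousOn_pi.2 fun i => continuousOn_pi.2 fun j =>
      (contDiffOn_gram_inv h hc i j).continuousOn
  have hK' : ContinuousOn (fun y => (κ y)ᴴ) (frameDom c e) :=
    (continuous_id.matrix_conjTranspose).comp_continuousOn hK
  have htr : Continuous fun M : Matrix (Fin r) (Fin r) ℂ => M.trace.re :=
    Complex.continuous_re.comp continuous_id.matrix_trace
  exact (htr.comp_continuousOn (hK.mul ((hG'.mul hK').mul hG))).congr fun y hy =>
    normSq_eq_trace h hy _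

end HitchinSimpson

section ChernForms

open Set Filter Topology Matrix

/-! ### Smooth closed forms -/

section FormLemmas

variable {n : ℕ}

/-- A family of alternating maps is smooth if its values on all vectors are. -/
theorem contDiffOn_of_alt_apply {k : ℕ} {θ : (Fin n → ℂ) → (Fin n → ℂ) [⋀^Fin k]→L[ℝ] ℝ}
    {U : Set (Fin n → ℂ)} (h : ∀ v, ContDiffOn ℝ ∞ (fun z => θ z v) U) :
    ContDiffOn ℝ ∞ θ U := by
  set b := realify (Pi.basisFun ℂ (Fin n))
  -- the values on tuples of basis vectors embed the alternating maps into a finite product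
  let ev : (Fin n → ℂ) [⋀^Fin k]→L[ℝ] ℝ →ₗ[ℝ] (Fin k → Fin n × Fin 2) → ℝ :=
    { toFun := fun α s => α fun i => b (s i)
      map_add' := fun _ _ => rfl
      map_smul' := fun _ _ => rfl }
  have hev : LinearMap.ker ev = ⊥ := by
    refine LinearMap.ker_eq_bot.2 fun α α' hα => ?_
    apply ContinuousAlternatingMap.toAlternatingMap_injective
    exact b.ext_alternating fun s _ => congrFun hα s
  obtain ⟨L, hL⟩ := LinearMap.exists_leftInverse_of_injective ev hev
  have hc : ContDiff ℝ ∞ (LinearMap.toContinuousLinearMap L) := ContinuousLinearMap.contDiff _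
  have h1 : ContDiffOn ℝ ∞ (fun z => ev (θ z)) U := contDiffOn_pi.2 fun s => h _
  refine (hc.comp_contDiffOn h1).congr fun z _ => ?_
  exact (LinearMap.congr_fun hL (θ z)).symm

theorem alt_two_ext {α α' : (Fin n → ℂ) [⋀^Fin 2]→L[ℝ] ℝ} (h : ∀ u v, α ![u, v] = α' ![u, v]) :
    α = α' := by
  ext v
  have hv : v = ![v 0, v 1] := by funext j; fin_cases j <;> rfl
  rw [hv]
  exact h _ _

theorem alt_one_ext {α α' : (Fin n → ℂ) [⋀^Fin 1]→L[ℝ] ℝ} (h : ∀ v, α ![v] = α' ![v]) :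
    α = α' := by
  ext v
  have hv : v = ![v 0] := by funext j; fin_cases j; rfl
  rw [hv]
  exact h _

end FormLemmas

variable {n : ℕ} {X : Type*} [TopologicalSpace X] [ChartedSpace (Fin n → ℂ) X]
  {c c' : OpenPartialHomeomorph X (Fin n → ℂ)} [IsManifold 𝓘(ℂ, Fin n → ℂ) ω X]

theorem DForm.IsSmooth.differentiableAt {k : ℕ} {α : DForm n X k} (hα : α.IsSmooth)
    (hc : c ∈ atlas (Fin n → ℂ) X) {y : Fin n → ℂ} (hy : y ∈ c.target) :
    DifferentiableAt ℝ (α.inChart c) y :=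
  ((hα c hc).contDiffAt (c.open_target.mem_nhds hy)).differentiableAt (by simp)

theorem DForm.IsSmooth.d_isClosedForm {k : ℕ} {η : DForm n X k} (hη : η.IsSmooth) :
    η.d.IsClosedForm :=
  DForm.isClosedForm_of_locally_exact fun c hc _ hy =>
    ⟨c.target, η.inChart c, c.open_target, hy, hη c hc, fun _ hz => DForm.d_inChart hη hc hz⟩

/-- A form which is cohomologous to a smooth closed form is a smooth closed form. -/
theorem DForm.IsClosedForm.of_cohomologous {α β : DForm n X 2} (hα : α.IsClosedForm)
    (h : Cohomologous α β) : β.IsClosedForm := by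
  obtain ⟨η, hη, h⟩ := h
  have hd := hη.d_isClosedForm
  have heq : β.inChart = fun c y => α.inChart c y + η.d.inChart c y := by
    funext c y
    ext v
    change (β (c.symm y)) _ = (α (c.symm y)) _ + (η.d (c.symm y)) _
    rw [h]
    rfl
  constructor
  · intro c hc
    rw [heq]
    exact (hα.smooth c hc).add (hd.smooth c hc)
  · intro c hc y hy
    rw [heq, extDeriv_fun_add (hα.smooth.differentiableAt hc hy) (hd.smooth.differentiableAt hc hy),
      hα.closed c hc y hy, hd.closed c hc y hy, add_zero]

theorem cohomologous_refl (α : DForm n X 2) : Cohomologous α α := by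
  have h0 : ∀ c : OpenPartialHomeomorph X (Fin n → ℂ),
      DForm.inChart (fun _ => 0 : DForm n X 1) c = fun _ => 0 := fun c => by
    funext y
    ext v
    rfl
  refine ⟨fun _ => 0, fun c _ => ?_, fun x => ?_⟩
  · rw [h0]
    exact contDiffOn_const
  · rw [DForm.d_eq, h0]
    have : extDeriv (fun _ : Fin n → ℂ => (0 : (Fin n → ℂ) [⋀^Fin 1]→L[ℝ] ℝ))
        (chartAt (Fin n → ℂ) x x) = 0 :=
      alt_two_ext fun u v => by
        rw [extDeriv_one_apply (differentiableAt_const _)]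
        simp
    rw [this]
    exact (add_zero _).symm

/-! ### The Kähler form -/

/-- In a chart, `ω(u, v)` is `2 Im` of a combination of the smooth coefficients `g_{ij}`. -/
theorem isSmooth_kaehlerForm (g : HermitianStructure n X) : (kaehlerForm g).IsSmooth := by
  intro c hc
  refine contDiffOn_of_alt_apply fun v => ?_
  have h : ContDiffOn ℝ ∞ (fun y => 2 * (∑ i, ∑ j, starRingEnd ℂ (v 0 i) * (v 1 j *
      chartGram g c y i j)).im) c.target := by
    refine contDiffOn_const.mul (Complex.imCLM.contDiff.comp_contDiffOn ?_)
    exact ContDiffOn.sum fun i _ => ContDiffOn.sum fun j _ =>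
      contDiffOn_const.mul (contDiffOn_const.mul (contDiffOn_chartGram g hc i j))
  refine h.congr fun y hy => ?_
  have hexp : ∀ (B : (Fin n → ℂ) →ₗ⋆[ℂ] (Fin n → ℂ) →ₗ[ℂ] ℂ),
      B (chartJac c y (v 0)) (chartJac c y (v 1)) = ∑ i, ∑ j, starRingEnd ℂ (v 0 i) * (v 1 j *
        B (chartJac c y (Pi.single i 1)) (chartJac c y (Pi.single j 1))) := by
    intro B
    conv_lhs => rw [pi_eq_sum_univ' (v 0), pi_eq_sum_univ' (v 1)]
    simp only [map_sum, map_smul, LinearMap.map_smulₛₗ, LinearMap.sum_apply, LinearMap.smul_apply,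
      smul_eq_mul, Finset.mul_sum]
    rw [Finset.sum_comm]
    exact Finset.sum_congr rfl fun i _ => Finset.sum_congr rfl fun j _ => mul_left_comm _ _ _
  rw [DForm.inChart_apply _ hc hy]
  exact congrArg (fun z : ℂ => 2 * z.im) (hexp (g.form (c.symm y)))

theorem isClosedForm_kaehlerForm {g : HermitianStructure n X} (hg : IsKaehler g) :
    (kaehlerForm g).IsClosedForm :=
  (isSmooth_kaehlerForm g).isClosedForm hg

/-! ### Chern forms -/

variable {r : ℕ} {E : X → Type*} [∀ x, AddCommGroup (E x)] [∀ x, Module ℂ (E x)]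
  [∀ x, TopologicalSpace (E x)] [TopologicalSpace (TotalSpace (Fin r → ℂ) E)]
  [FiberBundle (Fin r → ℂ) E] [VectorBundle ℂ (Fin r → ℂ) E]
  {e e' : Trivialization (Fin r → ℂ) (π (Fin r → ℂ) E)}
  [MemTrivializationAtlas e] [MemTrivializationAtlas e']

/-- The local `1`-form `Re (√-1 / 2π) tr A`, where `A` is the matrix of the Chern connection. -/
def chernTheta (h : HermitianMetric n r E) (c : OpenPartialHomeomorph X (Fin n → ℂ))
    (e : Trivialization (Fin r → ℂ) (π (Fin r → ℂ) E)) [MemTrivializationAtlas e]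
    (y : Fin n → ℂ) : (Fin n → ℂ) [⋀^Fin 1]→L[ℝ] ℝ :=
  ContinuousAlternatingMap.ofSubsingleton ℝ (Fin n → ℂ) ℝ 0 (LinearMap.toContinuousLinearMap
    { toFun := fun v => (Complex.I / (2 * Real.pi) * (h.chernConnection c e y v).trace).re
      map_add' := fun u v => by
        rw [(chernConnection_isLinear h y).map_add, Matrix.trace_add, mul_add, Complex.add_re]
      map_smul' := fun t v => by
        rw [(chernConnection_isLinear h y).map_smul, Matrix.trace_smul, mul_smul_comm,
          Complex.smul_re]
        rfl })

theorem chernTheta_apply (h : HermitianMetric n r E) (y v : Fin n → ℂ) :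
    chernTheta h c e y ![v] =
      (Complex.I / (2 * Real.pi) * (h.chernConnection c e y v).trace).re := rfl

theorem contDiffOn_chernTheta (h : HermitianMetric n r E) (hc : c ∈ atlas (Fin n → ℂ) X) :
    ContDiffOn ℝ ∞ (chernTheta h c e) (frameDom c e) := by
  refine contDiffOn_of_alt_apply fun v => ?_
  have h1 : ContDiffOn ℝ ∞ (fun y => (h.chernConnection c e y (v 0)).trace) (frameDom c e) :=
    ContDiffOn.sum fun i _ => contDiffOn_chernConnection h hc (v 0) i i
  exact Complex.reCLM.contDiff.comp_contDiffOn (contDiffOn_const.mul h1)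

theorem differentiableAt_chernTheta (h : HermitianMetric n r E) (hc : c ∈ atlas (Fin n → ℂ) X)
    {y : Fin n → ℂ} (hy : y ∈ frameDom c e) : DifferentiableAt ℝ (chernTheta h c e) y :=
  ((contDiffOn_chernTheta h hc).contDiffAt ((isOpen_frameDom c e).mem_nhds hy)).differentiableAt
    (by simp)

variable [ContMDiffVectorBundle ω (Fin r → ℂ) E 𝓘(ℂ, Fin n → ℂ)]

theorem extDeriv_chernTheta (h : HermitianMetric n r E) (hc : c ∈ atlas (Fin n → ℂ) X)
    {y : Fin n → ℂ} (hy : y ∈ frameDom c e) (u v : Fin n → ℂ) :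
    extDeriv (chernTheta h c e) y ![u, v] =
      (Complex.I / (2 * Real.pi) * (curvatureMatrix (h.chernConnection c e) y u v).trace).re := by
  have hB := (isConnection_chern h).matDifferentiableAt hc hy
  have hA : ∀ v, DifferentiableAt ℝ (fun z => (h.chernConnection c e z v).trace) y := fun v =>
    DifferentiableAt.fun_sum fun i _ => hB v i i
  have hd : ∀ v u, fderiv ℝ (fun z => chernTheta h c e z ![v]) y u =
      (Complex.I / (2 * Real.pi) * fderiv ℝ (fun z => (h.chernConnection c e z v).trace) y u).re := by
    intro v u
    have := Complex.reCLM.hasFDerivAt.comp y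
      ((hA v).hasFDerivAt.const_mul (Complex.I / (2 * Real.pi)))
    exact congrArg (fun L : (Fin n → ℂ) →L[ℝ] ℝ => L u) this.fderiv
  rw [extDeriv_one_apply (differentiableAt_chernTheta h hc hy), hd, hd,
    trace_curvatureMatrix hB, mul_sub, Complex.sub_re]

/-- The Chern form `(√-1 / 2π) tr R_h` of a Hermitian metric, defined at `x` as `dθ` with the local
`1`-form `θ` of the preferred chart and frame. -/
def chernForm (h : HermitianMetric n r E) : DForm n X 2 := fun x =>
  extDeriv (chernTheta h (chartAt (Fin n → ℂ) x) (trivializationAt (Fin r → ℂ) E x))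
    (chartAt (Fin n → ℂ) x x)

theorem chernForm_apply (h : HermitianMetric n r E) (x : X) (u v : Fin n → ℂ) :
    (chernForm h x : (Fin n → ℂ) [⋀^Fin 2]→L[ℝ] ℝ) ![u, v] = (Complex.I / (2 * Real.pi) *
      LinearMap.trace ℂ (E x) (h.chernCurvature x u v)).re := by
  have hx : x ∈ (trivializationAt (Fin r → ℂ) E x).baseSet := mem_baseSet_trivializationAt _ _ x
  have h1 : h.chernCurvature x u v = _ :=
    curvature_apply (B := fun c e => h.chernConnection c e) x u v
  rw [h1, trace_eq_trace_endMatrix hx, endMatrix_endOfMatrix hx]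
  exact extDeriv_chernTheta h (chart_mem_atlas _ _) (chartAt_mem_frameDom x) u v

/-- In every chart and frame the Chern form is `dθ` for the local form `θ` of this chart and frame,
since the curvature matrices in two frames are conjugate. -/
theorem chernForm_inChart (h : HermitianMetric n r E) (hc : c ∈ atlas (Fin n → ℂ) X)
    {y : Fin n → ℂ} (hy : y ∈ frameDom c e) :
    (chernForm h).inChart c y = extDeriv (chernTheta h c e) y := by
  refine alt_two_ext fun u v => ?_
  rw [extDeriv_chernTheta h hc hy, DForm.inChart_apply _ hc hy.1]
  have hv : (fun i => chartJac c y (![u, v] i)) = ![chartJac c y u, chartJac c y v] := by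
    funext i; fin_cases i <;> rfl
  have h1 : endMatrix e (c.symm y)
      (h.chernCurvature (c.symm y) (chartJac c y u) (chartJac c y v)) = _ :=
    (isConnection_chern h).endMatrix_curvature hc hy u v
  rw [← h1, ← trace_eq_trace_endMatrix hy.2]
  exact (congrArg (chernForm h (c.symm y) : (Fin n → ℂ) [⋀^Fin 2]→L[ℝ] ℝ) hv).trans
    (chernForm_apply h (c.symm y) _ _)

theorem mem_frameDom_trivializationAt {y : Fin n → ℂ} (hy : y ∈ c.target) :
    y ∈ frameDom c (trivializationAt (Fin r → ℂ) E (c.symm y)) :=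
  ⟨hy, mem_baseSet_trivializationAt _ _ _⟩

theorem isClosedForm_chernForm (h : HermitianMetric n r E) : (chernForm h).IsClosedForm :=
  DForm.isClosedForm_of_locally_exact fun c hc y hy =>
    ⟨frameDom c (trivializationAt (Fin r → ℂ) E (c.symm y)), chernTheta h c _, isOpen_frameDom _ _,
      mem_frameDom_trivializationAt hy, contDiffOn_chernTheta h hc,
      fun _ hz => chernForm_inChart h hc hz⟩

/-- The trace of the Chern connection matrix changes by a term which does not depend on the
metric. -/
theorem trace_chernConnection_change (h h' : HermitianMetric n r E)
    (hc : c ∈ atlas (Fin n → ℂ) X) (hc' : c' ∈ atlas (Fin n → ℂ) X) {z : Fin n → ℂ}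
    (hz : z ∈ gaugeDom c c' e e') (v : Fin n → ℂ) :
    (h'.chernConnection c' e' z v).trace - (h.chernConnection c' e' z v).trace =
      (h'.chernConnection c e (transition c' c z) (fderiv ℝ (transition c' c) z v)).trace -
        (h.chernConnection c e (transition c' c z) (fderiv ℝ (transition c' c) z v)).trace := by
  have hua := isUnit_det_changeMatrix hz.2.1.2 hz.2.2.2
  set a := changeMatrix e e' (c'.symm z)
  have key : a * (h'.chernConnection c' e' z v - h.chernConnection c' e' z v) =
      (h'.chernConnection c e (transition c' c z) (fderiv ℝ (transition c' c) z v) -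
        h.chernConnection c e (transition c' c z) (fderiv ℝ (transition c' c) z v)) * a := by
    rw [mul_sub, sub_mul, chernConnection_gauge h hc hc' hz, chernConnection_gauge h' hc hc' hz]
    abel
  rw [← Matrix.trace_sub, ← Matrix.trace_sub,
    ← Matrix.nonsing_inv_mul_cancel_left a (h'.chernConnection c' e' z v - _) hua, key,
    Matrix.trace_mul_comm, Matrix.mul_nonsing_inv_cancel_right _ _ hua]

/-- The difference of the local `1`-forms of two Chern connections, which does not depend on the
chart and the frame and hence is a global `1`-form. -/
def chernDiff (h h' : HermitianMetric n r E) : DForm n X 1 := fun x =>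
  chernTheta h' (chartAt (Fin n → ℂ) x) (trivializationAt (Fin r → ℂ) E x)
      (chartAt (Fin n → ℂ) x x) -
    chernTheta h (chartAt (Fin n → ℂ) x) (trivializationAt (Fin r → ℂ) E x)
      (chartAt (Fin n → ℂ) x x)

theorem chernDiff_inChart (h h' : HermitianMetric n r E) (hc : c ∈ atlas (Fin n → ℂ) X)
    {y : Fin n → ℂ} (hy : y ∈ frameDom c e) :
    (chernDiff h h').inChart c y = chernTheta h' c e y - chernTheta h c e y := by
  refine alt_one_ext fun v => ?_
  set x := c.symm y with hx
  set c₀ := chartAt (Fin n → ℂ) x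
  set e₀ := trivializationAt (Fin r → ℂ) E x
  have hc₀ : c₀ ∈ atlas (Fin n → ℂ) X := chart_mem_atlas _ _
  have hov : y ∈ overlap c c₀ := mem_overlap_chartAt hy.1
  have hz : y ∈ gaugeDom c₀ c e₀ e :=
    ⟨hov, ⟨hy.1, mem_baseSet_trivializationAt _ _ x⟩, hy⟩
  have hJ : chartJac c y v = fderiv ℝ (transition c c₀) y v := by
    rw [chartJac_eq hc hy.1, fderiv_transition_real hc hc₀ hov]
    rfl
  have h1 : (chernDiff h h').inChart c y ![v] =
      chernTheta h' c₀ e₀ (c₀ x) ![chartJac c y v] -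
        chernTheta h c₀ e₀ (c₀ x) ![chartJac c y v] := by
    rw [DForm.inChart_apply _ hc hy.1]
    have hv : (fun i => chartJac c y (![v] i)) = ![chartJac c y v] := by
      funext i; fin_cases i; rfl
    exact congrArg (chernDiff h h' x : (Fin n → ℂ) [⋀^Fin 1]→L[ℝ] ℝ) hv
  rw [h1, ContinuousAlternatingMap.sub_apply]
  simp only [chernTheta_apply]
  rw [← Complex.sub_re, ← Complex.sub_re, ← mul_sub, ← mul_sub,
    trace_chernConnection_change h h' hc₀ hc hz, hJ]
  rfl

/-- The Chern forms of two Hermitian metrics are cohomologous. -/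
theorem cohomologous_chernForm (h h' : HermitianMetric n r E) :
    Cohomologous (chernForm h) (chernForm h') := by
  refine ⟨chernDiff h h', fun c hc y hy => ?_, fun x => ?_⟩
  · have hy' := mem_frameDom_trivializationAt (r := r) (E := E) hy
    have h1 : ContDiffOn ℝ ∞ ((chernDiff h h').inChart c)
        (frameDom c (trivializationAt (Fin r → ℂ) E (c.symm y))) :=
      ((contDiffOn_chernTheta h' hc).sub (contDiffOn_chernTheta h hc)).congr fun z hz =>
        chernDiff_inChart h h' hc hz
    exact (h1.contDiffAt ((isOpen_frameDom _ _).mem_nhds hy')).contDiffWithinAt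
  · have hc := chart_mem_atlas (Fin n → ℂ) x
    have hx := chartAt_mem_frameDom (n := n) (r := r) (E := E) x
    have heq : (chernDiff h h').inChart (chartAt (Fin n → ℂ) x) =ᶠ[𝓝 (chartAt (Fin n → ℂ) x x)]
        fun z => chernTheta h' (chartAt (Fin n → ℂ) x) (trivializationAt (Fin r → ℂ) E x) z -
          chernTheta h (chartAt (Fin n → ℂ) x) (trivializationAt (Fin r → ℂ) E x) z := by
      filter_upwards [(isOpen_frameDom _ _).mem_nhds hx] with z hz
      exact chernDiff_inChart h h' hc hz
    have hd := differentiableAt_chernTheta h hc hx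
    have hd' := differentiableAt_chernTheta h' hc hx
    have hadd := extDeriv_fun_add hd (hd'.sub hd)
    rw [DForm.d_eq, heq.extDeriv_eq]
    refine Eq.trans ?_ hadd
    have hfun : (fun z => chernTheta h (chartAt (Fin n → ℂ) x)
        (trivializationAt (Fin r → ℂ) E x) z +
        (chernTheta h' (chartAt (Fin n → ℂ) x) (trivializationAt (Fin r → ℂ) E x) -
          chernTheta h (chartAt (Fin n → ℂ) x) (trivializationAt (Fin r → ℂ) E x)) z) =
        chernTheta h' (chartAt (Fin n → ℂ) x) (trivializationAt (Fin r → ℂ) E x) := by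
      funext z
      simp
    rw [hfun]
    rfl

/-! ### The trace of the Chern curvature is imaginary -/

/-- The form `tr (G⁻¹ dG)` is closed, being locally `d log det G`. -/
theorem fderiv_trace_inv_mul_symm {G : (Fin n → ℂ) → Matrix (Fin r) (Fin r) ℂ}
    {U : Set (Fin n → ℂ)} (hU : IsOpen U) (hG : ∀ i j, ContDiffOn ℝ ∞ (fun z => G z i j) U)
    (hdet : ∀ z ∈ U, IsUnit (G z).det) {y : Fin n → ℂ} (hy : y ∈ U) (u v : Fin n → ℂ) :
    fderiv ℝ (fun z => ((G z)⁻¹ * matDeriv G z v).trace) y u =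
      fderiv ℝ (fun z => ((G z)⁻¹ * matDeriv G z u).trace) y v := by
  have hd : MatDifferentiableAt G y :=
    matDifferentiableAt_of_contDiffOn hU (fun i j => (hG i j).of_le (by simp)) hy
  have hinv : MatDifferentiableAt (fun z => (G z)⁻¹) y :=
    matDifferentiableAt_of_contDiffOn hU
      (fun i j => (contDiffOn_matrix_inv hG hdet i j).of_le (by simp)) hy
  have hdd : ∀ v, MatDifferentiableAt (fun z => matDeriv G z v) y := fun v =>
    matDifferentiableAt_of_contDiffOn hU (fun i j =>
      (((hG i j).fderiv_of_isOpen hU (m := 1) (by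
        exact WithTop.coe_le_coe.2 (le_top (a := (2 : ℕ∞))))).clm_apply contDiffOn_const)) hy
  have hdG : ∀ u, matDeriv (fun z => (G z)⁻¹) y u = -((G y)⁻¹ * matDeriv G y u * (G y)⁻¹) := by
    intro u
    have h1 : (fun z => (G z)⁻¹ * G z) =ᶠ[𝓝 y] fun _ => 1 := by
      filter_upwards [hU.mem_nhds hy] with z hz
      exact Matrix.nonsing_inv_mul _ (hdet z hz)
    have h2 := matDeriv_congr h1 u
    rw [matDeriv_mul hinv hd] at h2
    have h3 : matDeriv (fun _ : Fin n → ℂ => (1 : Matrix (Fin r) (Fin r) ℂ)) y u = 0 := by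
      ext i j
      simp [matDeriv]
    rw [h3] at h2
    have h4 := congrArg (· * (G y)⁻¹) (eq_neg_of_add_eq_zero_left h2)
    simpa only [Matrix.mul_nonsing_inv_cancel_right _ _ (hdet y hy), neg_mul] using h4
  have hsymm : ∀ u v, matDeriv (fun z => matDeriv G z v) y u =
      matDeriv (fun z => matDeriv G z u) y v := by
    intro u v
    ext i j
    have hC : ContDiffAt ℝ ∞ (fun z => G z i j) y := (hG i j).contDiffAt (hU.mem_nhds hy)
    have hdiff : DifferentiableAt ℝ (fderiv ℝ fun z => G z i j) y :=
      (hC.fderiv_right (m := 1) (WithTop.coe_le_coe.2 (le_top (a := (2 : ℕ∞))))).differentiableAt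
        (by simp)
    have hf : ∀ w : Fin n → ℂ, fderiv ℝ (fun z => fderiv ℝ (fun z => G z i j) z w) y =
        (fderiv ℝ (fderiv ℝ fun z => G z i j) y).flip w := fun w => by
      simpa using (hdiff.hasFDerivAt.clm_apply (hasFDerivAt_const w y)).fderiv
    simp only [matDeriv, Matrix.of_apply]
    rw [hf, hf]
    exact (hC.isSymmSndFDerivAt two_le_smooth) u v
  have key : ∀ u v, fderiv ℝ (fun z => ((G z)⁻¹ * matDeriv G z v).trace) y u =
      (-((G y)⁻¹ * matDeriv G y u * (G y)⁻¹) * matDeriv G y v).trace +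
        ((G y)⁻¹ * matDeriv (fun z => matDeriv G z v) y u).trace := by
    intro u v
    rw [← hdG, ← Matrix.trace_add, ← matDeriv_mul hinv (hdd v), trace_matDeriv (hinv.mul (hdd v))]
  rw [key, key, hsymm u v]
  congr 1
  rw [neg_mul, neg_mul, Matrix.trace_neg, Matrix.trace_neg, mul_assoc _ _ (matDeriv G y v),
    Matrix.trace_mul_comm, mul_assoc, mul_assoc, mul_assoc, Matrix.trace_mul_comm, ← mul_assoc]

/-- With `A = G⁻¹ ∂G` and `G` Hermitian, `tr (G⁻¹ dG)` is real and equals `tr A` plus its conjugate. -/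
theorem re_trace_chernConnection (h : HermitianMetric n r E) (hc : c ∈ atlas (Fin n → ℂ) X)
    {y : Fin n → ℂ} (hy : y ∈ frameDom c e) (v : Fin n → ℂ) :
    (h.chernConnection c e y v).trace.re =
      1 / 2 * ((h.gram c e y)⁻¹ * matDeriv (h.gram c e) y v).trace.re := by
  set G := h.gram c e
  have hreal : ∀ w, ((G y)⁻¹ * matDeriv G y w).trace.im = 0 := by
    intro w
    have hstar : (matDeriv G y w)ᴴ = matDeriv G y w := by
      rw [← matDeriv_conjTranspose (matDifferentiableAt_gram h hc hy)]
      exact congrArg (fun M => matDeriv M y w) (funext fun z => gram_conjTranspose h z)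
    have h1 := Matrix.trace_conjTranspose ((G y)⁻¹ * matDeriv G y w)
    rw [Matrix.conjTranspose_mul, hstar, Matrix.conjTranspose_nonsing_inv, gram_conjTranspose,
      Matrix.trace_mul_comm] at h1
    exact Complex.conj_eq_iff_im.1 h1.symm
  rw [chernConnection_eq, matDel_eq, Matrix.mul_smul, Matrix.trace_smul, mul_sub, Matrix.trace_sub,
    Matrix.mul_smul, Matrix.trace_smul, smul_eq_mul, smul_eq_mul]
  have : ((h.gram c e y)⁻¹ * matDeriv (h.gram c e) y (Complex.I • v)).trace.im = 0 := hreal _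
  simp [this, G]

/-- The trace of the curvature of the Chern connection is imaginary, as the real part of `tr A` is
half the closed form `tr (G⁻¹ dG)`. -/
theorem re_trace_chernCurvature (h : HermitianMetric n r E) (x : X) (u v : Fin n → ℂ) :
    (LinearMap.trace ℂ (E x) (h.chernCurvature x u v)).re = 0 := by
  have hxe : x ∈ (trivializationAt (Fin r → ℂ) E x).baseSet := mem_baseSet_trivializationAt _ _ x
  have hcurv : h.chernCurvature x u v = _ :=
    curvature_apply (B := fun c e => h.chernConnection c e) x u v
  rw [hcurv, trace_eq_trace_endMatrix hxe, endMatrix_endOfMatrix hxe]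
  have hc := chart_mem_atlas (Fin n → ℂ) x
  have hx := chartAt_mem_frameDom (n := n) (r := r) (E := E) x
  set c := chartAt (Fin n → ℂ) x
  set e := trivializationAt (Fin r → ℂ) E x
  set y := c x
  have hB := (isConnection_chern h).matDifferentiableAt hc hx
  rw [trace_curvatureMatrix hB]
  have hA : ∀ v, DifferentiableAt ℝ (fun z => (h.chernConnection c e z v).trace) y := fun v =>
    DifferentiableAt.fun_sum fun i _ => hB v i i
  have hL : ∀ v, DifferentiableAt ℝ
      (fun z => ((h.gram c e z)⁻¹ * matDeriv (h.gram c e) z v).trace) y := fun v =>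
    DifferentiableAt.fun_sum fun i _ => matDifferentiableAt_of_contDiffOn (isOpen_frameDom c e)
      (contDiffOn_matrix_mul (fun i j => (contDiffOn_gram_inv h hc i j).of_le (by simp))
        fun i j => (((contDiffOn_gram h hc i j).fderiv_of_isOpen (isOpen_frameDom c e) (m := 1)
          (WithTop.coe_le_coe.2 (le_top (a := (2 : ℕ∞))))).clm_apply contDiffOn_const)) hx i i
  have hre : ∀ {f : (Fin n → ℂ) → ℂ}, DifferentiableAt ℝ f y → ∀ w,
      (fderiv ℝ f y w).re = fderiv ℝ (fun z => (f z).re) y w := fun {f} hf w =>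
    (congrArg (fun L : (Fin n → ℂ) →L[ℝ] ℝ => L w)
      (Complex.reCLM.hasFDerivAt.comp y hf.hasFDerivAt).fderiv).symm
  have key : ∀ v w, (fderiv ℝ (fun z => (h.chernConnection c e z v).trace) y w).re =
      1 / 2 * (fderiv ℝ (fun z => ((h.gram c e z)⁻¹ * matDeriv (h.gram c e) z v).trace) y w).re := by
    intro v w
    have heq : (fun z => (h.chernConnection c e z v).trace.re) =ᶠ[𝓝 y] fun z =>
        1 / 2 * ((h.gram c e z)⁻¹ * matDeriv (h.gram c e) z v).trace.re := by
      filter_upwards [(isOpen_frameDom c e).mem_nhds hx] with z hz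
      exact re_trace_chernConnection h hc hz v
    have hd : DifferentiableAt ℝ
        (fun z => ((h.gram c e z)⁻¹ * matDeriv (h.gram c e) z v).trace.re) y :=
      (Complex.reCLM.hasFDerivAt.comp y (hL v).hasFDerivAt).differentiableAt
    rw [hre (hA v), hre (hL v), heq.fderiv_eq, fderiv_const_mul hd]
    rfl
  rw [Complex.sub_re, key, key, fderiv_trace_inv_mul_symm (isOpen_frameDom c e)
    (contDiffOn_gram h hc) (fun z hz => isUnit_det_gram h hz) hx, sub_self]

/-- The real part in the definition of the Chern form can be omitted. -/
theorem chernForm_apply_coe (h : HermitianMetric n r E) (x : X) (u v : Fin n → ℂ) :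
    (((chernForm h x : (Fin n → ℂ) [⋀^Fin 2]→L[ℝ] ℝ) ![u, v] : ℝ) : ℂ) =
      Complex.I / (2 * Real.pi) * LinearMap.trace ℂ (E x) (h.chernCurvature x u v) := by
  rw [chernForm_apply]
  set t := LinearMap.trace ℂ (E x) (h.chernCurvature x u v) with ht
  have ht0 : t.re = 0 := re_trace_chernCurvature h x u v
  have hI : Complex.I / (2 * Real.pi) = ((1 / (2 * Real.pi) : ℝ) : ℂ) * Complex.I := by
    push_cast
    ring
  apply Complex.ext
  · simp
  · rw [hI, mul_assoc, Complex.im_ofReal_mul, Complex.ofReal_im]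
    simp [ht0]

theorem representsFirstChernClass_chernForm (h : HermitianMetric n r E) :
    RepresentsFirstChernClass n r E (chernForm h) := by
  obtain ⟨η, hη, h0⟩ := cohomologous_refl (chernForm h)
  refine ⟨h, η, hη, fun x u v => ?_⟩
  have hd : η.d x = 0 := left_eq_add.1 (h0 x)
  rw [hd]
  exact (chernForm_apply_coe h x u v).trans (by simp)

/-- Every form which represents the first Chern class is cohomologous to a Chern form. -/
theorem RepresentsFirstChernClass.exists_cohomologous {β : DForm n X 2}
    (hβ : RepresentsFirstChernClass n r E β) :
    ∃ h : HermitianMetric n r E, Cohomologous (chernForm h) β := by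
  obtain ⟨h, η, hη, hβ⟩ := hβ
  refine ⟨h, η, hη, fun x => alt_two_ext fun u v => ?_⟩
  have h1 := hβ x u v
  have h2 := congrArg (· + (((η.d x : (Fin n → ℂ) [⋀^Fin 2]→L[ℝ] ℝ) ![u, v] : ℝ) : ℂ))
    (chernForm_apply_coe h x u v)
  exact_mod_cast h1.trans h2.symm

theorem RepresentsFirstChernClass.isClosedForm {β : DForm n X 2}
    (hβ : RepresentsFirstChernClass n r E β) : β.IsClosedForm := by
  obtain ⟨h, hh⟩ := hβ.exists_cohomologous
  exact (isClosedForm_chernForm h).of_cohomologous hh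

end ChernForms

section Functional

open Set Filter Topology Matrix MeasureTheory

variable {n : ℕ} {X : Type*} [TopologicalSpace X] [ChartedSpace (Fin n → ℂ) X]
  [IsManifold 𝓘(ℂ, Fin n → ℂ) ω X] {c : OpenPartialHomeomorph X (Fin n → ℂ)}

/-! ### Integration against the volume form -/

/-- The volume form `ωⁿ` is positive with respect to the complex orientation. -/
theorem coeff_topPower_pos (g : HermitianStructure n X) (hc : c ∈ atlas (Fin n → ℂ) X)
    {y : Fin n → ℂ} (hy : y ∈ c.target) : 0 < (topPower (kaehlerForm g)).coeff c y := by
  have h : (fun q => chartJac c y (realBasis n q)) = ⇑(realify (chartBasis hc hy)) := by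
    rw [← realify_stdBasis]
    funext ⟨a, j⟩
    fin_cases j
    · simp [realify_zero, chartBasis_apply]
    · simp [realify_one, chartBasis_apply]
  have hpos := wedgeAt_twoImForm_pos (g.conj_symm (c.symm y)) (g.pos (c.symm y))
    (chartBasis hc hy)
  rw [TopForm.coeff_eq _ hc hy]
  exact hpos.trans_eq (congrArg (fun v : Fin n × Fin 2 → Fin n → ℂ =>
    wedgeAt (fun _ => twoImForm (g.form (c.symm y)) (g.conj_symm (c.symm y))) v) h.symm)

section Compact

variable [T2Space X] [CompactSpace X]

theorem isContinuous_topPower (g : HermitianStructure n X) :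
    (topPower (kaehlerForm g)).IsContinuous :=
  isContinuous_wedge fun _ => isSmooth_kaehlerForm g

/-- The integral of a function against the volume form `ωⁿ`. -/
def volIntegral (g : HermitianStructure n X) (f : X → ℝ) : ℝ :=
  TopForm.integral fun x => f x • topPower (kaehlerForm g) x

theorem volIntegral_add (g : HermitianStructure n X) {f f' : X → ℝ} (hf : Continuous f)
    (hf' : Continuous f') :
    volIntegral g (fun x => f x + f' x) = volIntegral g f + volIntegral g f' := by
  rw [volIntegral, volIntegral, volIntegral, ← TopForm.integral_add
    ((isContinuous_topPower g).fun_smul hf) ((isContinuous_topPower g).fun_smul hf')]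
  exact TopForm.integral_congr fun x => add_smul _ _ _

theorem volIntegral_const_mul (g : HermitianStructure n X) (a : ℝ) (f : X → ℝ) :
    volIntegral g (fun x => a * f x) = a * volIntegral g f := by
  rw [volIntegral, volIntegral, ← TopForm.integral_smul]
  exact TopForm.integral_congr fun x => mul_smul _ _ _

theorem vol_eq (g : HermitianStructure n X) :
    vol g = 1 / n.factorial * volIntegral g fun _ => 1 := by
  rw [← volIntegral_const_mul, volIntegral, vol]
  simp only [mul_one]

theorem coeff_smul_topPower (g : HermitianStructure n X) (f : X → ℝ) (y : Fin n → ℂ) :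
    TopForm.coeff (fun x => f x • topPower (kaehlerForm g) x) c y =
      f (c.symm y) * (topPower (kaehlerForm g)).coeff c y := rfl

theorem partition_term_nonneg (g : HermitianStructure n X) {f : X → ℝ} (hf : ∀ x, 0 ≤ f x) (p : X)
    {y : Fin n → ℂ} (hy : y ∈ (chartAt (Fin n → ℂ) p).target) :
    0 ≤ chartPartition n X p ((chartAt (Fin n → ℂ) p).symm y) *
      TopForm.coeff (fun x => f x • topPower (kaehlerForm g) x) (chartAt (Fin n → ℂ) p) y := by
  rw [coeff_smul_topPower]
  exact mul_nonneg ((chartPartition n X).nonneg p _)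
    (mul_nonneg (hf _) (coeff_topPower_pos g (chart_mem_atlas _ _) hy).le)

theorem volIntegral_nonneg (g : HermitianStructure n X) {f : X → ℝ} (hf : ∀ x, 0 ≤ f x) :
    0 ≤ volIntegral g f := by
  rw [volIntegral, TopForm.integral_eq_sum]
  exact Finset.sum_nonneg fun p _ =>
    setIntegral_nonneg (chartAt (Fin n → ℂ) p).open_target.measurableSet
      fun y hy => partition_term_nonneg g hf p hy

/-- A non-negative continuous function with integral zero vanishes. -/
theorem eq_zero_of_volIntegral_eq_zero (g : HermitianStructure n X) {f : X → ℝ}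
    (hfc : Continuous f) (hf : ∀ x, 0 ≤ f x) (h : volIntegral g f = 0) (x : X) : f x = 0 := by
  rw [volIntegral, TopForm.integral_eq_sum, Finset.sum_eq_zero_iff_of_nonneg fun p _ =>
    setIntegral_nonneg (chartAt (Fin n → ℂ) p).open_target.measurableSet
      fun y hy => partition_term_nonneg g hf p hy] at h
  -- some function of the partition of unity is positive at `x`
  obtain ⟨p, hp, hpx⟩ : ∃ p ∈ partitionIndex n X, chartPartition n X p x ≠ 0 :=
    Finset.exists_ne_zero_of_sum_ne_zero (by rw [sum_chartPartition n x]; exact one_ne_zero)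
  set c := chartAt (Fin n → ℂ) p
  have hxc : x ∈ c.source := chartPartition_isSubordinate n p (subset_tsupport _ hpx)
  have hτ : TopForm.IsContinuous fun x => f x • topPower (kaehlerForm g) x :=
    (isContinuous_topPower g).fun_smul hfc
  have hae := (setIntegral_eq_zero_iff_of_nonneg_ae
    ((ae_restrict_iff' c.open_target.measurableSet).2 (Eventually.of_forall fun y hy =>
      partition_term_nonneg g hf p hy)) (hτ.integrableOn p)).1 (h p hp)
  have hcont : ContinuousOn (fun y => chartPartition n X p (c.symm y) *
      TopForm.coeff (fun x => f x • topPower (kaehlerForm g) x) c y) c.target :=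
    (continuousOn_comp_symm c (chartPartition_continuous p)).mul (hτ c (chart_mem_atlas _ _))
  have h0 := Measure.eqOn_open_of_ae_eq hae c.open_target hcont continuousOn_const
    (c.map_source hxc)
  have hpos := coeff_topPower_pos g (chart_mem_atlas (Fin n → ℂ) p) (c.map_source hxc)
  have hcx : c.symm (c x) = x := c.left_inv hxc
  simp only [coeff_smul_topPower, Pi.zero_apply] at h0
  change chartPartition n X p (c.symm (c x)) * (f (c.symm (c x)) * _) = 0 at h0
  rw [hcx] at h0
  rcases mul_eq_zero.1 h0 with h1 | h1
  · exact absurd h1 hpx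
  · exact (mul_eq_zero.1 h1).resolve_right hpos.ne'

end Compact

/-! ### The norm of an endomorphism -/

variable {r : ℕ} {E : X → Type*} [∀ x, AddCommGroup (E x)] [∀ x, Module ℂ (E x)]
  [∀ x, TopologicalSpace (E x)] [TopologicalSpace (TotalSpace (Fin r → ℂ) E)]
  [FiberBundle (Fin r → ℂ) E] [VectorBundle ℂ (Fin r → ℂ) E]

/-- In an orthonormal basis of the fibre the adjoint is the conjugate transpose. -/
theorem exists_basis_toMatrix_adjoint (h : HermitianMetric n r E) (x : X) :
    ∃ u : Module.Basis (Fin r) ℂ (E x), ∀ f : Module.End ℂ (E x),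
      LinearMap.toMatrix u u (h.adjoint x f) = (LinearMap.toMatrix u u f)ᴴ := by
  obtain ⟨u, hu⟩ := exists_orthonormal_basis
    (frameBasis (trivializationAt (Fin r → ℂ) E x) (mem_baseSet_trivializationAt _ _ x))
    (h.form x) (h.conj_symm x) (h.pos x)
  have hrepr : ∀ (w : E x) i, h.form x (u i) w = u.repr w i := by
    intro w i
    conv_lhs => rw [← u.sum_repr w]
    simp only [map_sum, map_smul, hu, smul_eq_mul, mul_ite, mul_one, mul_zero, Finset.sum_ite_eq,
      Finset.mem_univ, if_true]
  refine ⟨u, fun f => ?_⟩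
  ext i j
  have hadj : h.form x (h.adjoint x f (u j)) (u i) = h.form x (u j) (f (u i)) :=
    (h.exists_adjoint x f).choose_spec (u j) (u i)
  rw [Matrix.conjTranspose_apply, LinearMap.toMatrix_apply, LinearMap.toMatrix_apply, ← hrepr,
    ← hrepr, ← hadj, ← h.conj_symm]
  rfl

/-- In an orthonormal basis `|f|²` is the sum of the squared absolute values of the matrix entries. -/
theorem normSq_nonneg_and_definite (h : HermitianMetric n r E) (x : X) (f : Module.End ℂ (E x)) :
    0 ≤ h.normSq x f ∧ (h.normSq x f = 0 → f = 0) := by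
  obtain ⟨u, hu⟩ := exists_basis_toMatrix_adjoint h x
  have heq : h.normSq x f = ∑ i, ∑ j, Complex.normSq (LinearMap.toMatrix u u f i j) := by
    rw [HermitianMetric.normSq, LinearMap.trace_eq_matrix_trace ℂ u, LinearMap.toMatrix_mul, hu]
    simp [Matrix.trace, Matrix.mul_apply, Complex.mul_conj]
  have h0 : ∀ i, 0 ≤ ∑ j, Complex.normSq (LinearMap.toMatrix u u f i j) := fun i =>
    Finset.sum_nonneg fun j _ => Complex.normSq_nonneg _
  rw [heq]
  refine ⟨Finset.sum_nonneg fun i _ => h0 i, fun hz => ?_⟩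
  refine (LinearMap.toMatrix u u).injective ?_
  rw [map_zero]
  ext i j
  have h1 := (Finset.sum_eq_zero_iff_of_nonneg fun i _ => h0 i).1 hz i (Finset.mem_univ _)
  exact Complex.normSq_eq_zero.1 ((Finset.sum_eq_zero_iff_of_nonneg
    fun j _ => Complex.normSq_nonneg _).1 h1 j (Finset.mem_univ _))

theorem normSq_sub_smul_one (h : HermitianMetric n r E) (x : X) (f : Module.End ℂ (E x)) (a : ℝ) :
    h.normSq x (f - (a : ℂ) • 1) =
      h.normSq x f - 2 * a * (LinearMap.trace ℂ (E x) f).re + a ^ 2 * r := by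
  obtain ⟨u, hu⟩ := exists_basis_toMatrix_adjoint h x
  simp only [HermitianMetric.normSq, LinearMap.trace_eq_matrix_trace ℂ u, LinearMap.toMatrix_mul,
    hu, map_sub, map_smul, LinearMap.toMatrix_one]
  set M := LinearMap.toMatrix u u f
  have hM : (Matrix.trace Mᴴ).re = M.trace.re := by
    rw [Matrix.trace_conjTranspose]; rfl
  simp only [Matrix.conjTranspose_sub, Matrix.conjTranspose_smul, Matrix.conjTranspose_one, sub_mul,
    mul_sub, Matrix.smul_mul, Matrix.mul_smul, mul_one, one_mul, Matrix.trace_sub,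
    Matrix.trace_smul, Matrix.trace_one, Fintype.card_fin, smul_eq_mul, Complex.sub_re,
    RCLike.star_def, Complex.conj_ofReal, Complex.re_ofReal_mul, hM, Complex.natCast_re]
  ring

variable [ContMDiffVectorBundle ω (Fin r → ℂ) E 𝓘(ℂ, Fin n → ℂ)]

/-! ### The degree and the mean curvature -/

/-- The pointwise identity `2πn c₁(E, h) ∧ ωⁿ⁻¹ = (tr K) ωⁿ`. -/
theorem wedgePower_chernForm (hn : 1 ≤ n) (g : HermitianStructure n X) (φ : HiggsField n r E)
    (h : HermitianMetric n r E) (x : X) :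
    (2 * Real.pi * n) • wedgePower (chernForm h) (kaehlerForm g) x =
      (LinearMap.trace ℂ (E x) (meanCurvature g φ h x)).re • topPower (kaehlerForm g) x := by
  set β : (Fin n → ℂ) [⋀^Fin 2]→L[ℝ] ℝ := chernForm h x with hβ
  have hlam := wedgeAt_eq_lam (g.conj_symm x) (g.pos x) (Pi.basisFun ℂ (Fin n)) β ⟨0, hn⟩
  set L := lamWith (V := Fin n → ℂ) (g.form x) (Pi.basisFun ℂ (Fin n))
    (fun u v => ((β ![u, v] : ℝ) : ℂ)) with hL
  have htr : LinearMap.trace ℂ (E x) (meanCurvature g φ h x) = 2 * Real.pi * L := by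
    have h2 : (fun u v : Fin n → ℂ => LinearMap.trace ℂ (E x) (h.chernCurvature x u v)) =
        fun u v => (-(2 * Real.pi * Complex.I)) • ((β ![u, v] : ℝ) : ℂ) := by
      funext u v
      have hpi : (Real.pi : ℂ) ≠ 0 := Complex.ofReal_ne_zero.2 Real.pi_ne_zero
      have h3 : ((β ![u, v] : ℝ) : ℂ) = _ := chernForm_apply_coe h x u v
      rw [h3, smul_eq_mul]
      field_simp
      rw [Complex.I_sq]
      ring
    have h4 : Lam g x (fun u v => LinearMap.trace ℂ (E x) (h.chernCurvature x u v)) =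
        lamWith (V := Fin n → ℂ) (g.form x) (Pi.basisFun ℂ (Fin n))
          (fun u v => (-(2 * Real.pi * Complex.I)) • ((β ![u, v] : ℝ) : ℂ)) := by
      refine (Lam_eq_lamWith g x _).trans ?_
      have h5 : (fun i => Pi.single i 1) = ⇑(Pi.basisFun ℂ (Fin n)) := funext fun i => by simp
      exact congrArg₂ (fun (b : Fin n → Fin n → ℂ) ψ => lamWith (V := Fin n → ℂ) (g.form x) b ψ)
        h5 h2
    rw [trace_meanCurvature, h4]
    have h6 := linearMap_lamWith (V := Fin n → ℂ)
      (LinearMap.lsmul ℂ ℂ (-(2 * Real.pi * Complex.I))) (g.form x) (Pi.basisFun ℂ (Fin n))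
      (fun u v => ((β ![u, v] : ℝ) : ℂ))
    simp only [LinearMap.lsmul_apply] at h6
    refine (congrArg (Complex.I * ·) h6.symm).trans ?_
    change Complex.I * (-(2 * Real.pi * Complex.I) * L) = _
    linear_combination -(2 * Real.pi * L) * Complex.I_sq
  have hre : (LinearMap.trace ℂ (E x) (meanCurvature g φ h x)).re = 2 * Real.pi * L.re := by
    rw [htr]
    simp
  have hw : wedgePower (chernForm h) (kaehlerForm g) x = wedgeAt (fun k =>
      if k = ⟨0, hn⟩ then β else twoImForm (g.form x) (g.conj_symm x)) := by
    change wedgeAt (fun k => (if (k : ℕ) = 0 then chernForm h else kaehlerForm g) x) = _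
    congr 1
    funext k
    by_cases hk : (k : ℕ) = 0
    · rw [if_pos hk]
      exact (if_pos (Fin.ext hk)).symm
    · rw [if_neg hk]
      exact (if_neg fun h => hk (congrArg Fin.val h)).symm
  rw [hw, hre]
  ext v
  change 2 * Real.pi * n * wedgeAt _ v = 2 * Real.pi * L.re * wedgeAt _ v
  rw [mul_assoc (2 * Real.pi), mul_assoc (2 * Real.pi)]
  exact congrArg (2 * Real.pi * ·) (hlam v).2

section Compact

variable [T2Space X] [CompactSpace X]

theorem wedgePower_eq_slot (hn : 1 ≤ n) (β α : DForm n X 2) :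
    wedgePower β α = wedge fun k => if k = ⟨0, hn⟩ then β else α := by
  rw [wedgePower]
  congr 1
  funext k
  simp [Fin.ext_iff]

/-- The integral `∫ β ∧ ωⁿ⁻¹` is the same for all forms representing the first Chern class. -/
theorem integral_wedgePower_eq (hn : 1 ≤ n) {g : HermitianStructure n X} (hg : IsKaehler g)
    {β β' : DForm n X 2} (hβ : RepresentsFirstChernClass n r E β)
    (hβ' : RepresentsFirstChernClass n r E β') :
    (wedgePower β (kaehlerForm g)).integral = (wedgePower β' (kaehlerForm g)).integral := by
  have key : ∀ {α α' : DForm n X 2}, Cohomologous α α' → α.IsSmooth →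
      (wedgePower α' (kaehlerForm g)).integral = (wedgePower α (kaehlerForm g)).integral := by
    intro α α' h hα
    rw [wedgePower_eq_slot hn, wedgePower_eq_slot hn]
    exact integral_wedge_slot_congr h hα (fun _ => kaehlerForm g) ⟨0, hn⟩
      fun _ _ => isClosedForm_kaehlerForm hg
  obtain ⟨h, hh⟩ := hβ.exists_cohomologous
  obtain ⟨h', hh'⟩ := hβ'.exists_cohomologous
  rw [key hh (isClosedForm_chernForm h).smooth, key hh' (isClosedForm_chernForm h').smooth,
    key (cohomologous_chernForm h h') (isClosedForm_chernForm h).smooth]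

theorem integral_wedgePower_eq_degree (hn : 1 ≤ n) {g : HermitianStructure n X} (hg : IsKaehler g)
    {β : DForm n X 2} (hβ : RepresentsFirstChernClass n r E β) :
    (wedgePower β (kaehlerForm g)).integral = degree r E g :=
  integral_wedgePower_eq hn hg hβ (Classical.epsilon_spec ⟨β, hβ⟩)

/-- The mean value of `tr K` is topological. -/
theorem volIntegral_trace_meanCurvature (hn : 1 ≤ n) {g : HermitianStructure n X}
    (hg : IsKaehler g) (φ : HiggsField n r E) (h : HermitianMetric n r E) :
    volIntegral g (fun x => (LinearMap.trace ℂ (E x) (meanCurvature g φ h x)).re) =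
      2 * Real.pi * n * degree r E g := by
  rw [← integral_wedgePower_eq_degree hn hg (representsFirstChernClass_chernForm h),
    ← TopForm.integral_smul]
  exact TopForm.integral_congr fun x => (wedgePower_chernForm hn g φ h x).symm

/-- The squared `L²`-distance of `K` to the scalar endomorphism `a`. -/
theorem volIntegral_normSq_sub (hn : 1 ≤ n) {g : HermitianStructure n X} (hg : IsKaehler g)
    (φ : HiggsField n r E) (h : HermitianMetric n r E) (a : ℝ) :
    volIntegral g (fun x => h.normSq x (meanCurvature g φ h x - (a : ℂ) • 1)) =
      2 * kobayashi g φ h - 2 * a * (2 * Real.pi * n * degree r E g) +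
        a ^ 2 * r * (n.factorial * vol g) := by
  have hκ := continuous_normSq_meanCurvature g φ h
  have hτ := continuous_trace_meanCurvature g φ h
  have h1 : (fun x => h.normSq x (meanCurvature g φ h x - (a : ℂ) • 1)) = fun x =>
      (h.normSq x (meanCurvature g φ h x) +
        (-(2 * a)) * (LinearMap.trace ℂ (E x) (meanCurvature g φ h x)).re) + a ^ 2 * r * 1 := by
    funext x
    rw [normSq_sub_smul_one]
    ring
  have hτ' : Continuous fun x =>
      (-(2 * a)) * (LinearMap.trace ℂ (E x) (meanCurvature g φ h x)).re := continuous_const.mul hτ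
  have hκτ : Continuous fun x => h.normSq x (meanCurvature g φ h x) +
      (-(2 * a)) * (LinearMap.trace ℂ (E x) (meanCurvature g φ h x)).re := hκ.add hτ'
  rw [h1, volIntegral_add g hκτ continuous_const, volIntegral_add g hκ hτ', volIntegral_const_mul,
    volIntegral_const_mul,
    volIntegral_trace_meanCurvature hn hg, vol_eq]
  have hf : (n.factorial : ℝ) ≠ 0 := Nat.cast_ne_zero.2 n.factorial_ne_zero
  have hJ : volIntegral g (fun x => h.normSq x (meanCurvature g φ h x)) =
      2 * kobayashi g φ h := by
    rw [kobayashi, volIntegral]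
    ring
  rw [hJ]
  field_simp
  ring

/-- The excess of the Kobayashi functional over its lower bound is half the squared `L²`-distance
of `K` to the scalar endomorphism `c`. -/
theorem kobayashi_sub_lowerBound (hn : 1 ≤ n) (hr : 1 ≤ r) {g : HermitianStructure n X}
    (hg : IsKaehler g) (φ : HiggsField n r E) (h : HermitianMetric n r E) :
    2 * (kobayashi g φ h - lowerBound r E g) = volIntegral g (fun x =>
      h.normSq x (meanCurvature g φ h x - (hymConstant r E g : ℂ) • 1)) := by
  rw [volIntegral_normSq_sub hn hg, hymConstant, lowerBound]
  have hfac : (n.factorial : ℝ) = n * (n - 1).factorial := by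
    exact_mod_cast (Nat.mul_factorial_pred (by omega)).symm
  have hf : ((n - 1).factorial : ℝ) ≠ 0 := Nat.cast_ne_zero.2 (Nat.factorial_ne_zero _)
  have hn0 : (n : ℝ) ≠ 0 := by positivity
  have hr0 : (r : ℝ) ≠ 0 := by positivity
  rw [hfac]
  by_cases hv : vol g = 0
  -- `X` is empty; both constants are quotients by zero and vanish
  · simp [hv]
  · field_simp
    ring

theorem vol_eq_of_cohomologous {g g' : HermitianStructure n X} (hg : IsKaehler g)
    (hg' : IsKaehler g') (h : Cohomologous (kaehlerForm g) (kaehlerForm g')) :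
    vol g' = vol g := by
  rw [vol, vol, TopForm.integral_smul, TopForm.integral_smul]
  congr 1
  exact integral_wedge_congr (fun _ => h) (fun _ => isClosedForm_kaehlerForm hg)
    fun _ => isClosedForm_kaehlerForm hg'

theorem integral_wedgePower_eq_of_cohomologous {g g' : HermitianStructure n X}
    (hg : IsKaehler g) (hg' : IsKaehler g')
    (h : Cohomologous (kaehlerForm g) (kaehlerForm g')) {β : DForm n X 2} (hβ : β.IsClosedForm) :
    (wedgePower β (kaehlerForm g')).integral = (wedgePower β (kaehlerForm g)).integral := by
  refine integral_wedge_congr (fun k => ?_) (fun k => ?_) fun k => ?_ <;> split_ifs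
  · exact cohomologous_refl β
  · exact h
  · exact hβ
  · exact isClosedForm_kaehlerForm hg
  · exact hβ
  · exact isClosedForm_kaehlerForm hg'

end Compact

end Functional

end HiggsKaehler

end

theorem mainTheorem1 {n r : ℕ} (hn : 1 ≤ n) (hr : 1 ≤ r)
    {X : Type*} [TopologicalSpace X] [T2Space X] [CompactSpace X]
    [ChartedSpace (Fin n → ℂ) X] [IsManifold 𝓘(ℂ, Fin n → ℂ) ω X]
    {E : X → Type*} [∀ x, AddCommGroup (E x)] [∀ x, Module ℂ (E x)] [∀ x, TopologicalSpace (E x)]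
    [TopologicalSpace (TotalSpace (Fin r → ℂ) E)] [FiberBundle (Fin r → ℂ) E]
    [VectorBundle ℂ (Fin r → ℂ) E]
    [ContMDiffVectorBundle ω (Fin r → ℂ) E 𝓘(ℂ, Fin n → ℂ)]
    (φ : HiggsKaehler.HiggsField n r E)
    (g : HiggsKaehler.HermitianStructure n X) (hg : HiggsKaehler.IsKaehler g) :
    -- the degree is the integral of `β ∧ ωⁿ⁻¹` for every form `β` representing the Chern class
    (∀ β : HiggsKaehler.DForm n X 2, HiggsKaehler.RepresentsFirstChernClass n r E β →
      (HiggsKaehler.wedgePower β (HiggsKaehler.kaehlerForm g)).integral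
        = HiggsKaehler.degree r E g) ∧
    -- the lower bound
    (∀ h : HiggsKaehler.HermitianMetric n r E,
      HiggsKaehler.lowerBound r E g ≤ HiggsKaehler.kobayashi g φ h) ∧
    -- the case of equality
    (∀ h₀ : HiggsKaehler.HermitianMetric n r E,
      HiggsKaehler.kobayashi g φ h₀ = HiggsKaehler.lowerBound r E g ↔
        HiggsKaehler.IsHermiteYangMills g φ h₀) ∧
    -- the bound depends only on the rank, on the first Chern class and on the Kähler class
    (∀ (E' : X → Type*) [∀ x, AddCommGroup (E' x)] [∀ x, Module ℂ (E' x)]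
      [∀ x, TopologicalSpace (E' x)] [TopologicalSpace (TotalSpace (Fin r → ℂ) E')]
      [FiberBundle (Fin r → ℂ) E'] [VectorBundle ℂ (Fin r → ℂ) E']
      [ContMDiffVectorBundle ω (Fin r → ℂ) E' 𝓘(ℂ, Fin n → ℂ)]
      (g' : HiggsKaehler.HermitianStructure n X), HiggsKaehler.IsKaehler g' →
      HiggsKaehler.Cohomologous (HiggsKaehler.kaehlerForm g) (HiggsKaehler.kaehlerForm g') →
      (∃ β : HiggsKaehler.DForm n X 2, HiggsKaehler.RepresentsFirstChernClass n r E β ∧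
        HiggsKaehler.RepresentsFirstChernClass n r E' β) →
      HiggsKaehler.lowerBound r E' g' = HiggsKaehler.lowerBound r E g) := by
  refine ⟨fun β hβ => HiggsKaehler.integral_wedgePower_eq_degree hn hg hβ, fun h => ?_,
    fun h => ?_, fun E' _ _ _ _ _ _ _ g' hg' hgg' hEE' => ?_⟩
  · have h1 := HiggsKaehler.kobayashi_sub_lowerBound hn hr hg φ h
    have h2 := HiggsKaehler.volIntegral_nonneg g fun x =>
      (HiggsKaehler.normSq_nonneg_and_definite h x (HiggsKaehler.meanCurvature g φ h x -
        (HiggsKaehler.hymConstant r E g : ℂ) • 1)).1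
    linarith
  · have h1 := HiggsKaehler.kobayashi_sub_lowerBound hn hr hg φ h
    have hpos := fun x => HiggsKaehler.normSq_nonneg_and_definite h x
      (HiggsKaehler.meanCurvature g φ h x - (HiggsKaehler.hymConstant r E g : ℂ) • 1)
    constructor
    · intro heq x
      rw [heq, sub_self, mul_zero] at h1
      have hcont : Continuous fun x => h.normSq x (HiggsKaehler.meanCurvature g φ h x -
          (HiggsKaehler.hymConstant r E g : ℂ) • 1) := by
        simp only [HiggsKaehler.normSq_sub_smul_one]
        exact ((HiggsKaehler.continuous_normSq_meanCurvature g φ h).sub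
          (continuous_const.mul (HiggsKaehler.continuous_trace_meanCurvature g φ h))).add
          continuous_const
      exact sub_eq_zero.1 ((hpos x).2 (HiggsKaehler.eq_zero_of_volIntegral_eq_zero g hcont
        (fun x => (hpos x).1) h1.symm x))
    · intro hK
      have h0 : (fun x => h.normSq x (HiggsKaehler.meanCurvature g φ h x -
          (HiggsKaehler.hymConstant r E g : ℂ) • 1)) = fun x => 0 * (1 : ℝ) := by
        funext x
        rw [hK x, sub_self, HiggsKaehler.HermitianMetric.normSq, zero_mul, map_zero]
        simp
      rw [h0, HiggsKaehler.volIntegral_const_mul, zero_mul] at h1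
      linarith
  · obtain ⟨β, hβ, hβ'⟩ := hEE'
    rw [HiggsKaehler.lowerBound, HiggsKaehler.lowerBound,
      HiggsKaehler.vol_eq_of_cohomologous hg hg' hgg',
      ← HiggsKaehler.integral_wedgePower_eq_degree hn hg hβ,
      ← HiggsKaehler.integral_wedgePower_eq_degree hn hg' hβ',
      HiggsKaehler.integral_wedgePower_eq_of_cohomologous hg hg' hgg' hβ.isClosedForm]
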